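/- **Theorem (Triangle estimation).** For a finite simple graph $G=(V,E)$ let $m=|E|$, let $T$ be its number of triangles, and let $\Delta_V$ and $\Delta_E$ be the maximum number of triangles sharing a common vertex and a common edge. *One run.* A run has parameters $k\ge 1$ and $0<\omega\le\sqrt k$; put $L=\lceil\log_2(\sqrt k/\omega)\rceil$ and assume $\sum_{h=0}^{L}\frac1{\omega 2^h}\le 1$. Given a guess $\widetilde T$, draw independent random functions (with independent values) $d_1,d_2,c:V\to\{0,1\}$ taking the value $1$ with probability $1/\sqrt k$; $h:V\to\{0,\dots,L\}\cup\{-\infty\}$ with $\Pr[h(v)=j]=\frac1{\omega2^j}$; and $r_1,r_2,r_C$, uniform in $[0,1]$ on the unordered pairs of vertices. The run keeps an edge of the input if, for one of its two orientations $uv$ and some $i\in\{1,2\}$, one of the following holds: $d_i(u)=d_i(v)=1$; $c(u)=d_i(v)=1$; $c(u)=c(v)=1$; $r_i(uv)<\omega2^{h(u)}/\sqrt k$ and $d_i(v)=1$; $r_C(uv)<\omega2^{h(u)}/\sqrt k$ and $c(v)=1$. Everything else is computed in the graph $H$ of kept edges. Let $X_{v,i}^{(h)}$ be the number of triangles $\{u,v,w\}$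 of $H$ with $d_i(u)=d_i(w)=1$ and $r_i(vu),r_i(vw)<\omega2^h/\sqrt k$. Let $\mathcal T_v$ be the least $h\in\{0,\dots,L\}$ with $X_{v,i}^{(h)}\ge\omega\widetilde T2^h/k^2$ for some $i\in\{1,2\}$; if there is none, $v$ is called light, and otherwise heavy. The run returns $\overline{T_L}+\overline{T_H}$, where $\overline{T_L}$ is $k^{3/2}$ times the number of triangles of $H$ all of whose vertices are light with $c=1$, and $\overline{T_H}$ is the sum, over all heavy $v$ with $h(v)=\mathcal T_v$ and all triangles $\{u,v,w\}$ of $H$ with $c(u)=c(w)=1$ and $r_C(vu),r_C(vw)<\omega2^{\mathcal T_v}/\sqrt k$, of $\frac{k^2}{\omega2^{\mathcal T_v}}$ divided by the number of heavy vertices of the triangle. *The algorithm.* The algorithm makes one pass over the stream of edges, performs several independent runs in parallel, arranged in blocks of equal size, and keeps exactly the edges that at least one run keeps. It forms the median $\overline T$ of the block means of the run estimates. It outputs $\overline T$ if $\overline T\ge\frac34\widetilde T$, and otherwise it reports that $\widetilde T>T$. *Claim.* There are an absolute constant $A>0$ and a choice of $k$, $\omega$, the block size and the number of blocks as functions of $(\varepsilon,\delta,\widetilde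 T,D_V,D_E)$ only, such that for all $0<\varepsilon\le1$, $0<\delta\le\frac12$, real $\widetilde T\ge1$, natural numbers $D_V,D_E$, every finite graph $G$ with $\Delta_V\le D_V$ and $\Delta_E\le D_E$ (in particular for $D_V=\Delta_V$, $D_E=\Delta_E$), and every order of the edges in the stream: 1. the expected number of edges kept is at most $$A\cdot\frac{m\log\frac1\delta}{\varepsilon^2}\left(\frac1{\widetilde T^{2/3}}+\frac{\sqrt{D_V}\,\log\widetilde T}{\widetilde T}+\frac{D_E\log\widetilde T}{\widetilde T}\right);$$ 2. if $\widetilde T\le T$, then with probability at least $1-\delta$ the algorithm outputs a number $x$ with $|x-T|\le\varepsilon T$; 3. if $\widetilde T>T$, then with probability at least $1-\delta$ the algorithm reports that $\widetilde T>T$ or outputs a number $x$ with $|x-T|\le\varepsilon T$. -/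

import Mathlib

open MeasureTheory
open scoped ENNReal

universe u

noncomputable section

namespace TriangleSampling

/-! ### Triangle statistics of a finite graph -/

section Graph

variable {V : Type u} [Fintype V] [DecidableEq V]

open Classical in
/-- The triangles of `G`, as three-element vertex sets. -/
def triangles (G : SimpleGraph V) : Finset (Finset V) := G.cliqueFinset 3

/-- `T(G)`, the number of triangles. -/
def numTriangles (G : SimpleGraph V) : ℕ := (triangles G).card

/-- `τ(v)`, the set of triangles through the vertex `v`. -/
def trianglesAt (G : SimpleGraph V) (v : V) : Finset (Finset V) :=
  (triangles G).filter (fun t => v ∈ t)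

/-- `Δ_V`, the maximum number of triangles sharing a common vertex. -/
def maxVertexTriangles (G : SimpleGraph V) : ℕ :=
  Finset.univ.sup (fun v => (trianglesAt G v).card)

open Classical in
/-- `Δ_E`, the maximum number of triangles sharing a common edge. -/
def maxEdgeTriangles (G : SimpleGraph V) : ℕ :=
  (Finset.univ.filter (fun e : Sym2 V => e ∈ G.edgeSet)).sup
    (fun e => ((triangles G).filter (fun t => ∀ x ∈ e, x ∈ t)).card)

end Graph

/-! ### Parameters and random seed -/

/-- `⌈log₂ (√k / ω)⌉`, the index of the largest scale. -/
def topScale (k ω : ℝ) : ℕ := ⌈Real.logb 2 (√k / ω)⌉₊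

/-- The parameters of the algorithm: vertices are sampled at rate `1 / √k`, heavy vertices are
given one of the weights `ω 2 ^ h` with `0 ≤ h ≤ topScale k ω`, and the whole procedure is
repeated in `numBlocks` blocks of `blockSize` independent runs. The last field says that the
probabilities `1 / (ω 2 ^ h)` of the random scale of a vertex add up to at most one. -/
structure Params where
  k : ℝ
  ω : ℝ
  blockSize : ℕ
  numBlocks : ℕ
  one_le_k : 1 ≤ k
  ω_pos : 0 < ω
  ω_le : ω ≤ √k
  blockSize_pos : 0 < blockSize
  numBlocks_pos : 0 < numBlocks
  scale_prob_le : ∑ h ∈ Finset.range (topScale k ω + 1), 1 / (ω * 2 ^ h) ≤ 1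

namespace Params

variable (P : Params)

/-- The index of the largest scale. -/
def top : ℕ := topScale P.k P.ω

/-- The weight `ω 2 ^ h` of scale `h`. -/
def weight (h : ℕ) : ℝ := P.ω * 2 ^ h

/-- The event of probability `1 / √k`, for a uniform `x ∈ [0,1]`. -/
def Picks (x : unitInterval) : Prop := (x : ℝ) < 1 / √P.k

/-- The event of probability `min 1 (ω 2 ^ h / √k)`, for a uniform `x ∈ [0,1]`. -/
def Below (h : ℕ) (x : unitInterval) : Prop := (x : ℝ) < P.weight h / √P.k

/-- The event that the uniform `x ∈ [0,1]` selects the scale `h`. For distinct `h ≤ top` these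
events are disjoint, with probabilities `1 / (ω 2 ^ h)`; no scale is selected otherwise. -/
def Selects (h : ℕ) (x : unitInterval) : Prop :=
  h ≤ P.top ∧ ∑ j ∈ Finset.range h, 1 / P.weight j ≤ (x : ℝ) ∧
    (x : ℝ) < ∑ j ∈ Finset.range (h + 1), 1 / P.weight j

end Params

/-- The random hash functions of one run, all of whose values are independent and uniform on
`[0,1]`: in this order those behind `d₁, d₂`, then `r_{D,1}, r_{D,2}`, then those behind `c` and
`h`, and finally `r_C`. Hash functions of edges are functions of unordered pairs of vertices. -/
abbrev RunSeed (V : Type u) : Type u :=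
  (Fin 2 × V → unitInterval) × (Fin 2 × Sym2 V → unitInterval) ×
    (V → unitInterval) × (V → unitInterval) × (Sym2 V → unitInterval)

/-- Independent seeds for all runs: `numBlocks` blocks of `blockSize` runs each. -/
abbrev Seed (P : Params) (V : Type u) : Type u :=
  Fin P.numBlocks × Fin P.blockSize → RunSeed V

/-! ### A single run -/

section Run

variable {V : Type u} [Fintype V] [DecidableEq V] (P : Params) (s : RunSeed V)

/-- `d_i(v) = 1`. -/
def D (i : Fin 2) (v : V) : Prop := P.Picks (s.1 (i, v))

/-- `r_{D,i}(e) < ω 2 ^ h / √k`. -/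
def RD (i : Fin 2) (h : ℕ) (e : Sym2 V) : Prop := P.Below h (s.2.1 (i, e))

/-- `c(v) = 1`. -/
def C (v : V) : Prop := P.Picks (s.2.2.1 v)

/-- `h(v) = h`. -/
def Scale (v : V) (h : ℕ) : Prop := P.Selects h (s.2.2.2.1 v)

/-- `r_C(e) < ω 2 ^ h / √k`. -/
def RC (h : ℕ) (e : Sym2 V) : Prop := P.Below h (s.2.2.2.2 e)

/-- The ordered pairs that the run wants to keep; this does not depend on the graph. -/
def KeepsPair (u v : V) : Prop :=
  (∃ i, D P s i u ∧ D P s i v) ∨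
  (∃ i, C P s u ∧ D P s i v) ∨
  (C P s u ∧ C P s v) ∨
  (∃ i h, Scale P s u h ∧ RD P s i h s(u, v) ∧ D P s i v) ∨
  (∃ h, Scale P s u h ∧ RC P s h s(u, v) ∧ C P s v)

/-- The unordered pairs that the run wants to keep (in at least one of the two orders). -/
def keepSet : Set (Sym2 V) := {e | ∃ u v, e = s(u, v) ∧ KeepsPair P s u v}

open Classical in
/-- `X_{v,i}^{(h)}` computed in the graph `H`: the number of triangles through `v` whose two other
vertices `u` all satisfy `d_i(u) = 1` and `r_{D,i}(vu) < ω 2 ^ h / √k`. -/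
def X (H : SimpleGraph V) (i : Fin 2) (h : ℕ) (v : V) : ℕ :=
  ((trianglesAt H v).filter
    (fun t => ∀ u ∈ t, u ≠ v → D P s i u ∧ RD P s i h s(v, u))).card

open Classical in
/-- `𝒯_{v,i}` computed in `H` for the guess `Tg`: the least scale `h` with
`X_{v,i}^{(h)} ≥ ω Tg 2 ^ h / k ^ 2`, and `⊤` (the vertex looks light) if there is none. -/
def levelOf (Tg : ℝ) (H : SimpleGraph V) (i : Fin 2) (v : V) : WithTop ℕ :=
  ((Finset.range (P.top + 1)).filter
    (fun h => P.ω * Tg * 2 ^ h / P.k ^ 2 ≤ (X P s H i h v : ℝ))).min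

/-- `𝒯_v`, the smaller of the two levels. -/
def level (Tg : ℝ) (H : SimpleGraph V) (v : V) : WithTop ℕ :=
  min (levelOf P s Tg H 0 v) (levelOf P s Tg H 1 v)

open Classical in
/-- The estimate of the number of triangles without heavy vertices. -/
def lightEstimate (Tg : ℝ) (H : SimpleGraph V) : ℝ :=
  P.k ^ (3 / 2 : ℝ) *
    ((triangles H).filter (fun t => ∀ v ∈ t, level P s Tg H v = ⊤ ∧ C P s v)).card

open Classical in
/-- `T̄_v` for a vertex `v` of level `h`: every triangle through `v` whose two other vertices `u`
satisfy `c(u) = 1` and `r_C(vu) < ω 2 ^ h / √k` adds `k ^ 2 / (ω 2 ^ h)`, divided by the number of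
heavy vertices of the triangle. -/
def vertexEstimate (Tg : ℝ) (H : SimpleGraph V) (v : V) (h : ℕ) : ℝ :=
  ∑ t ∈ (trianglesAt H v).filter (fun t => ∀ u ∈ t, u ≠ v → C P s u ∧ RC P s h s(v, u)),
    P.k ^ 2 / P.weight h * (1 / ((t.filter (fun x => level P s Tg H x ≠ ⊤)).card : ℝ))

open Classical in
/-- The estimate of the number of triangles with a heavy vertex: the sum of `T̄_v` over the heavy
vertices `v` with `h(v) = 𝒯_v`. -/
def heavyEstimate (Tg : ℝ) (H : SimpleGraph V) : ℝ :=
  ∑ v : V, ∑ h ∈ (Finset.range (P.top + 1)).filter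
    (fun h : ℕ => level P s Tg H v = (h : WithTop ℕ) ∧ Scale P s v h), vertexEstimate P s Tg H v h

/-- The estimate `T̄` returned by one run. -/
def runEstimate (Tg : ℝ) (H : SimpleGraph V) : ℝ :=
  lightEstimate P s Tg H + heavyEstimate P s Tg H

end Run

/-! ### The full algorithm -/

section Algorithm

variable {V : Type u} [Fintype V] [DecidableEq V]

open Classical in
/-- The single pass over the stream of edges: an arriving edge is kept if and only if some run
wants to keep it, and nothing else is stored. -/
def onePass (P : Params) (σ : Seed P V) (stream : List (Sym2 V)) : Finset (Sym2 V) :=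
  stream.foldl (fun K e => if ∃ i, e ∈ keepSet P (σ i) then insert e K else K) ∅

/-- The (lower) median of `n` real numbers. -/
def median {n : ℕ} (f : Fin n → ℝ) : ℝ :=
  sInf {x : ℝ | n ≤ 2 * (Finset.univ.filter (fun i => f i ≤ x)).card}

/-- The final estimate, computed from the kept edges `K` and the seed only: the median of the
block means of the run estimates, where each run sees only the edges that it wanted to keep. -/
def finalEstimate (P : Params) (Tg : ℝ) (σ : Seed P V) (K : Finset (Sym2 V)) : ℝ :=
  median (fun a => (∑ b, runEstimate P (σ (a, b)) Tg
    (SimpleGraph.fromEdgeSet ((K : Set (Sym2 V)) ∩ keepSet P (σ (a, b))))) / P.blockSize)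

open Classical in
/-- The output of the algorithm on a stream of edges: the final estimate if it is at least
`3 Tg / 4`, and otherwise `none`, the report that `Tg` exceeds the number of triangles. -/
def output (P : Params) (Tg : ℝ) (stream : List (Sym2 V)) (σ : Seed P V) : Option ℝ :=
  if 3 / 4 * Tg ≤ finalEstimate P Tg σ (onePass P σ stream) then
    some (finalEstimate P Tg σ (onePass P σ stream))
  else none

/-- The output is an estimate `x` with `(1 - ε) T ≤ x ≤ (1 + ε) T`. -/
def IsApprox (ε T : ℝ) (out : Option ℝ) : Prop := ∃ x, out = some x ∧ |x - T| ≤ ε * T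

end Algorithm

end TriangleSampling

end

/-!
A run can be analysed as if it knew the whole graph: every edge that its estimate depends on is
among the edges that it keeps, so the estimate computed from the kept edges is the estimate
computed from `G` (`runEstimate_visibleGraph`, `finalEstimate_onePass`). The levels `𝒯_v` depend
only on `d_i` and `r_i`, so they are independent of `c`, `h` and `r_C`, and moments are computed
by integrating over the latter first.

*Mean.* The parameters are chosen such that `ω 2 ^ L = √k` exactly. Then all thresholds
`ω 2 ^ h / √k` are probabilities, and given the levels a triangle without heavy vertices is counted with
weight `k ^ (3 / 2)` and probability `k ^ (-3 / 2)`, while at each heavy vertex of level `h` any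
other triangle is counted with weight `k ^ 2 / (ω 2 ^ h)` and probability `(ω 2 ^ h) / k ^ 2`, up
to its share, the inverse of its number of heavy vertices. So the estimate is unbiased whatever
the levels are (`integral_runEstimate`), and its variance is the mean of the variance given the
levels.

*Variance.* Given the levels, the variance is a sum of covariances of indicators. Write `τ` for
the number of triangles at `v`. Beyond terms that `k ^ (3 / 2) ≤ Tg` and `k D_E ≤ Tg` bound
directly, light vertices contribute `√k τ ^ 2`, heavy vertices contribute their weight `ω 2 ^ 𝒯_v`
times `τ ^ 2`, and triangles counted at different heavy vertices contribute `√k Δ_E T` for each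
heavy vertex (`integral_lightSum_sub_sq_le`, `integral_heavySum_sub_sq_le`). The three are
controlled in the mean over the levels. By Chebyshev's inequality a test of weight `w` fails with
probability `O(Tg / (τ w))`, and both copies fail with probability at most the square of this
(`volume_real_fails_le`). Thus the expected contribution of a light vertex is `O(Tg τ)`. The
weight of the level of a heavy vertex is `ω` plus the sum of the weights of the failed scales
(`sum_weight_mul_sq_le`), with an expected contribution of at most `τ ^ 2` times the sum over the
weights `w` of `w min 1 ((12 Tg / (τ w)) ^ 2)`; this dyadic sum is `O(Tg / τ)` because of the square
(`sum_le_of_le_weight`). By Markov's inequality `v` is heavy with probability `O(√k τ / Tg)`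
(`volume_real_heavy_le`), which bounds the expected number of heavy vertices. Since the numbers
`τ` add up to `3 T`, the variance of a run is `O(max T Tg ^ 2)`
(`integral_runEstimate_sub_sq_le_max`). If `k = 1`, there is no variance at all.

*Amplification.* The mean of a block of `O(1 / ε ^ 2)` runs is off by `ε / 8 * max T Tg` with
probability at most `1 / 16`, and the median of `O(log (1 / δ))` block means fails with
probability at most `δ` (`exists_volume_le_final`). An estimate above `3 / 4 * Tg` then forces
`T ≥ 5 / 8 * Tg`, so that `ε / 8 * Tg` is at most `ε T`.

*Space.* Each of the `O(L + 1)` ways of keeping an edge has probability `1 / k`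
(`volume_real_keepsPair_le`). With `k = max 1 (Tg / max (Tg ^ (1 / 3)) (max D_E √D_V))` and `ω`
within a factor two of `max 2 (k ^ 2 / Tg)`, or a single scale, all conditions above hold and
`(L + 1) / k` is of the required order (`exists_params`).
-/

namespace TriangleSampling

/-! ### Product measures -/

section Product

theorem measurePreserving_uncurry {α β γ : Type*} [Fintype α] [Fintype β] [MeasureSpace γ]
    [SigmaFinite (volume : Measure γ)] :
    MeasurePreserving (fun (f : α → β → γ) (p : α × β) => f p.1 p.2) := by
  refine ⟨by fun_prop, (Measure.pi_eq fun s hs => ?_).symm⟩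
  rw [Measure.map_apply (by fun_prop) (MeasurableSet.univ_pi hs)]
  have : (fun (f : α → β → γ) (p : α × β) => f p.1 p.2) ⁻¹' Set.univ.pi s
      = Set.univ.pi fun a => Set.univ.pi fun b => s (a, b) := by
    ext f; simp [Set.mem_pi]
  rw [this, volume_pi, Measure.pi_pi, Fintype.prod_prod_type]
  refine Finset.prod_congr rfl fun a _ => ?_
  rw [volume_pi, Measure.pi_pi]

theorem measurePreserving_curry {α β γ : Type*} [Fintype α] [Fintype β] [MeasureSpace γ]
    [SigmaFinite (volume : Measure γ)] :
    MeasurePreserving (fun (f : α × β → γ) (a : α) (b : β) => f (a, b)) := by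
  refine ⟨by fun_prop, ?_⟩
  conv_lhs => rw [← (measurePreserving_uncurry (α := α) (β := β) (γ := γ)).map_eq]
  rw [Measure.map_map (by fun_prop) (by fun_prop)]
  exact Measure.map_id

/-- The probability that finitely many of the independent coordinates satisfy constraints. -/
theorem volume_real_forall_mem {ι γ : Type*} [Fintype ι] [DecidableEq ι] [MeasureSpace γ]
    [IsProbabilityMeasure (volume : Measure γ)] (S : Finset ι) (A : ι → Set γ) :
    volume.real {x : ι → γ | ∀ i ∈ S, x i ∈ A i} = ∏ i ∈ S, volume.real (A i) := by
  have : {x : ι → γ | ∀ i ∈ S, x i ∈ A i}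
      = Set.univ.pi fun i => if i ∈ S then A i else Set.univ := by
    ext x
    simp only [Set.mem_ofPred_eq, Set.mem_pi, Set.mem_univ, true_implies]
    refine forall_congr' fun i => ?_
    split_ifs with h <;> simp [h]
  rw [this, Measure.real, volume_pi, Measure.pi_pi, ENNReal.toReal_prod,
    ← Finset.prod_subset (Finset.subset_univ S)]
  · refine Finset.prod_congr rfl fun i hi => ?_
    simp [hi, Measure.real]
  · intro i _ hi
    simp [hi]

theorem volume_real_coe_lt {a : ℝ} (h0 : 0 ≤ a) (h1 : a ≤ 1) :
    volume.real {x : unitInterval | (x : ℝ) < a} = a := by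
  have : {x : unitInterval | (x : ℝ) < a} = Set.Iio ⟨a, h0, h1⟩ := by
    ext x; simp [← Subtype.coe_lt_coe]
  rw [this, Measure.real, unitInterval.volume_Iio, ENNReal.toReal_ofReal h0]

theorem volume_real_coe_mem_Ico {a b : ℝ} (h0 : 0 ≤ a) (hab : a ≤ b) (h1 : b ≤ 1) :
    volume.real {x : unitInterval | a ≤ (x : ℝ) ∧ (x : ℝ) < b} = b - a := by
  have : {x : unitInterval | a ≤ (x : ℝ) ∧ (x : ℝ) < b}
      = Set.Ico ⟨a, h0, hab.trans h1⟩ ⟨b, h0.trans hab, h1⟩ := by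
    ext x; simp [← Subtype.coe_lt_coe, ← Subtype.coe_le_coe]
  rw [this, Measure.real, unitInterval.volume_Ico, ENNReal.toReal_ofReal (by simpa using hab)]

end Product

/-! ### Weighted sums of indicators -/

section SecondMoment

variable {Ω ι : Type*} [MeasurableSpace Ω] (μ : Measure Ω) [IsProbabilityMeasure μ]

theorem integrable_indicator_one {E : Set Ω} (hE : MeasurableSet E) (c : ℝ) :
    Integrable (fun x => E.indicator (fun _ => c) x) μ :=
  (integrable_const c).indicator hE

theorem integral_sum_indicator (J : Finset ι) (a : ι → ℝ) (E : ι → Set Ω)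
    (hE : ∀ j ∈ J, MeasurableSet (E j)) :
    ∫ x, ∑ j ∈ J, (E j).indicator (fun _ => a j) x ∂μ = ∑ j ∈ J, a j * μ.real (E j) := by
  rw [integral_finsetSum _ fun j hj => integrable_indicator_one μ (hE j hj) _]
  refine Finset.sum_congr rfl fun j hj => ?_
  rw [integral_indicator_const _ (hE j hj), smul_eq_mul, mul_comm]

/-- The variance of a weighted sum of indicators is the sum of the covariances. -/
theorem integral_sq_sum_indicator_sub (J : Finset ι) (a : ι → ℝ) (E : ι → Set Ω)
    (hE : ∀ j ∈ J, MeasurableSet (E j)) :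
    ∫ x, (∑ j ∈ J, (E j).indicator (fun _ => a j) x - ∑ j ∈ J, a j * μ.real (E j)) ^ 2 ∂μ
      = ∑ j ∈ J, ∑ l ∈ J, (a j * a l * μ.real (E j ∩ E l)
          - a j * μ.real (E j) * (a l * μ.real (E l))) := by
  set m := ∑ j ∈ J, a j * μ.real (E j) with hm
  have h1 : ∀ x, (∑ j ∈ J, (E j).indicator (fun _ => a j) x - m) ^ 2
      = ∑ j ∈ J, ∑ l ∈ J, (E j ∩ E l).indicator (fun _ => a j * a l) x
        - 2 * m * ∑ j ∈ J, (E j).indicator (fun _ => a j) x + m ^ 2 := by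
    intro x
    have : ∀ j l, (E j ∩ E l).indicator (fun _ => a j * a l) x
        = (E j).indicator (fun _ => a j) x * (E l).indicator (fun _ => a l) x := by
      intro j l
      by_cases hj : x ∈ E j <;> by_cases hl : x ∈ E l <;> simp [hj, hl]
    simp only [this]
    rw [← Finset.sum_mul_sum]
    ring
  have hi1 : Integrable (fun x => ∑ j ∈ J, (E j).indicator (fun _ => a j) x) μ :=
    integrable_finsetSum _ fun j hj => integrable_indicator_one μ (hE j hj) _
  have hi2 : Integrable (fun x => ∑ j ∈ J, ∑ l ∈ J,
      (E j ∩ E l).indicator (fun _ => a j * a l) x) μ :=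
    integrable_finsetSum _ fun j hj => integrable_finsetSum _ fun l hl =>
      integrable_indicator_one μ ((hE j hj).inter (hE l hl)) _
  have hi3 : Integrable (fun x => ∑ j ∈ J, ∑ l ∈ J, (E j ∩ E l).indicator (fun _ => a j * a l) x
      - 2 * m * ∑ j ∈ J, (E j).indicator (fun _ => a j) x) μ := hi2.sub (hi1.const_mul _)
  simp only [h1]
  rw [integral_add hi3 (integrable_const _),
    integral_sub hi2 (hi1.const_mul _), integral_const_mul, integral_sum_indicator μ J a E hE,
    integral_finsetSum _ fun j hj => integrable_finsetSum _ fun l hl =>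
      integrable_indicator_one μ ((hE j hj).inter (hE l hl)) _]
  have h2 : ∀ j ∈ J, ∫ x, ∑ l ∈ J, (E j ∩ E l).indicator (fun _ => a j * a l) x ∂μ
      = ∑ l ∈ J, a j * a l * μ.real (E j ∩ E l) := fun j hj =>
    integral_sum_indicator μ J (fun l => a j * a l) (fun l => E j ∩ E l)
      fun l hl => (hE j hj).inter (hE l hl)
  rw [Finset.sum_congr rfl h2]
  simp only [Finset.sum_sub_distrib, ← Finset.mul_sum, ← Finset.sum_mul]
  rw [← hm]
  simp only [integral_const, probReal_univ, smul_eq_mul]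
  ring

end SecondMoment

/-! ### Counting triangles -/

section Counting

variable {V : Type u} [Fintype V] [DecidableEq V] (G : SimpleGraph V)

variable {G} in
theorem mem_triangles_iff {t : Finset V} :
    t ∈ triangles G ↔ (∀ u ∈ t, ∀ v ∈ t, u ≠ v → G.Adj u v) ∧ t.card = 3 := by
  simp only [triangles, SimpleGraph.mem_cliqueFinset_iff, SimpleGraph.isNClique_iff,
    SimpleGraph.isClique_iff, Set.Pairwise, Finset.mem_coe]

variable {G} in
theorem card_of_mem_triangles {t : Finset V} (ht : t ∈ triangles G) : t.card = 3 :=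
  (mem_triangles_iff.1 ht).2

variable {G} in
theorem mem_trianglesAt {t : Finset V} {v : V} :
    t ∈ trianglesAt G v ↔ t ∈ triangles G ∧ v ∈ t := by
  simp [trianglesAt]

theorem card_trianglesAt_le (v : V) : (trianglesAt G v).card ≤ numTriangles G :=
  Finset.card_filter_le _ _

theorem card_trianglesAt_le_max (v : V) : (trianglesAt G v).card ≤ maxVertexTriangles G :=
  Finset.le_sup (f := fun v => (trianglesAt G v).card) (Finset.mem_univ v)

theorem sum_card_trianglesAt : ∑ v, (trianglesAt G v).card = 3 * numTriangles G := by
  simp only [trianglesAt, Finset.card_filter]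
  rw [Finset.sum_comm, numTriangles, mul_comm, ← smul_eq_mul, ← Finset.sum_const]
  refine Finset.sum_congr rfl fun t ht => ?_
  rw [← Finset.card_filter, Finset.filter_univ_mem, card_of_mem_triangles ht]

theorem card_triangles_through_pair_le {u v : V} (huv : u ≠ v) :
    ((triangles G).filter fun t => u ∈ t ∧ v ∈ t).card ≤ maxEdgeTriangles G := by
  classical
  by_cases h : G.Adj u v
  · have := Finset.le_sup (s := Finset.univ.filter (fun e : Sym2 V => e ∈ G.edgeSet))
      (f := fun e => ((triangles G).filter (fun t => ∀ x ∈ e, x ∈ t)).card) (b := s(u, v))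
      (by simpa using h)
    refine le_trans (le_of_eq ?_) (this.trans (le_of_eq ?_))
    · congr 1
      refine Finset.filter_congr fun t _ => by simp
    · rw [maxEdgeTriangles]
  · rw [Finset.card_eq_zero.2]
    · exact Nat.zero_le _
    · refine Finset.filter_eq_empty_iff.2 fun t ht hh => h ?_
      exact (mem_triangles_iff.1 ht).1 u hh.1 v hh.2 huv

/-- The number of ordered pairs of triangles that share an edge is at most `3 T Δ_E`. -/
theorem sum_sum_two_le_card_inter_le :
    ∑ t ∈ triangles G, ∑ t' ∈ triangles G, (if 2 ≤ (t ∩ t').card then (1 : ℝ) else 0)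
      ≤ 3 * maxEdgeTriangles G * numTriangles G := by
  have key : ∀ t ∈ triangles G,
      ∑ t' ∈ triangles G, (if 2 ≤ (t ∩ t').card then (1 : ℝ) else 0)
        ≤ 3 * maxEdgeTriangles G := by
    intro t ht
    rw [← Finset.sum_filter, Finset.sum_const, nsmul_eq_mul, mul_one]
    have hsub : (triangles G).filter (fun t' => 2 ≤ (t ∩ t').card) ⊆
        (t.powersetCard 2).biUnion fun p => (triangles G).filter fun t' => p ⊆ t' := by
      intro t' ht'
      obtain ⟨h1, h2⟩ := Finset.mem_filter.1 ht'
      obtain ⟨p, hp, hpc⟩ := Finset.exists_subset_card_eq h2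
      simp only [Finset.mem_biUnion, Finset.mem_powersetCard, Finset.mem_filter]
      exact ⟨p, ⟨hp.trans Finset.inter_subset_left, hpc⟩, h1, hp.trans Finset.inter_subset_right⟩
    have h3 : ((t.powersetCard 2).biUnion fun p =>
        (triangles G).filter fun t' => p ⊆ t').card ≤ 3 * maxEdgeTriangles G := by
      have hc : (t.powersetCard 2).card = 3 := by
        rw [Finset.card_powersetCard, card_of_mem_triangles ht]; rfl
      rw [← hc]
      refine Finset.card_biUnion_le_card_mul _ _ _ fun p hp => ?_
      obtain ⟨a, b, hab, rfl⟩ := Finset.card_eq_two.1 (Finset.mem_powersetCard.1 hp).2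
      refine le_trans (le_of_eq ?_) (card_triangles_through_pair_le G hab)
      congr 1
      refine Finset.filter_congr fun t' _ => by simp [Finset.insert_subset_iff]
    exact_mod_cast (Finset.card_le_card hsub).trans h3
  refine (Finset.sum_le_sum key).trans (le_of_eq ?_)
  rw [Finset.sum_const, nsmul_eq_mul, numTriangles]
  ring

/-- The number of ordered pairs of triangles through `v` that share exactly one more vertex. -/
theorem sum_sum_card_inter_eq_two_le (v : V) :
    ∑ t ∈ trianglesAt G v, ∑ t' ∈ trianglesAt G v, (if (t ∩ t').card = 2 then (1 : ℝ) else 0)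
      ≤ 2 * maxEdgeTriangles G * (trianglesAt G v).card := by
  have key : ∀ t ∈ trianglesAt G v,
      ∑ t' ∈ trianglesAt G v, (if (t ∩ t').card = 2 then (1 : ℝ) else 0)
        ≤ 2 * maxEdgeTriangles G := by
    intro t ht
    obtain ⟨ht, hv⟩ := mem_trianglesAt.1 ht
    rw [← Finset.sum_filter, Finset.sum_const, nsmul_eq_mul, mul_one]
    have hsub : (trianglesAt G v).filter (fun t' => (t ∩ t').card = 2) ⊆
        (t.erase v).biUnion fun u => (triangles G).filter fun t' => u ∈ t' ∧ v ∈ t' := by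
      intro t' ht'
      obtain ⟨h1, h2⟩ := Finset.mem_filter.1 ht'
      obtain ⟨h1, hv'⟩ := mem_trianglesAt.1 h1
      obtain ⟨u, hu, huv⟩ := Finset.exists_mem_ne (s := t ∩ t') (by omega) v
      obtain ⟨hu1, hu2⟩ := Finset.mem_inter.1 hu
      simp only [Finset.mem_biUnion, Finset.mem_erase, Finset.mem_filter]
      exact ⟨u, ⟨huv, hu1⟩, h1, hu2, hv'⟩
    have h3 : ((t.erase v).biUnion fun u =>
        (triangles G).filter fun t' => u ∈ t' ∧ v ∈ t').card ≤ 2 * maxEdgeTriangles G := by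
      have hc : (t.erase v).card = 2 := by
        rw [Finset.card_erase_of_mem hv, card_of_mem_triangles ht]
      rw [← hc]
      exact Finset.card_biUnion_le_card_mul _ _ _ fun u hu =>
        card_triangles_through_pair_le G (Finset.ne_of_mem_erase hu)
    exact_mod_cast (Finset.card_le_card hsub).trans h3
  refine (Finset.sum_le_sum key).trans (le_of_eq ?_)
  rw [Finset.sum_const, nsmul_eq_mul]
  ring

/-- Pairs `(v, t)`, `(v', t')` of a triangle and one of its vertices, both vertices from `S`, whose
triangles meet in a vertex other than `v` and `v'`. For fixed `v, v'` and `t' ∋ v'`, each of the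
two other vertices of `t'` lies in at most `Δ_E` triangles `t ∋ v`. -/
theorem sum_sum_common_vertex_le (S : Finset V) :
    ∑ v ∈ S, ∑ t ∈ trianglesAt G v, ∑ v' ∈ S, ∑ t' ∈ trianglesAt G v',
        (if ∃ u ∈ t ∩ t', u ≠ v ∧ u ≠ v' then (1 : ℝ) else 0)
      ≤ S.card * (6 * maxEdgeTriangles G * numTriangles G) := by
  rw [← nsmul_eq_mul]
  refine Finset.sum_le_card_nsmul _ _ _ fun v _ => ?_
  have key : ∀ v' : V, ∀ t' ∈ trianglesAt G v', ∑ t ∈ trianglesAt G v,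
      (if ∃ u ∈ t ∩ t', u ≠ v ∧ u ≠ v' then (1 : ℝ) else 0) ≤ 2 * maxEdgeTriangles G := by
    intro v' t' ht'
    obtain ⟨ht', hv'⟩ := mem_trianglesAt.1 ht'
    rw [← Finset.sum_filter, Finset.sum_const, nsmul_eq_mul, mul_one]
    have hsub : (trianglesAt G v).filter (fun t => ∃ u ∈ t ∩ t', u ≠ v ∧ u ≠ v') ⊆
        ((t'.erase v').erase v).biUnion
          fun u => (triangles G).filter fun t => u ∈ t ∧ v ∈ t := by
      intro t ht
      obtain ⟨h1, u, hu, huv, huv'⟩ := Finset.mem_filter.1 ht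
      obtain ⟨h1, hv⟩ := mem_trianglesAt.1 h1
      obtain ⟨hu1, hu2⟩ := Finset.mem_inter.1 hu
      simp only [Finset.mem_biUnion, Finset.mem_erase, Finset.mem_filter]
      exact ⟨u, ⟨huv, huv', hu2⟩, h1, hu1, hv⟩
    have h3 : (((t'.erase v').erase v).biUnion fun u =>
        (triangles G).filter fun t => u ∈ t ∧ v ∈ t).card ≤ 2 * maxEdgeTriangles G := by
      have hc : ((t'.erase v').erase v).card ≤ 2 := by
        refine Finset.card_erase_le.trans ?_
        rw [Finset.card_erase_of_mem hv', card_of_mem_triangles ht']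
      exact (Finset.card_biUnion_le_card_mul _ _ _ fun u hu =>
        card_triangles_through_pair_le G (Finset.ne_of_mem_erase hu)).trans
          (Nat.mul_le_mul_right _ hc)
    exact_mod_cast (Finset.card_le_card hsub).trans h3
  rw [Finset.sum_comm]
  calc ∑ v' ∈ S, ∑ t ∈ trianglesAt G v, ∑ t' ∈ trianglesAt G v',
        (if ∃ u ∈ t ∩ t', u ≠ v ∧ u ≠ v' then (1 : ℝ) else 0)
      ≤ ∑ v' ∈ S, ((trianglesAt G v').card : ℝ) * (2 * maxEdgeTriangles G) := by
        refine Finset.sum_le_sum fun v' _ => ?_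
        rw [Finset.sum_comm, ← nsmul_eq_mul]
        exact Finset.sum_le_card_nsmul _ _ _ (key v')
    _ ≤ ∑ v', ((trianglesAt G v').card : ℝ) * (2 * maxEdgeTriangles G) :=
        Finset.sum_le_sum_of_subset_of_nonneg (Finset.subset_univ _)
          fun _ _ _ => by positivity
    _ = 6 * maxEdgeTriangles G * numTriangles G := by
        rw [← Finset.sum_mul, ← Nat.cast_sum, sum_card_trianglesAt]
        push_cast
        ring

end Counting

/-! ### A run computes the same estimate from the kept edges as from the whole graph -/

section Reduction

variable {V : Type u} [Fintype V] [DecidableEq V] (P : Params) (s : RunSeed V)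

namespace Params

variable {P}

theorem weight_pos (h : ℕ) : 0 < P.weight h := mul_pos P.ω_pos (by positivity)

theorem weight_mono {h h' : ℕ} (hh : h ≤ h') : P.weight h ≤ P.weight h' :=
  mul_le_mul_of_nonneg_left (pow_le_pow_right₀ (by norm_num) hh) P.ω_pos.le

theorem Below.mono {h h' : ℕ} (hh : h ≤ h') {x : unitInterval} (hx : P.Below h x) :
    P.Below h' x :=
  lt_of_lt_of_le hx (div_le_div_of_nonneg_right (weight_mono hh) (Real.sqrt_nonneg _))

end Params

/-- Copy `i` of the classifying test succeeds at scale `h` for the vertex `v` in the graph `H`. -/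
def Passes (Tg : ℝ) (H : SimpleGraph V) (i : Fin 2) (h : ℕ) (v : V) : Prop :=
  P.ω * Tg * 2 ^ h / P.k ^ 2 ≤ (X P s H i h v : ℝ)

variable {P s}

theorem level_eq_top_iff {Tg : ℝ} {H : SimpleGraph V} {v : V} :
    level P s Tg H v = ⊤ ↔ ∀ h ≤ P.top, ∀ i, ¬ Passes P s Tg H i h v := by
  simp only [level, levelOf, min_eq_top, Finset.min_eq_top, Finset.filter_eq_empty_iff,
    Finset.mem_range, Nat.lt_succ_iff, Fin.forall_fin_two, Passes]
  exact ⟨fun hh h hl => ⟨hh.1 hl, hh.2 hl⟩, fun hh => ⟨fun h hl => (hh h hl).1,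
    fun h hl => (hh h hl).2⟩⟩

theorem level_eq_coe_iff {Tg : ℝ} {H : SimpleGraph V} {v : V} {h : ℕ} :
    level P s Tg H v = h ↔ h ≤ P.top ∧ (∃ i, Passes P s Tg H i h v) ∧
      ∀ h' < h, ∀ i, ¬ Passes P s Tg H i h' v := by
  classical
  have hlev : level P s Tg H v = ((Finset.range (P.top + 1)).filter
      fun h => ∃ i, Passes P s Tg H i h v).min := by
    simp only [level, levelOf, Fin.exists_fin_two, Finset.filter_or, Passes, Finset.min,
      Finset.inf_union]
  rw [hlev]
  constructor
  · intro hm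
    have h1 := Finset.mem_of_min hm
    simp only [Finset.mem_filter, Finset.mem_range, Nat.lt_succ_iff, Nat.cast_id] at h1
    refine ⟨h1.1, h1.2, fun h' hh' i hp => absurd (Finset.min_le_of_eq ?_ hm) (not_le.2 hh')⟩
    simp only [Finset.mem_filter, Finset.mem_range]
    exact ⟨by omega, i, hp⟩
  · rintro ⟨h1, h2, h3⟩
    refine le_antisymm (Finset.min_le ?_) (Finset.le_min fun b hb => ?_)
    · simp only [Finset.mem_filter, Finset.mem_range, Nat.cast_id]
      exact ⟨by omega, h2⟩
    · simp only [Finset.mem_filter, Finset.mem_range] at hb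
      obtain ⟨-, i, hi⟩ := hb
      by_contra hlt
      exact h3 b (by simpa using hlt) i hi

theorem level_le_top {Tg : ℝ} {H : SimpleGraph V} {v : V} {h : ℕ}
    (hv : level P s Tg H v = h) : h ≤ P.top := (level_eq_coe_iff.1 hv).1

variable (G : SimpleGraph V)

variable (P s) in
/-- The part of `G` that is visible to a run. -/
def visibleGraph : SimpleGraph V := SimpleGraph.fromEdgeSet (G.edgeSet ∩ keepSet P s)

omit [Fintype V] [DecidableEq V] in
theorem mem_keepSet_of_keepsPair {u v : V} (h : KeepsPair P s u v) : s(u, v) ∈ keepSet P s :=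
  ⟨u, v, rfl, h⟩

omit [Fintype V] [DecidableEq V] in
theorem mem_keepSet_of_keepsPair' {u v : V} (h : KeepsPair P s v u) : s(u, v) ∈ keepSet P s :=
  ⟨v, u, Sym2.eq_swap, h⟩

variable {G}

theorem mem_triangles_visibleGraph {t : Finset V} :
    t ∈ triangles (visibleGraph P s G) ↔
      t ∈ triangles G ∧ ∀ u ∈ t, ∀ v ∈ t, u ≠ v → s(u, v) ∈ keepSet P s := by
  simp only [mem_triangles_iff, visibleGraph, SimpleGraph.fromEdgeSet_adj, Set.mem_inter_iff,
    SimpleGraph.mem_edgeSet]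
  constructor
  · rintro ⟨h, h3⟩
    exact ⟨⟨fun u hu v hv huv => (h u hu v hv huv).1.1, h3⟩,
      fun u hu v hv huv => (h u hu v hv huv).1.2⟩
  · rintro ⟨⟨h, h3⟩, h2⟩
    exact ⟨fun u hu v hv huv => ⟨⟨h u hu v hv huv, h2 u hu v hv huv⟩, huv⟩, h3⟩

theorem mem_trianglesAt_visibleGraph {t : Finset V} {v : V} :
    t ∈ trianglesAt (visibleGraph P s G) v ↔
      t ∈ trianglesAt G v ∧ ∀ u ∈ t, ∀ v ∈ t, u ≠ v → s(u, v) ∈ keepSet P s := by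
  rw [mem_trianglesAt, mem_triangles_visibleGraph, mem_trianglesAt]
  tauto

omit [Fintype V] in
/-- All pairs inside `t` are kept as soon as the pairs at `v` and the pairs avoiding `v` are. -/
theorem pairs_mem_keepSet {t : Finset V} {v : V}
    (h1 : ∀ u ∈ t, u ≠ v → KeepsPair P s v u)
    (h2 : ∀ u ∈ t, ∀ w ∈ t, u ≠ v → w ≠ v → KeepsPair P s u w) :
    ∀ u ∈ t, ∀ w ∈ t, u ≠ w → s(u, w) ∈ keepSet P s := by
  intro u hu w hw huw
  by_cases huv : u = v
  · subst huv
    exact mem_keepSet_of_keepsPair (h1 w hw huw.symm)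
  by_cases hwv : w = v
  · subst hwv
    exact mem_keepSet_of_keepsPair' (h1 u hu huw)
  exact mem_keepSet_of_keepsPair (h2 u hu w hw huv hwv)

/-- If `v` is sampled by `c`, or has a scale of at least `h`, then the run keeps every edge of the
triangles that the test of scale `h` counts at `v`. -/
theorem X_visibleGraph {i : Fin 2} {h : ℕ} {v : V}
    (hv : C P s v ∨ ∃ h', Scale P s v h' ∧ h ≤ h') :
    X P s (visibleGraph P s G) i h v = X P s G i h v := by
  unfold X
  congr 1
  ext t
  simp only [Finset.mem_filter, mem_trianglesAt_visibleGraph]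
  constructor
  · rintro ⟨⟨h1, -⟩, h2⟩
    exact ⟨h1, h2⟩
  · rintro ⟨h1, h2⟩
    refine ⟨⟨h1, pairs_mem_keepSet (v := v) (fun u hu huv => ?_) fun u hu w hw huv hwv => ?_⟩, h2⟩
    · obtain ⟨hD, hR⟩ := h2 u hu huv
      rcases hv with hC | ⟨h', hs, hh⟩
      · exact Or.inr (Or.inl ⟨i, hC, hD⟩)
      · exact Or.inr (Or.inr (Or.inr (Or.inl ⟨i, h', hs, Params.Below.mono hh hR, hD⟩)))
    · exact Or.inl ⟨i, (h2 u hu huv).1, (h2 w hw hwv).1⟩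

theorem level_visibleGraph_of_C {Tg : ℝ} {v : V} (hv : C P s v) :
    level P s Tg (visibleGraph P s G) v = level P s Tg G v := by
  simp only [level, levelOf, X_visibleGraph (G := G) (Or.inl hv)]

/-- A vertex of scale `h` sees enough of its edges to decide whether its level is `h`. -/
theorem level_visibleGraph_eq_iff {Tg : ℝ} {v : V} {h : ℕ} (hv : Scale P s v h) :
    level P s Tg (visibleGraph P s G) v = h ↔ level P s Tg G v = h := by
  have key : ∀ h' ≤ h, ∀ i, Passes P s Tg (visibleGraph P s G) i h' v ↔ Passes P s Tg G i h' v :=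
    fun h' hh i => by rw [Passes, X_visibleGraph (Or.inr ⟨h, hv, hh⟩), Passes]
  rw [level_eq_coe_iff, level_eq_coe_iff]
  refine and_congr_right fun _ => and_congr (exists_congr (key h le_rfl)) ?_
  exact forall_congr' fun h' => forall_congr' fun hh => forall_congr' fun i =>
    not_congr (key h' hh.le i)

theorem lightEstimate_visibleGraph (Tg : ℝ) :
    lightEstimate P s Tg (visibleGraph P s G) = lightEstimate P s Tg G := by
  unfold lightEstimate
  refine congrArg (fun n : Finset (Finset V) => P.k ^ (3 / 2 : ℝ) * (n.card : ℝ)) ?_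
  ext t
  simp only [Finset.mem_filter, mem_triangles_visibleGraph]
  constructor
  · rintro ⟨⟨h1, -⟩, h2⟩
    exact ⟨h1, fun v hv => ⟨level_visibleGraph_of_C (G := G) (h2 v hv).2 ▸ (h2 v hv).1,
      (h2 v hv).2⟩⟩
  · rintro ⟨h1, h2⟩
    exact ⟨⟨h1, fun u hu v hv _ => mem_keepSet_of_keepsPair
      (Or.inr (Or.inr (Or.inl ⟨(h2 u hu).2, (h2 v hv).2⟩)))⟩,
      fun v hv => ⟨(level_visibleGraph_of_C (h2 v hv).2).trans (h2 v hv).1, (h2 v hv).2⟩⟩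

theorem vertexEstimate_visibleGraph {Tg : ℝ} {v : V} {h : ℕ} (hs : Scale P s v h)
    (hl : level P s Tg G v = h) :
    vertexEstimate P s Tg (visibleGraph P s G) v h = vertexEstimate P s Tg G v h := by
  classical
  have hset : (trianglesAt (visibleGraph P s G) v).filter
        (fun t => ∀ u ∈ t, u ≠ v → C P s u ∧ RC P s h s(v, u))
      = (trianglesAt G v).filter (fun t => ∀ u ∈ t, u ≠ v → C P s u ∧ RC P s h s(v, u)) := by
    ext t
    simp only [Finset.mem_filter, mem_trianglesAt_visibleGraph]
    constructor
    · rintro ⟨⟨h1, -⟩, h2⟩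
      exact ⟨h1, h2⟩
    · rintro ⟨h1, h2⟩
      refine ⟨⟨h1, pairs_mem_keepSet (v := v) (fun u hu huv => ?_)
        fun u hu w hw huv hwv => ?_⟩, h2⟩
      · exact Or.inr (Or.inr (Or.inr (Or.inr ⟨h, hs, (h2 u hu huv).2, (h2 u hu huv).1⟩)))
      · exact Or.inr (Or.inr (Or.inl ⟨(h2 u hu huv).1, (h2 w hw hwv).1⟩))
  unfold vertexEstimate
  refine Finset.sum_congr (by convert hset) fun t ht => ?_
  refine congrArg (fun n : Finset V => P.k ^ 2 / P.weight h * (1 / (n.card : ℝ))) ?_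
  refine Finset.filter_congr fun x hx => not_congr ?_
  by_cases hxv : x = v
  · rw [hxv, hl, (level_visibleGraph_eq_iff hs).2 hl]
  · rw [level_visibleGraph_of_C ((Finset.mem_filter.1 ht).2 x hx hxv).1]

/-- Whatever the estimate of a run depends on is visible to the run. -/
theorem runEstimate_visibleGraph (Tg : ℝ) :
    runEstimate P s Tg (visibleGraph P s G) = runEstimate P s Tg G := by
  unfold runEstimate heavyEstimate
  refine congrArg₂ (· + ·) (lightEstimate_visibleGraph Tg) ?_
  refine Finset.sum_congr rfl fun v _ => ?_
  classical
  refine Finset.sum_congr (Finset.filter_congr fun h _ => ?_) fun h hh => ?_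
  · exact and_congr_left fun hs => level_visibleGraph_eq_iff hs
  · obtain ⟨-, hl, hs⟩ := Finset.mem_filter.1 hh
    exact vertexEstimate_visibleGraph hs hl

end Reduction

section Stream

variable {V : Type u} [Fintype V] [DecidableEq V] {G : SimpleGraph V} {stream : List (Sym2 V)}

omit [Fintype V] in
theorem mem_onePass {P : Params} {σ : Seed P V} {e : Sym2 V} :
    e ∈ onePass P σ stream ↔ e ∈ stream ∧ ∃ i, e ∈ keepSet P (σ i) := by
  classical
  have key : ∀ (l : List (Sym2 V)) (K : Finset (Sym2 V)),
      e ∈ l.foldl (fun K e => if ∃ i, e ∈ keepSet P (σ i) then insert e K else K) K ↔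
        e ∈ K ∨ (e ∈ l ∧ ∃ i, e ∈ keepSet P (σ i)) := by
    intro l
    induction l with
    | nil => simp
    | cons a l ih =>
      intro K
      rw [List.foldl_cons, ih, List.mem_cons]
      by_cases ha : ∃ i, a ∈ keepSet P (σ i)
      · rw [if_pos ha, Finset.mem_insert]
        constructor
        · rintro ((rfl | h) | h)
          · exact Or.inr ⟨Or.inl rfl, ha⟩
          · exact Or.inl h
          · exact Or.inr ⟨Or.inr h.1, h.2⟩
        · rintro (h | ⟨rfl | h, h'⟩)
          · exact Or.inl (Or.inr h)
          · exact Or.inl (Or.inl rfl)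
          · exact Or.inr ⟨h, h'⟩
      · rw [if_neg ha]
        constructor
        · rintro (h | h)
          · exact Or.inl h
          · exact Or.inr ⟨Or.inr h.1, h.2⟩
        · rintro (h | ⟨rfl | h, h'⟩)
          · exact Or.inl h
          · exact absurd h' ha
          · exact Or.inr ⟨h, h'⟩
  have := key stream ∅
  simpa [onePass] using this

/-- The final estimate is the median of the block means of the estimates computed from `G`. -/
theorem finalEstimate_onePass (P : Params) (Tg : ℝ) (σ : Seed P V)
    (hG : ∀ e, e ∈ stream ↔ e ∈ G.edgeSet) :
    finalEstimate P Tg σ (onePass P σ stream) =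
      median fun a => (∑ b, runEstimate P (σ (a, b)) Tg G) / P.blockSize := by
  have key : ∀ p, runEstimate P (σ p) Tg (SimpleGraph.fromEdgeSet
      ((onePass P σ stream : Set (Sym2 V)) ∩ keepSet P (σ p))) = runEstimate P (σ p) Tg G := by
    intro p
    have hset : (onePass P σ stream : Set (Sym2 V)) ∩ keepSet P (σ p)
        = G.edgeSet ∩ keepSet P (σ p) := by
      ext e
      simp only [Set.mem_inter_iff, Finset.mem_coe, mem_onePass, hG]
      exact ⟨fun h => ⟨h.1.1, h.2⟩, fun h => ⟨⟨h.1, _, h.2⟩, h.2⟩⟩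
    rw [hset]
    exact runEstimate_visibleGraph Tg
  simp only [finalEstimate, key]

end Stream

/-! ### Measurability of the estimate -/

section Measurability

theorem measurable_of_factorsThrough {Ω F β : Type*} [MeasurableSpace Ω] [MeasurableSpace F]
    [MeasurableSpace β] [DiscreteMeasurableSpace F] {g : Ω → F} (hg : Measurable g) {f : Ω → β}
    (hf : f.FactorsThrough g) : Measurable f := by
  intro A _
  have : f ⁻¹' A = g ⁻¹' (g '' (f ⁻¹' A)) := by
    ext s
    refine ⟨fun h => ⟨s, h, rfl⟩, ?_⟩
    rintro ⟨s', h', hs⟩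
    rw [Set.mem_preimage, ← hf hs]
    exact h'
  rw [this]
  exact hg (MeasurableSet.of_discrete)

theorem finite_range_of_factorsThrough {Ω F β : Type*} [Finite F] {g : Ω → F} {f : Ω → β}
    (hf : f.FactorsThrough g) : (Set.range f).Finite := by
  have : Set.range f ⊆ Set.range fun y : Set.range g => f y.2.choose := by
    rintro _ ⟨s, rfl⟩
    exact ⟨⟨g s, s, rfl⟩, hf (Exists.choose_spec (⟨s, rfl⟩ : g s ∈ Set.range g))⟩
  exact (Set.finite_range _).subset this

variable {V : Type u} (P : Params)

theorem measurableSet_picks : MeasurableSet {x | P.Picks x} :=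
  measurableSet_lt measurable_subtype_coe measurable_const

theorem measurableSet_below (h : ℕ) : MeasurableSet {x | P.Below h x} :=
  measurableSet_lt measurable_subtype_coe measurable_const

theorem measurableSet_selects (h : ℕ) : MeasurableSet {x | P.Selects h x} :=
  (MeasurableSet.const _).inter ((measurableSet_le measurable_const measurable_subtype_coe).inter
    (measurableSet_lt measurable_subtype_coe measurable_const))

/-- The finitely many yes-no questions about a seed that determine the estimate of the run. -/
def signature (s : RunSeed V) :
    (Fin 2 × V → Prop) × (Fin 2 × Sym2 V × Fin (P.top + 1) → Prop) × (V → Prop) ×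
      (V × Fin (P.top + 1) → Prop) × (Sym2 V × Fin (P.top + 1) → Prop) :=
  (fun p => D P s p.1 p.2, fun p => RD P s p.1 p.2.2 p.2.1, fun v => C P s v,
    fun p => Scale P s p.1 p.2, fun p => RC P s p.2 p.1)

theorem measurable_signature [Fintype V] : Measurable (signature (V := V) P) := by
  refine Measurable.prodMk ?_ (Measurable.prodMk ?_ (Measurable.prodMk ?_
    (Measurable.prodMk ?_ ?_)))
  · refine measurable_pi_lambda _ fun p => ?_
    exact measurableSet_setOfPred.1 (measurableSet_picks P |>.preimage
      (show Measurable fun s : RunSeed V => s.1 (p.1, p.2) by fun_prop))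
  · refine measurable_pi_lambda _ fun p => ?_
    exact measurableSet_setOfPred.1 (measurableSet_below P p.2.2 |>.preimage
      (show Measurable fun s : RunSeed V => s.2.1 (p.1, p.2.1) by fun_prop))
  · refine measurable_pi_lambda _ fun v => ?_
    exact measurableSet_setOfPred.1 (measurableSet_picks P |>.preimage
      (show Measurable fun s : RunSeed V => s.2.2.1 v by fun_prop))
  · refine measurable_pi_lambda _ fun p => ?_
    exact measurableSet_setOfPred.1 (measurableSet_selects P p.2 |>.preimage
      (show Measurable fun s : RunSeed V => s.2.2.2.1 p.1 by fun_prop))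
  · refine measurable_pi_lambda _ fun p => ?_
    exact measurableSet_setOfPred.1 (measurableSet_below P p.2 |>.preimage
      (show Measurable fun s : RunSeed V => s.2.2.2.2 p.1 by fun_prop))

variable [Fintype V] {P}

theorem measurable_of_signature {β : Type*} [MeasurableSpace β] {f : RunSeed V → β}
    (hf : f.FactorsThrough (signature P)) : Measurable f :=
  measurable_of_factorsThrough (measurable_signature P) hf

/-- A function of finitely many yes-no questions takes finitely many values, so it is bounded. -/
theorem memLp_of_signature {f : RunSeed V → ℝ} (hf : f.FactorsThrough (signature P))
    (p : ℝ≥0∞) : MemLp f p := by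
  obtain ⟨B, hB⟩ := (finite_range_of_factorsThrough hf).isBounded.exists_norm_le
  exact MemLp.of_bound (measurable_of_signature hf).aestronglyMeasurable B
    (Filter.Eventually.of_forall fun s => hB _ ⟨s, rfl⟩)

theorem integrable_of_signature {f : RunSeed V → ℝ} (hf : f.FactorsThrough (signature P)) :
    Integrable f := memLp_one_iff_integrable.1 (memLp_of_signature hf 1)

variable [DecidableEq V] (P) (Tg : ℝ) (H : SimpleGraph V)

theorem X_factorsThrough {i : Fin 2} {h : ℕ} (hh : h ≤ P.top) (v : V) :
    (fun s => X P s H i h v).FactorsThrough (signature P) := by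
  intro s s' hs
  have hD : ∀ v, D P s i v ↔ D P s' i v := fun v =>
    iff_of_eq (congrFun (congrArg Prod.fst hs) (i, v))
  have hR : ∀ e, RD P s i h e ↔ RD P s' i h e := fun e =>
    iff_of_eq (congrFun (congrArg (fun x => x.2.1) hs) (i, e, ⟨h, by omega⟩))
  classical
  exact congrArg Finset.card (Finset.filter_congr fun t _ => by simp only [hD, hR])

theorem passes_factorsThrough {i : Fin 2} {h : ℕ} (hh : h ≤ P.top) (v : V) :
    (fun s => Passes P s Tg H i h v).FactorsThrough (signature P) := by
  intro s s' hs
  have := X_factorsThrough P H (i := i) hh v hs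
  simp only at this
  simp only [Passes, this]

theorem level_factorsThrough (v : V) :
    (fun s => level P s Tg H v).FactorsThrough (signature P) := by
  intro s s' hs
  have key : ∀ i, levelOf P s Tg H i v = levelOf P s' Tg H i v := by
    intro i
    unfold levelOf
    refine congrArg Finset.min (Finset.filter_congr fun h hh => ?_)
    exact iff_of_eq (passes_factorsThrough P Tg H
      (Nat.lt_succ_iff.1 (Finset.mem_range.1 hh)) v hs)
  simp only [level, key]

theorem lightEstimate_factorsThrough :
    (fun s => lightEstimate P s Tg H).FactorsThrough (signature P) := by
  intro s s' hs
  have hl : ∀ v, level P s Tg H v = level P s' Tg H v := fun v => level_factorsThrough P Tg H v hs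
  have hC : ∀ v, C P s v ↔ C P s' v := fun v =>
    iff_of_eq (congrFun (congrArg (fun x => x.2.2.1) hs) v)
  classical
  exact congrArg (fun n : Finset (Finset V) => P.k ^ (3 / 2 : ℝ) * (n.card : ℝ))
    (Finset.filter_congr fun t _ => by simp only [hl, hC])

theorem heavyEstimate_factorsThrough :
    (fun s => heavyEstimate P s Tg H).FactorsThrough (signature P) := by
  classical
  intro s s' hs
  have hl : ∀ v, level P s Tg H v = level P s' Tg H v := fun v => level_factorsThrough P Tg H v hs
  have hC : ∀ v, C P s v ↔ C P s' v := fun v =>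
    iff_of_eq (congrFun (congrArg (fun x => x.2.2.1) hs) v)
  have hS : ∀ h < P.top + 1, ∀ v, Scale P s v h ↔ Scale P s' v h := fun h hh v =>
    iff_of_eq (congrFun (congrArg (fun x => x.2.2.2.1) hs) (v, ⟨h, hh⟩))
  have hR : ∀ h < P.top + 1, ∀ e, RC P s h e ↔ RC P s' h e := fun h hh e =>
    iff_of_eq (congrFun (congrArg (fun x => x.2.2.2.2) hs) (e, ⟨h, hh⟩))
  unfold heavyEstimate
  refine Finset.sum_congr rfl fun v _ => ?_
  refine Finset.sum_congr (Finset.filter_congr fun h hh => ?_) fun h hh => ?_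
  · rw [hl, hS h (Finset.mem_range.1 hh)]
  · have hh := Finset.mem_range.1 (Finset.mem_filter.1 hh).1
    simp only [vertexEstimate, hl, hC, hR h hh]

theorem runEstimate_factorsThrough :
    (fun s => runEstimate P s Tg H).FactorsThrough (signature P) := by
  intro s s' hs
  have h1 := lightEstimate_factorsThrough P Tg H hs
  have h2 := heavyEstimate_factorsThrough P Tg H hs
  simp only at h1 h2
  simp only [runEstimate, h1, h2]

end Measurability

/-! ### Probabilities of the sampling events -/

section Probabilities

variable {P : Params} {h h' : ℕ}

namespace Params

theorem sqrt_pos (P : Params) : 0 < √P.k := Real.sqrt_pos.2 (zero_lt_one.trans_le P.one_le_k)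

theorem one_le_sqrt (P : Params) : 1 ≤ √P.k := Real.one_le_sqrt.2 P.one_le_k

theorem k_eq (P : Params) : P.k = √P.k ^ 2 :=
  (Real.sq_sqrt (zero_le_one.trans P.one_le_k)).symm

theorem k_rpow (P : Params) : P.k ^ (3 / 2 : ℝ) = √P.k ^ 3 := by
  rw [Real.sqrt_eq_rpow, ← Real.rpow_natCast, ← Real.rpow_mul (zero_le_one.trans P.one_le_k)]
  norm_num

theorem volume_real_picks (P : Params) : volume.real {x | P.Picks x} = 1 / √P.k :=
  volume_real_coe_lt (by positivity) (by rw [div_le_one P.sqrt_pos]; exact P.one_le_sqrt)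

theorem weight_div_le_one (hP : P.weight P.top = √P.k) (hh : h ≤ P.top) :
    P.weight h / √P.k ≤ 1 := by
  rw [div_le_one P.sqrt_pos, ← hP]
  exact weight_mono hh

theorem volume_real_below (hP : P.weight P.top = √P.k) (hh : h ≤ P.top) :
    volume.real {x | P.Below h x} = P.weight h / √P.k :=
  volume_real_coe_lt (div_nonneg (weight_pos h).le (Real.sqrt_nonneg _))
    (weight_div_le_one hP hh)

theorem volume_real_selects (hh : h ≤ P.top) :
    volume.real {x | P.Selects h x} = 1 / P.weight h := by
  have hs : ∑ j ∈ Finset.range (h + 1), 1 / P.weight j ≤ 1 :=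
    (Finset.sum_le_sum_of_subset_of_nonneg
      (Finset.range_subset_range.2 (Nat.succ_le_succ hh))
      fun j _ _ => (one_div_pos.2 (weight_pos j)).le).trans P.scale_prob_le
  have h0 : 0 ≤ ∑ j ∈ Finset.range h, 1 / P.weight j :=
    Finset.sum_nonneg fun j _ => (one_div_pos.2 (weight_pos j)).le
  have hlt := Finset.sum_range_succ (fun j => 1 / P.weight j) h
  have hp : 0 < 1 / P.weight h := one_div_pos.2 (weight_pos h)
  have := volume_real_coe_mem_Ico h0 (by linarith) hs
  rw [hlt] at this
  simp only [Selects, hh, true_and, hlt]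
  rw [this]
  ring

end Params

variable {V : Type u} [DecidableEq V]

variable (P) in
/-- The vertices of `t` other than `v` and the edges between them and `v` are sampled, the edges
at scale `h`. -/
def starEvent (h : ℕ) (v : V) (t : Finset V) : Set ((V → unitInterval) × (Sym2 V → unitInterval)) :=
  {z | ∀ u ∈ t, u ≠ v → P.Picks (z.1 u) ∧ P.Below h (z.2 s(v, u))}

theorem starEvent_eq (v : V) (t : Finset V) :
    starEvent P h v t = {x | ∀ u ∈ t.erase v, x u ∈ {a | P.Picks a}} ×ˢ
      {y | ∀ e ∈ (t.erase v).image (fun u => s(v, u)), y e ∈ {a | P.Below h a}} := by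
  ext ⟨x, y⟩
  simp only [starEvent, Set.mem_prod, Set.mem_ofPred_eq, Finset.mem_erase, Finset.forall_mem_image]
  exact ⟨fun H => ⟨fun u hu => (H u hu.2 hu.1).1, fun u hu => (H u hu.2 hu.1).2⟩,
    fun H u hu huv => ⟨H.1 u ⟨huv, hu⟩, H.2 ⟨huv, hu⟩⟩⟩

theorem starEvent_inter (v : V) (t t' : Finset V) :
    starEvent P h v t ∩ starEvent P h v t' = starEvent P h v (t ∪ t') := by
  ext z
  simp only [starEvent, Set.mem_inter_iff, Set.mem_ofPred_eq, Finset.mem_union]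
  exact ⟨fun H u hu => hu.elim (H.1 u) (H.2 u), fun H => ⟨fun u hu => H u (Or.inl hu),
    fun u hu => H u (Or.inr hu)⟩⟩

theorem card_image_star (v : V) (t : Finset V) :
    (t.image fun u => s(v, u)).card = t.card :=
  Finset.card_image_of_injective _ fun _ _ h => Sym2.congr_right.1 h

variable [Fintype V]

theorem measurableSet_forall_mem {ι γ : Type*} [Fintype ι] [MeasurableSpace γ]
    (S : Finset ι) {A : ι → Set γ} (hA : ∀ i, MeasurableSet (A i)) :
    MeasurableSet {x : ι → γ | ∀ i ∈ S, x i ∈ A i} := by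
  have : {x : ι → γ | ∀ i ∈ S, x i ∈ A i} = ⋂ i ∈ S, (fun x : ι → γ => x i) ⁻¹' A i := by
    ext; simp
  rw [this]
  exact Finset.measurableSet_biInter _ fun i _ => hA i |>.preimage (measurable_pi_apply i)

theorem measurableSet_starEvent (v : V) (t : Finset V) : MeasurableSet (starEvent P h v t) := by
  rw [starEvent_eq]
  exact (measurableSet_forall_mem _ fun _ => measurableSet_picks P).prod
    (measurableSet_forall_mem _ fun _ => measurableSet_below P h)

theorem volume_real_starEvent (hP : P.weight P.top = √P.k) (hh : h ≤ P.top) (v : V)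
    (t : Finset V) :
    volume.real (starEvent P h v t) = (P.weight h / P.k) ^ (t.erase v).card := by
  rw [starEvent_eq, Measure.volume_eq_prod, measureReal_prod_prod, volume_real_forall_mem,
    volume_real_forall_mem, Finset.prod_const, Finset.prod_const, card_image_star,
    Params.volume_real_picks, Params.volume_real_below hP hh, ← mul_pow]
  congr 1
  conv_rhs => rw [P.k_eq]
  field_simp

theorem measurableSet_prod_three {α β γ : Type*} [MeasurableSpace α] [MeasurableSpace β]
    [MeasurableSpace γ] {A : Set α} {B : Set β} {D : Set γ} (hA : MeasurableSet A)
    (hB : MeasurableSet B) (hD : MeasurableSet D) :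
    MeasurableSet {y : α × β × γ | y.1 ∈ A ∧ y.2.1 ∈ B ∧ y.2.2 ∈ D} :=
  hA.prod (hB.prod hD)

theorem volume_real_prod_three {α β γ : Type*} [MeasureSpace α] [MeasureSpace β]
    [MeasureSpace γ] [SigmaFinite (volume : Measure β)] [SigmaFinite (volume : Measure γ)]
    (A : Set α) (B : Set β) (D : Set γ) :
    volume.real {y : α × β × γ | y.1 ∈ A ∧ y.2.1 ∈ B ∧ y.2.2 ∈ D}
      = volume.real A * (volume.real B * volume.real D) := by
  have : {y : α × β × γ | y.1 ∈ A ∧ y.2.1 ∈ B ∧ y.2.2 ∈ D} = A ×ˢ (B ×ˢ D) := by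
    ext; simp [Set.mem_prod]
  rw [this, Measure.volume_eq_prod, measureReal_prod_prod, Measure.volume_eq_prod,
    measureReal_prod_prod]

/-- The probability that disjoint sets of edges are sampled at two different scales. -/
theorem volume_real_edges_of_disjoint (hP : P.weight P.top = √P.k) (hh : h ≤ P.top)
    (hh' : h' ≤ P.top) {R R' : Finset (Sym2 V)} (hR : Disjoint R R') :
    volume.real {y : Sym2 V → unitInterval |
        (∀ e ∈ R, P.Below h (y e)) ∧ ∀ e ∈ R', P.Below h' (y e)}
      = (P.weight h / √P.k) ^ R.card * (P.weight h' / √P.k) ^ R'.card := by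
  have hset : {y : Sym2 V → unitInterval |
        (∀ e ∈ R, P.Below h (y e)) ∧ ∀ e ∈ R', P.Below h' (y e)}
      = {y | ∀ e ∈ R ∪ R', y e ∈ if e ∈ R then {a | P.Below h a} else {a | P.Below h' a}} := by
    ext y
    simp only [Set.mem_ofPred_eq, Finset.mem_union]
    constructor
    · rintro ⟨h1, h2⟩ e he
      split_ifs with heR
      · exact h1 e heR
      · exact h2 e (he.resolve_left heR)
    · intro H
      refine ⟨fun e he => ?_, fun e he => ?_⟩
      · have := H e (Or.inl he)
        rwa [if_pos he] at this
      · have := H e (Or.inr he)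
        rwa [if_neg (Finset.disjoint_right.1 hR he)] at this
  rw [hset, volume_real_forall_mem, Finset.prod_union hR]
  congr 1
  · rw [← Finset.prod_const]
    refine Finset.prod_congr rfl fun e he => ?_
    rw [if_pos he, Params.volume_real_below hP hh]
  · rw [← Finset.prod_const]
    refine Finset.prod_congr rfl fun e he => ?_
    rw [if_neg (Finset.disjoint_right.1 hR he), Params.volume_real_below hP hh']

/-- An edge of `R ∩ R'` is charged to the scale `h` only. -/
theorem volume_real_edges_le (hP : P.weight P.top = √P.k) (hh : h ≤ P.top)
    (hh' : h' ≤ P.top) (R R' : Finset (Sym2 V)) :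
    volume.real {y : Sym2 V → unitInterval |
        (∀ e ∈ R, P.Below h (y e)) ∧ ∀ e ∈ R', P.Below h' (y e)}
      ≤ (P.weight h / √P.k) ^ R.card * (P.weight h' / √P.k) ^ (R' \ R).card := by
  rw [← volume_real_edges_of_disjoint hP hh hh' Finset.disjoint_sdiff]
  refine measureReal_mono fun y hy => ⟨hy.1, fun e he => hy.2 e (Finset.mem_sdiff.1 he).1⟩

end Probabilities

/-! ### Covariances of the sampled triangles, given the levels -/

section Covariance

variable {V : Type u} [DecidableEq V] {P : Params}

variable (P) in
/-- All vertices of `t` are sampled. -/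
def lightEvent (t : Finset V) :
    Set ((V → unitInterval) × (V → unitInterval) × (Sym2 V → unitInterval)) :=
  {y | ∀ v ∈ t, P.Picks (y.1 v)}

variable (P) in
/-- The vertex `v` gets the scale `lv v`, and the star that joins it to the other vertices of `t`
is sampled at this scale. -/
def heavyEvent (lv : V → ℕ) (v : V) (t : Finset V) :
    Set ((V → unitInterval) × (V → unitInterval) × (Sym2 V → unitInterval)) :=
  {y | P.Selects (lv v) (y.2.1 v) ∧ (y.1, y.2.2) ∈ starEvent P (lv v) v t}

theorem lightEvent_inter (t t' : Finset V) :
    lightEvent P t ∩ lightEvent P t' = lightEvent P (t ∪ t') := by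
  ext z
  simp only [lightEvent, Set.mem_inter_iff, Set.mem_ofPred_eq, Finset.mem_union]
  exact ⟨fun H u hu => hu.elim (H.1 u) (H.2 u), fun H => ⟨fun u hu => H u (Or.inl hu),
    fun u hu => H u (Or.inr hu)⟩⟩

theorem heavyEvent_inter_self (lv : V → ℕ) (v : V) (t t' : Finset V) :
    heavyEvent P lv v t ∩ heavyEvent P lv v t' = heavyEvent P lv v (t ∪ t') := by
  ext y
  simp only [heavyEvent, ← starEvent_inter, Set.mem_inter_iff, Set.mem_ofPred_eq]
  tauto

theorem heavyEvent_inter {lv : V → ℕ} (v v' : V) (t t' : Finset V) :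
    heavyEvent P lv v t ∩ heavyEvent P lv v' t' =
      {y | y.1 ∈ {x : V → unitInterval | ∀ u ∈ t.erase v ∪ t'.erase v', x u ∈ {a | P.Picks a}} ∧
        y.2.1 ∈ {x : V → unitInterval | ∀ u ∈ ({v, v'} : Finset V),
          x u ∈ {a | P.Selects (lv u) a}} ∧
        y.2.2 ∈ {x : Sym2 V → unitInterval |
          (∀ e ∈ (t.erase v).image (fun u => s(v, u)), P.Below (lv v) (x e)) ∧
            ∀ e ∈ (t'.erase v').image (fun u => s(v', u)), P.Below (lv v') (x e)}} := by
  ext y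
  simp only [heavyEvent, starEvent_eq, Set.mem_inter_iff, Set.mem_ofPred_eq, Set.mem_prod,
    Finset.mem_union, Finset.mem_insert, Finset.mem_singleton, forall_eq_or_imp, forall_eq]
  constructor
  · rintro ⟨⟨h1, h2, h3⟩, h4, h5, h6⟩
    exact ⟨fun u hu => hu.elim (h2 u) (h5 u), ⟨h1, h4⟩, h3, h6⟩
  · rintro ⟨h1, ⟨h2, h3⟩, h4, h5⟩
    exact ⟨⟨h2, fun u hu => h1 u (Or.inl hu), h4⟩, h3, fun u hu => h1 u (Or.inr hu), h5⟩

theorem heavyEvent_eq (lv : V → ℕ) (v : V) (t : Finset V) :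
    heavyEvent P lv v t =
      {y | y.1 ∈ {x : V → unitInterval | ∀ u ∈ t.erase v, x u ∈ {a | P.Picks a}} ∧
        y.2.1 ∈ {x : V → unitInterval | ∀ u ∈ ({v} : Finset V), x u ∈ {a | P.Selects (lv u) a}} ∧
        y.2.2 ∈ {x : Sym2 V → unitInterval | ∀ e ∈ (t.erase v).image (fun u => s(v, u)),
          x e ∈ {a | P.Below (lv v) a}}} := by
  ext y
  simp only [heavyEvent, starEvent_eq, Set.mem_ofPred_eq, Set.mem_prod,
    Finset.mem_singleton, forall_eq]
  tauto

variable [Fintype V]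

omit [DecidableEq V] in
theorem measurableSet_lightEvent (t : Finset V) : MeasurableSet (lightEvent P t) :=
  (measurableSet_forall_mem t fun _ => measurableSet_picks P).preimage measurable_fst

theorem measurableSet_heavyEvent (lv : V → ℕ) (v : V) (t : Finset V) :
    MeasurableSet (heavyEvent P lv v t) := by
  rw [heavyEvent_eq]
  exact measurableSet_prod_three (measurableSet_forall_mem _ fun _ => measurableSet_picks P)
    (measurableSet_forall_mem _ fun _ => measurableSet_selects P _)
    (measurableSet_forall_mem _ fun _ => measurableSet_below P _)

theorem volume_real_lightEvent (t : Finset V) :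
    volume.real (lightEvent P t) = (1 / √P.k) ^ t.card := by
  have : lightEvent P t = {y | y.1 ∈ {x : V → unitInterval | ∀ v ∈ t, x v ∈ {a | P.Picks a}} ∧
      y.2.1 ∈ Set.univ ∧ y.2.2 ∈ Set.univ} := by
    ext; simp [lightEvent]
  rw [this, volume_real_prod_three, volume_real_forall_mem]
  simp [Params.volume_real_picks]

variable {lv : V → ℕ}

theorem volume_real_heavyEvent (hP : P.weight P.top = √P.k) {v : V} (hv : lv v ≤ P.top)
    (t : Finset V) :
    volume.real (heavyEvent P lv v t)
      = 1 / P.weight (lv v) * (P.weight (lv v) / P.k) ^ (t.erase v).card := by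
  rw [heavyEvent_eq, volume_real_prod_three, volume_real_forall_mem, volume_real_forall_mem,
    volume_real_forall_mem, Finset.prod_const, Finset.prod_const, Finset.prod_singleton,
    card_image_star, Params.volume_real_picks, Params.volume_real_selects hv,
    Params.volume_real_below hP hv]
  have : P.weight (lv v) / P.k = 1 / √P.k * (P.weight (lv v) / √P.k) := by
    conv_lhs => rw [P.k_eq]
    field_simp
  rw [this, mul_pow]
  ring

end Covariance

section Covariance

variable {V : Type u} [DecidableEq V] [Fintype V] {P : Params} {lv : V → ℕ}

/-- The terms of two triangles are correlated only if the triangles share vertices, and then their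
covariance is at most `√k` to the number of shared vertices. -/
theorem lightEvent_cov_le {t t' : Finset V} (ht : t.card = 3) (ht' : t'.card = 3) :
    √P.k ^ 3 * √P.k ^ 3 * volume.real (lightEvent P t ∩ lightEvent P t')
        - √P.k ^ 3 * volume.real (lightEvent P t) * (√P.k ^ 3 * volume.real (lightEvent P t'))
      ≤ (if t = t' then √P.k ^ 3 else 0) + (if 2 ≤ (t ∩ t').card then √P.k ^ 2 else 0)
        + (if (t ∩ t').Nonempty then √P.k else 0) := by
  rw [lightEvent_inter, volume_real_lightEvent, volume_real_lightEvent, volume_real_lightEvent,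
    ht, ht']
  have hr := P.sqrt_pos
  set r := √P.k
  have hcard := Finset.card_union_add_card_inter t t'
  have hle : (t ∩ t').card ≤ 3 := ht ▸ Finset.card_le_card Finset.inter_subset_left
  have h1 : r ^ 3 * (1 / r) ^ 3 = 1 := by field_simp
  rw [h1]
  have hval : r ^ 3 * r ^ 3 * (1 / r) ^ (t ∪ t').card = r ^ (t ∩ t').card := by
    have : r ^ 3 * r ^ 3 = r ^ (t ∩ t').card * r ^ (t ∪ t').card := by
      rw [← pow_add, ← pow_add]; congr 1; omega
    rw [this, mul_assoc, ← mul_pow, mul_one_div_cancel hr.ne', one_pow, mul_one]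
  have p1 : (0 : ℝ) ≤ if t = t' then r ^ 3 else 0 := by split_ifs <;> positivity
  have p2 : (0 : ℝ) ≤ if 2 ≤ (t ∩ t').card then r ^ 2 else 0 := by split_ifs <;> positivity
  have p3 : (0 : ℝ) ≤ if (t ∩ t').Nonempty then r else 0 := by split_ifs <;> positivity
  obtain hj | hj | hj | hj : (t ∩ t').card = 0 ∨ (t ∩ t').card = 1 ∨ (t ∩ t').card = 2 ∨
    (t ∩ t').card = 3 := by omega
  · rw [hj, pow_zero] at hval; rw [hval]; linarith
  · have : (t ∩ t').Nonempty := Finset.card_pos.1 (by omega)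
    rw [hj, pow_one] at hval; rw [hval, if_pos this]; linarith
  · have : 2 ≤ (t ∩ t').card := by omega
    rw [hj] at hval; rw [hval, if_pos this]; linarith
  · have h2 : t ∩ t' = t := Finset.eq_of_subset_of_card_le Finset.inter_subset_left (by omega)
    have h3 : t ∩ t' = t' := Finset.eq_of_subset_of_card_le Finset.inter_subset_right (by omega)
    rw [hj] at hval; rw [hval, if_pos (h2.symm.trans h3)]; linarith

/-- Two triangles counted at the same vertex `v` share the choice of the scale of `v`, which
contributes `ω 2 ^ h`, and possibly further vertices and edges. The product of the expectations is
not subtracted here. -/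
theorem heavyEvent_cov_self_le (hP : P.weight P.top = √P.k) {Tg : ℝ} (hk : P.k ^ 2 ≤ P.ω * Tg)
    (hω : 1 ≤ P.ω) {v : V} (hv : lv v ≤ P.top) {t t' : Finset V}
    (ht : t.card = 3) (ht' : t'.card = 3) (hvt : v ∈ t) (hvt' : v ∈ t') :
    P.k ^ 2 / P.weight (lv v) * (P.k ^ 2 / P.weight (lv v)) *
        volume.real (heavyEvent P lv v t ∩ heavyEvent P lv v t')
      ≤ (if t = t' then Tg else 0) + (if 2 ≤ (t ∩ t').card then P.k else 0)
        + P.weight (lv v) := by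
  have hk0 : 0 < P.k := zero_lt_one.trans_le P.one_le_k
  have hTg : 0 ≤ Tg := by
    by_contra! h
    nlinarith [P.ω_pos, sq_nonneg P.k, mul_pos P.ω_pos (neg_pos.2 h)]
  rw [heavyEvent_inter_self, volume_real_heavyEvent hP hv]
  have hW := Params.weight_pos (P := P) (lv v)
  have hWω : P.ω ≤ P.weight (lv v) := by
    simpa [Params.weight] using Params.weight_mono (P := P) (Nat.zero_le (lv v))
  set W := P.weight (lv v)
  have hcard := Finset.card_union_add_card_inter t t'
  have hle : (t ∩ t').card ≤ 3 := ht ▸ Finset.card_le_card Finset.inter_subset_left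
  have hpos : 0 < (t ∩ t').card := Finset.card_pos.2 ⟨v, Finset.mem_inter.2 ⟨hvt, hvt'⟩⟩
  rw [Finset.card_erase_of_mem (Finset.mem_union_left _ hvt)]
  have p1 : (0 : ℝ) ≤ if t = t' then Tg else 0 := by split_ifs <;> positivity
  have p2 : (0 : ℝ) ≤ if 2 ≤ (t ∩ t').card then P.k else 0 := by split_ifs <;> positivity
  obtain hj | hj | hj : (t ∩ t').card = 1 ∨ (t ∩ t').card = 2 ∨ (t ∩ t').card = 3 := by omega
  · have hn : (t ∪ t').card - 1 = 4 := by omega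
    have : P.k ^ 2 / W * (P.k ^ 2 / W) * (1 / W * (W / P.k) ^ 4) = W := by field_simp
    rw [hn, this]; linarith
  · have hn : (t ∪ t').card - 1 = 3 := by omega
    have : P.k ^ 2 / W * (P.k ^ 2 / W) * (1 / W * (W / P.k) ^ 3) = P.k := by field_simp
    rw [hn, this, if_pos (show 2 ≤ (t ∩ t').card by omega)]; linarith
  · have hn : (t ∪ t').card - 1 = 2 := by omega
    have : P.k ^ 2 / W * (P.k ^ 2 / W) * (1 / W * (W / P.k) ^ 2) = P.k ^ 2 / W := by field_simp
    have h2 : t ∩ t' = t := Finset.eq_of_subset_of_card_le Finset.inter_subset_left (by omega)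
    have h3 : t ∩ t' = t' := Finset.eq_of_subset_of_card_le Finset.inter_subset_right (by omega)
    have h4 : P.k ^ 2 / W ≤ Tg := by
      rw [div_le_iff₀ hW]
      nlinarith
    rw [hn, this, if_pos (h2.symm.trans h3)]; linarith

/-- Triangles `t` and `t'` counted at distinct vertices `v` and `v'` are correlated only if a vertex
other than `v` and `v'` belongs to both stars, or if they share the edge `vv'`. -/
theorem heavyEvent_cov_ne_le (hP : P.weight P.top = √P.k) (hω : 1 ≤ P.ω) {v v' : V}
    (hne : v ≠ v') (hv : lv v ≤ P.top) (hv' : lv v' ≤ P.top) {t t' : Finset V}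
    (ht : t.card = 3) (ht' : t'.card = 3) (hvt : v ∈ t) (hvt' : v' ∈ t') :
    P.k ^ 2 / P.weight (lv v) * (P.k ^ 2 / P.weight (lv v')) *
        volume.real (heavyEvent P lv v t ∩ heavyEvent P lv v' t') - 1
      ≤ (if 2 ≤ (t ∩ t').card then P.k else 0)
        + (if ∃ u ∈ t ∩ t', u ≠ v ∧ u ≠ v' then √P.k else 0) := by
  rw [heavyEvent_inter, volume_real_prod_three, volume_real_forall_mem, volume_real_forall_mem,
    Finset.prod_const, Finset.prod_pair hne, Params.volume_real_picks,
    Params.volume_real_selects hv, Params.volume_real_selects hv']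
  have hr := P.sqrt_pos
  have hr1 := P.one_le_sqrt
  have hkr := P.k_eq
  have hW := Params.weight_pos (P := P) (lv v)
  have hW' := Params.weight_pos (P := P) (lv v')
  have hW1 : 1 ≤ P.weight (lv v') := hω.trans <| by
    simpa [Params.weight] using Params.weight_mono (P := P) (Nat.zero_le (lv v'))
  have hWr := Params.weight_div_le_one hP hv'
  have hedge := volume_real_edges_le hP hv hv' ((t.erase v).image fun u => s(v, u))
    ((t'.erase v').image fun u => s(v', u))
  have hedge' := volume_real_edges_of_disjoint hP hv hv'
    (R := (t.erase v).image fun u => s(v, u)) (R' := (t'.erase v').image fun u => s(v', u))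
  rw [card_image_star, Finset.card_erase_of_mem hvt, ht] at hedge hedge'
  rw [card_image_star, Finset.card_erase_of_mem hvt', ht'] at hedge'
  simp only [Nat.reduceSub] at hedge hedge'
  set Q := volume.real {y : Sym2 V → unitInterval |
    (∀ e ∈ (t.erase v).image (fun u => s(v, u)), P.Below (lv v) (y e)) ∧
      ∀ e ∈ (t'.erase v').image (fun u => s(v', u)), P.Below (lv v') (y e)}
  set r := √P.k
  set W := P.weight (lv v)
  set W' := P.weight (lv v')
  have hsum := Finset.card_union_add_card_inter (t.erase v) (t'.erase v')
  rw [Finset.card_erase_of_mem hvt, Finset.card_erase_of_mem hvt', ht, ht'] at hsum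
  have p1 : (0 : ℝ) ≤ if 2 ≤ (t ∩ t').card then P.k else 0 := by
    rw [hkr]; split_ifs <;> positivity
  have p2 : (0 : ℝ) ≤ if ∃ u ∈ t ∩ t', u ≠ v ∧ u ≠ v' then r else 0 := by
    split_ifs <;> positivity
  have hsub : t.erase v ∩ t'.erase v' ⊆ t ∩ t' :=
    Finset.inter_subset_inter (Finset.erase_subset _ _) (Finset.erase_subset _ _)
  by_cases hdis : Disjoint ((t.erase v).image fun u => s(v, u))
      ((t'.erase v').image fun u => s(v', u))
  · rw [hedge' hdis]
    have hle : (t.erase v ∩ t'.erase v').card ≤ 2 := by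
      refine (Finset.card_le_card Finset.inter_subset_left).trans ?_
      rw [Finset.card_erase_of_mem hvt, ht]
    obtain hj | hj | hj : (t.erase v ∪ t'.erase v').card = 4 ∨
      (t.erase v ∪ t'.erase v').card = 3 ∨ (t.erase v ∪ t'.erase v').card = 2 := by omega
    · have : P.k ^ 2 / W * (P.k ^ 2 / W') * ((1 / r) ^ 4 * (1 / W * (1 / W') *
        ((W / r) ^ 2 * (W' / r) ^ 2))) = 1 := by
        rw [hkr]; field_simp
      rw [hj, this]; linarith
    · have : P.k ^ 2 / W * (P.k ^ 2 / W') * ((1 / r) ^ 3 * (1 / W * (1 / W') *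
        ((W / r) ^ 2 * (W' / r) ^ 2))) = r := by
        rw [hkr]; field_simp
      rw [hj, this]
      obtain ⟨u, hu⟩ : (t.erase v ∩ t'.erase v').Nonempty := Finset.card_pos.1 (by omega)
      have hu' := Finset.mem_inter.1 hu
      rw [if_pos (show ∃ u ∈ t ∩ t', u ≠ v ∧ u ≠ v' from
        ⟨u, hsub hu, Finset.ne_of_mem_erase hu'.1, Finset.ne_of_mem_erase hu'.2⟩)]
      linarith
    · have : P.k ^ 2 / W * (P.k ^ 2 / W') * ((1 / r) ^ 2 * (1 / W * (1 / W') *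
        ((W / r) ^ 2 * (W' / r) ^ 2))) = P.k := by
        rw [hkr]; field_simp
      have h2 : 2 ≤ (t ∩ t').card := le_trans (by omega) (Finset.card_le_card hsub)
      rw [hj, this, if_pos h2]
      linarith
  -- The stars share an edge only if this edge is `vv'`, and then both triangles contain it.
  · obtain ⟨e, he, he'⟩ := Finset.not_disjoint_iff.1 hdis
    obtain ⟨u, hu, rfl⟩ := Finset.mem_image.1 he
    obtain ⟨u', hu', huu⟩ := Finset.mem_image.1 he'
    obtain ⟨rfl, -⟩ | ⟨rfl, rfl⟩ := Sym2.eq_iff.1 huu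
    · exact absurd rfl hne
    have hut := (Finset.mem_erase.1 hu).2
    have hut' := (Finset.mem_erase.1 hu').2
    have h2 : 2 ≤ (t ∩ t').card := by
      rw [← Finset.card_pair hne]
      refine Finset.card_le_card fun x hx => ?_
      rcases Finset.mem_insert.1 hx with rfl | hx
      · exact Finset.mem_inter.2 ⟨hvt, hut'⟩
      · rw [Finset.mem_singleton.1 hx]
        exact Finset.mem_inter.2 ⟨hut, hvt'⟩
    have hn : 3 ≤ (t.erase u' ∪ t'.erase v').card := by
      have h3 : insert u' (t.erase u') ⊆ t.erase u' ∪ t'.erase v' := by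
        refine Finset.insert_subset (Finset.mem_union_right _ hu') Finset.subset_union_left
      have := Finset.card_le_card h3
      rwa [Finset.insert_erase hvt, ht] at this
    have hm : 1 ≤ (((t'.erase v').image fun x => s(v', x)) \
        ((t.erase u').image fun x => s(u', x))).card := by
      obtain ⟨w, hw, hwu⟩ := Finset.exists_mem_ne (s := t'.erase v')
        (by rw [Finset.card_erase_of_mem hvt', ht']; norm_num) u'
      refine Finset.card_pos.2 ⟨s(v', w), Finset.mem_sdiff.2 ⟨Finset.mem_image_of_mem _ hw, ?_⟩⟩
      intro h
      obtain ⟨x, -, hx⟩ := Finset.mem_image.1 h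
      rcases Sym2.eq_iff.1 hx with ⟨h1, -⟩ | ⟨h1, -⟩
      · exact hne h1
      · exact hwu h1.symm
    have hQ : Q ≤ (W / r) ^ 2 * (W' / r) := by
      refine hedge.trans (mul_le_mul_of_nonneg_left ?_ (by positivity))
      exact pow_le_of_le_one (by positivity) hWr (by omega)
    have hq : (1 / r) ^ (t.erase u' ∪ t'.erase v').card ≤ (1 / r) ^ 3 :=
      pow_le_pow_of_le_one (by positivity) (by rw [div_le_one hr]; exact hr1) hn
    have hQ0 : 0 ≤ Q := measureReal_nonneg
    have hk0 : 0 < P.k := by rw [hkr]; positivity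
    have h3 : P.k ^ 2 / W * (P.k ^ 2 / W') * ((1 / r) ^ (t.erase u' ∪ t'.erase v').card *
        (1 / W * (1 / W') * Q)) ≤ P.k / W' := by
      calc _ ≤ P.k ^ 2 / W * (P.k ^ 2 / W') * ((1 / r) ^ 3 *
          (1 / W * (1 / W') * ((W / r) ^ 2 * (W' / r)))) := by gcongr
        _ = P.k / W' := by rw [hkr]; field_simp
    have h4 : P.k / W' ≤ P.k := div_le_self hk0.le hW1
    rw [if_pos h2]
    linarith

end Covariance

/-! ### The second moment of the estimate, given the levels -/

section ConditionalMoments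

variable {V : Type u} [DecidableEq V] [Fintype V] {P : Params} {lv : V → ℕ}
  (G : SimpleGraph V) (S : Finset V)

/-- The triangles without a vertex in `S`. -/
noncomputable def lightTriangles : Finset (Finset V) := (triangles G).filter fun t => ∀ v ∈ t, v ∉ S

/-- A triangle is counted once at each of its vertices in `S`, so each time it counts for the
inverse of their number. -/
noncomputable def share (t : Finset V) : ℝ := 1 / ((t.filter fun x => x ∈ S).card : ℝ)

omit [Fintype V] in
theorem share_nonneg (t : Finset V) : 0 ≤ share S t := by unfold share; positivity

omit [Fintype V] in
theorem share_le_one (t : Finset V) : share S t ≤ 1 := by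
  unfold share
  rcases Nat.eq_zero_or_pos (t.filter fun x => x ∈ S).card with h | h
  · simp [h]
  · exact (div_le_one (by exact_mod_cast h)).2 (by exact_mod_cast h)

theorem sum_trianglesAt (f : Finset V → ℝ) :
    ∑ v, ∑ t ∈ trianglesAt G v, f t = 3 * ∑ t ∈ triangles G, f t := by
  simp only [trianglesAt, Finset.sum_filter]
  rw [Finset.sum_comm, Finset.mul_sum]
  refine Finset.sum_congr rfl fun t ht => ?_
  rw [← Finset.sum_filter, Finset.filter_univ_mem, Finset.sum_const, card_of_mem_triangles ht]
  simp

theorem sum_trianglesAt_le {f : Finset V → ℝ} (hf : ∀ t, 0 ≤ f t) :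
    ∑ v ∈ S, ∑ t ∈ trianglesAt G v, f t ≤ 3 * ∑ t ∈ triangles G, f t := by
  rw [← sum_trianglesAt]
  exact Finset.sum_le_sum_of_subset_of_nonneg (Finset.subset_univ _)
    fun v _ _ => Finset.sum_nonneg fun t _ => hf t

/-- Light triangles and shares at the vertices of `S` together count every triangle once. -/
theorem card_lightTriangles_add_sum_share :
    ((lightTriangles G S).card : ℝ) + ∑ v ∈ S, ∑ t ∈ trianglesAt G v, share S t
      = numTriangles G := by
  have h1 : ∑ v ∈ S, ∑ t ∈ trianglesAt G v, share S t
      = ∑ t ∈ triangles G, if ∀ v ∈ t, v ∉ S then 0 else (1 : ℝ) := by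
    simp only [trianglesAt, Finset.sum_filter]
    rw [Finset.sum_comm]
    refine Finset.sum_congr rfl fun t _ => ?_
    rw [← Finset.sum_filter, Finset.sum_const, nsmul_eq_mul, share]
    have h2 : S.filter (fun v => v ∈ t) = t.filter fun x => x ∈ S := by ext; simp [and_comm]
    rw [h2]
    split_ifs with h
    · rw [Finset.filter_eq_empty_iff.2 fun x hx => h x hx]
      simp
    · push Not at h
      obtain ⟨v, hv, hvS⟩ := h
      have : 0 < (t.filter fun x => x ∈ S).card :=
        Finset.card_pos.2 ⟨v, Finset.mem_filter.2 ⟨hv, hvS⟩⟩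
      rw [mul_one_div_cancel]
      exact_mod_cast this.ne'
  rw [h1, lightTriangles, Finset.card_filter, Nat.cast_sum, ← Finset.sum_add_distrib, numTriangles,
    Finset.card_eq_sum_ones, Nat.cast_sum]
  refine Finset.sum_congr rfl fun t _ => ?_
  split_ifs <;> simp

variable (P) in
/-- The estimate of the number of light triangles as a weighted sum of indicators. -/
noncomputable def lightSum
    (y : (V → unitInterval) × (V → unitInterval) × (Sym2 V → unitInterval)) : ℝ :=
  ∑ t ∈ lightTriangles G S, (lightEvent P t).indicator (fun _ => √P.k ^ 3) y

variable (P lv) in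
/-- The estimate of the number of other triangles as a weighted sum of indicators. -/
noncomputable def heavySum
    (y : (V → unitInterval) × (V → unitInterval) × (Sym2 V → unitInterval)) : ℝ :=
  ∑ v ∈ S, ∑ t ∈ trianglesAt G v,
    (heavyEvent P lv v t).indicator (fun _ => P.k ^ 2 / P.weight (lv v) * share S t) y

theorem integrable_lightSum : Integrable (lightSum P G S) :=
  integrable_finsetSum _ fun t _ => integrable_indicator_one _ (measurableSet_lightEvent t) _

theorem integrable_heavySum : Integrable (heavySum P lv G S) :=
  integrable_finsetSum _ fun v _ => integrable_finsetSum _ fun t _ =>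
    integrable_indicator_one _ (measurableSet_heavyEvent lv v t) _

theorem light_coeff_mul {t : Finset V} (ht : t ∈ triangles G) :
    √P.k ^ 3 * volume.real (lightEvent P t) = 1 := by
  have := P.sqrt_pos
  rw [volume_real_lightEvent, card_of_mem_triangles ht]
  field_simp

theorem heavy_coeff_mul (hP : P.weight P.top = √P.k) {v : V} (hv : lv v ≤ P.top) {t : Finset V}
    (ht : t ∈ trianglesAt G v) :
    P.k ^ 2 / P.weight (lv v) * volume.real (heavyEvent P lv v t) = 1 := by
  have := Params.weight_pos (P := P) (lv v)
  have hk : 0 < P.k := zero_lt_one.trans_le P.one_le_k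
  obtain ⟨ht, hvt⟩ := mem_trianglesAt.1 ht
  rw [volume_real_heavyEvent hP hv, Finset.card_erase_of_mem hvt, card_of_mem_triangles ht]
  simp only [Nat.reduceSub]
  field_simp

theorem integral_lightSum : ∫ y, lightSum P G S y = (lightTriangles G S).card := by
  unfold lightSum
  have h1 : ∀ t ∈ lightTriangles G S, √P.k ^ 3 * volume.real (lightEvent P t) = 1 :=
    fun t ht => light_coeff_mul G (Finset.mem_filter.1 ht).1
  rw [integral_sum_indicator _ _ _ _ fun t _ => measurableSet_lightEvent t,
    Finset.sum_congr rfl h1]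
  simp

theorem integral_heavySum (hP : P.weight P.top = √P.k) (hlv : ∀ v ∈ S, lv v ≤ P.top) :
    ∫ y, heavySum P lv G S y = ∑ v ∈ S, ∑ t ∈ trianglesAt G v, share S t := by
  unfold heavySum
  rw [integral_finsetSum _ fun v _ => integrable_finsetSum _ fun t _ =>
    integrable_indicator_one _ (measurableSet_heavyEvent lv v t) _]
  refine Finset.sum_congr rfl fun v hv => ?_
  rw [integral_sum_indicator _ _ _ _ fun t _ => measurableSet_heavyEvent lv v t]
  refine Finset.sum_congr rfl fun t ht => ?_
  rw [mul_right_comm, heavy_coeff_mul G hP (hlv v hv) ht, one_mul]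

/-- The variance of the light sum as a sum of covariances. -/
theorem integral_lightSum_sub_sq :
    ∫ y, (lightSum P G S y - (lightTriangles G S).card) ^ 2
      = ∑ t ∈ lightTriangles G S, ∑ t' ∈ lightTriangles G S,
        (√P.k ^ 3 * √P.k ^ 3 * volume.real (lightEvent P t ∩ lightEvent P t')
          - √P.k ^ 3 * volume.real (lightEvent P t)
            * (√P.k ^ 3 * volume.real (lightEvent P t'))) := by
  have := integral_sq_sum_indicator_sub volume (lightTriangles G S) (fun _ => √P.k ^ 3)
    (lightEvent P) fun t _ => measurableSet_lightEvent t
  rw [← this]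
  have h2 : ∑ t ∈ lightTriangles G S, √P.k ^ 3 * volume.real (lightEvent P t)
      = (lightTriangles G S).card := by
    have h1 : ∀ t ∈ lightTriangles G S, √P.k ^ 3 * volume.real (lightEvent P t) = 1 :=
      fun t ht => light_coeff_mul G (Finset.mem_filter.1 ht).1
    rw [Finset.sum_congr rfl h1]
    simp
  rw [h2]
  rfl

/-- Two light triangles share a vertex at a light vertex `v` only, so such pairs contribute the
squares of the numbers of triangles at the light vertices. -/
theorem integral_lightSum_sub_sq_le :
    ∫ y, (lightSum P G S y - (lightTriangles G S).card) ^ 2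
      ≤ √P.k ^ 3 * numTriangles G + P.k * (3 * maxEdgeTriangles G * numTriangles G)
        + √P.k * ∑ v ∈ Sᶜ, ((trianglesAt G v).card : ℝ) ^ 2 := by
  rw [integral_lightSum_sub_sq]
  have hr := P.sqrt_pos
  have hL : lightTriangles G S ⊆ triangles G := Finset.filter_subset _ _
  have hcov := Finset.sum_le_sum fun t (ht : t ∈ lightTriangles G S) =>
    Finset.sum_le_sum fun t' (ht' : t' ∈ lightTriangles G S) =>
      lightEvent_cov_le (P := P) (card_of_mem_triangles (hL ht)) (card_of_mem_triangles (hL ht'))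
  refine hcov.trans ?_
  simp only [Finset.sum_add_distrib]
  refine add_le_add (add_le_add ?_ ?_) ?_
  · rw [Finset.sum_congr rfl fun t ht =>
      (Finset.sum_ite_eq (lightTriangles G S) t fun _ => √P.k ^ 3)]
    rw [Finset.sum_congr rfl fun t ht => if_pos ht, Finset.sum_const, nsmul_eq_mul, mul_comm]
    refine mul_le_mul_of_nonneg_left ?_ (by positivity)
    exact_mod_cast Finset.card_le_card hL
  · refine le_trans ?_ (mul_le_mul_of_nonneg_left (sum_sum_two_le_card_inter_le G)
      (zero_le_one.trans P.one_le_k))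
    simp only [Finset.mul_sum, mul_ite, mul_one, mul_zero, ← P.k_eq]
    have hp : ∀ t t' : Finset V, (0 : ℝ) ≤ if 2 ≤ (t ∩ t').card then P.k else 0 := by
      intro t t'; have := P.one_le_k; split_ifs <;> linarith
    exact (Finset.sum_le_sum_of_subset_of_nonneg hL fun t _ _ =>
      Finset.sum_nonneg fun t' _ => hp t t').trans (Finset.sum_le_sum fun t _ =>
        Finset.sum_le_sum_of_subset_of_nonneg hL fun t' _ _ => hp t t')
  · have h1 : ∀ t ∈ lightTriangles G S, ∀ t' ∈ lightTriangles G S,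
        (if (t ∩ t').Nonempty then √P.k else 0)
          ≤ √P.k * ∑ v ∈ Sᶜ, (if v ∈ t then (1 : ℝ) else 0) * (if v ∈ t' then (1 : ℝ) else 0) := by
      intro t ht t' _
      have hn : ∀ v ∈ Sᶜ,
          (0 : ℝ) ≤ (if v ∈ t then (1 : ℝ) else 0) * (if v ∈ t' then (1 : ℝ) else 0) := by
        intro v _; split_ifs <;> simp
      split_ifs with h
      · obtain ⟨v, hv⟩ := h
        obtain ⟨hv1, hv2⟩ := Finset.mem_inter.1 hv
        have hvS : v ∈ Sᶜ := Finset.mem_compl.2 ((Finset.mem_filter.1 ht).2 v hv1)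
        refine le_mul_of_one_le_right hr.le (le_trans ?_ (Finset.single_le_sum hn hvS))
        simp [hv1, hv2]
      · exact mul_nonneg hr.le (Finset.sum_nonneg hn)
    refine (Finset.sum_le_sum fun t ht => Finset.sum_le_sum fun t' ht' => h1 t ht t' ht').trans ?_
    simp only [← Finset.mul_sum]
    refine mul_le_mul_of_nonneg_left ?_ hr.le
    have h2 : ∑ t ∈ lightTriangles G S, ∑ t' ∈ lightTriangles G S, ∑ v ∈ Sᶜ,
        (if v ∈ t then (1 : ℝ) else 0) * (if v ∈ t' then (1 : ℝ) else 0)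
        = ∑ v ∈ Sᶜ, (∑ t ∈ lightTriangles G S, if v ∈ t then (1 : ℝ) else 0) ^ 2 := by
      simp only [sq, Finset.sum_mul_sum]
      conv_rhs => rw [Finset.sum_comm]
      exact Finset.sum_congr rfl fun t _ => Finset.sum_comm
    rw [h2]
    refine Finset.sum_le_sum fun v _ => pow_le_pow_left₀ (Finset.sum_nonneg fun t _ => by
      split_ifs <;> simp) ?_ 2
    rw [← Finset.sum_filter, Finset.sum_const, nsmul_eq_mul, mul_one]
    exact_mod_cast Finset.card_le_card (Finset.filter_subset_filter _ hL)

/-- The covariance of two terms of the heavy sum, without the factor of their shares. -/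
noncomputable def heavyCov (P : Params) (lv : V → ℕ) (v : V) (t : Finset V) (v' : V)
    (t' : Finset V) : ℝ :=
  P.k ^ 2 / P.weight (lv v) * (P.k ^ 2 / P.weight (lv v')) *
    volume.real (heavyEvent P lv v t ∩ heavyEvent P lv v' t') - 1

theorem integral_heavySum_sub_sq (hP : P.weight P.top = √P.k) (hlv : ∀ v ∈ S, lv v ≤ P.top) :
    ∫ y, (heavySum P lv G S y - ∑ v ∈ S, ∑ t ∈ trianglesAt G v, share S t) ^ 2
      = ∑ v ∈ S, ∑ t ∈ trianglesAt G v, ∑ v' ∈ S, ∑ t' ∈ trianglesAt G v',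
        share S t * share S t' * heavyCov P lv v t v' t' := by
  have key := integral_sq_sum_indicator_sub volume (S.sigma fun v => trianglesAt G v)
    (fun p => P.k ^ 2 / P.weight (lv p.1) * share S p.2)
    (fun p => heavyEvent P lv p.1 p.2) fun p _ => measurableSet_heavyEvent lv p.1 p.2
  have h1 : ∀ p ∈ S.sigma fun v => trianglesAt G v, P.k ^ 2 / P.weight (lv p.1) * share S p.2
      * volume.real (heavyEvent P lv p.1 p.2) = share S p.2 := by
    intro p hp
    obtain ⟨hv, ht⟩ := Finset.mem_sigma.1 hp
    rw [mul_right_comm, heavy_coeff_mul G hP (hlv _ hv) ht, one_mul]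
  rw [Finset.sum_congr rfl h1] at key
  simp only [Finset.sum_sigma] at key
  rw [show (fun y => (heavySum P lv G S y - ∑ v ∈ S, ∑ t ∈ trianglesAt G v, share S t) ^ 2)
    = _ from rfl]
  unfold heavySum
  rw [key]
  refine Finset.sum_congr rfl fun v hv => Finset.sum_congr rfl fun t ht =>
    Finset.sum_congr rfl fun v' hv' => Finset.sum_congr rfl fun t' ht' => ?_
  have e1 := h1 ⟨v, t⟩ (Finset.mem_sigma.2 ⟨hv, ht⟩)
  have e2 := h1 ⟨v', t'⟩ (Finset.mem_sigma.2 ⟨hv', ht'⟩)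
  simp only at e1 e2
  rw [e1, e2, heavyCov]
  ring

theorem integral_heavySum_sub_sq_le (hP : P.weight P.top = √P.k)
    (hlv : ∀ v ∈ S, lv v ≤ P.top) {Tg : ℝ} (hk : P.k ^ 2 ≤ P.ω * Tg) (hω : 1 ≤ P.ω) :
    ∫ y, (heavySum P lv G S y - ∑ v ∈ S, ∑ t ∈ trianglesAt G v, share S t) ^ 2
      ≤ 3 * numTriangles G * Tg + 9 * (P.k * (3 * maxEdgeTriangles G * numTriangles G))
        + ∑ v ∈ S, P.weight (lv v) * ((trianglesAt G v).card : ℝ) ^ 2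
        + √P.k * (S.card * (6 * maxEdgeTriangles G * numTriangles G)) := by
  have hk0 : 0 < P.k := zero_lt_one.trans_le P.one_le_k
  have hTg : 0 ≤ Tg := by
    by_contra! h
    nlinarith [P.ω_pos, sq_nonneg P.k, mul_pos P.ω_pos (neg_pos.2 h)]
  have hr := P.sqrt_pos
  rw [integral_heavySum_sub_sq G S hP hlv]
  set B : V → Finset V → V → Finset V → ℝ := fun v t v' t' =>
    (if v = v' then if t = t' then Tg else 0 else 0) + (if 2 ≤ (t ∩ t').card then P.k else 0)
      + (if v = v' then P.weight (lv v) else 0)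
      + (if ∃ u ∈ t ∩ t', u ≠ v ∧ u ≠ v' then √P.k else 0) with hB
  have hbound : ∀ v ∈ S, ∀ t ∈ trianglesAt G v, ∀ v' ∈ S, ∀ t' ∈ trianglesAt G v',
      share S t * share S t' * heavyCov P lv v t v' t' ≤ B v t v' t' := by
    intro v hv t ht v' hv' t' ht'
    obtain ⟨ht, hvt⟩ := mem_trianglesAt.1 ht
    obtain ⟨ht', hvt'⟩ := mem_trianglesAt.1 ht'
    have c3 := card_of_mem_triangles ht
    have c3' := card_of_mem_triangles ht'
    have hp : (0 : ℝ) ≤ if ∃ u ∈ t ∩ t', u ≠ v ∧ u ≠ v' then √P.k else 0 := by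
      split_ifs <;> positivity
    have hcov : heavyCov P lv v t v' t' ≤ B v t v' t' := by
      by_cases hvv : v = v'
      · subst hvv
        have := heavyEvent_cov_self_le hP hk hω (hlv v hv) c3 c3' hvt hvt'
        simp only [hB, heavyCov, if_true]
        linarith
      · have := heavyEvent_cov_ne_le hP hω hvv (hlv v hv) (hlv v' hv') c3 c3' hvt hvt'
        simp only [hB, heavyCov, if_neg hvv]
        linarith
    have hB0 : 0 ≤ B v t v' t' := by
      have := Params.weight_pos (P := P) (lv v)
      simp only [hB]
      refine add_nonneg (add_nonneg (add_nonneg ?_ ?_) ?_) hp <;> (try split_ifs) <;> linarith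
    have hs0 : 0 ≤ share S t * share S t' := mul_nonneg (share_nonneg S t) (share_nonneg S t')
    have hs1 : share S t * share S t' ≤ 1 :=
      mul_le_one₀ (share_le_one S t) (share_nonneg S t') (share_le_one S t')
    exact (mul_le_mul_of_nonneg_left hcov hs0).trans (mul_le_of_le_one_left hB0 hs1)
  refine (Finset.sum_le_sum fun v hv => Finset.sum_le_sum fun t ht => Finset.sum_le_sum
    fun v' hv' => Finset.sum_le_sum fun t' ht' => hbound v hv t ht v' hv' t' ht').trans ?_
  simp only [hB, Finset.sum_add_distrib]
  refine add_le_add (add_le_add (add_le_add ?_ ?_) ?_) ?_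
  · have h1 : ∀ v ∈ S, ∀ t ∈ trianglesAt G v, ∑ v' ∈ S, ∑ t' ∈ trianglesAt G v',
        (if v = v' then if t = t' then Tg else 0 else 0) = Tg := by
      intro v hv t ht
      rw [Finset.sum_eq_single_of_mem v hv]
      · simp [ht]
      · intro v' _ hne
        simp [hne.symm]
    rw [Finset.sum_congr rfl fun v hv => Finset.sum_congr rfl fun t ht => h1 v hv t ht]
    refine (sum_trianglesAt_le G S fun _ => hTg).trans (le_of_eq ?_)
    rw [Finset.sum_const, nsmul_eq_mul, numTriangles]
    ring
  · have hp : ∀ t t' : Finset V, (0 : ℝ) ≤ if 2 ≤ (t ∩ t').card then P.k else 0 := by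
      intro t t'; split_ifs <;> linarith
    calc _ ≤ ∑ v ∈ S, ∑ t ∈ trianglesAt G v, 3 * ∑ t' ∈ triangles G,
          (if 2 ≤ (t ∩ t').card then P.k else 0) :=
          Finset.sum_le_sum fun v _ => Finset.sum_le_sum fun t _ =>
            sum_trianglesAt_le G S fun t' => hp t t'
      _ ≤ 3 * ∑ t ∈ triangles G, 3 * ∑ t' ∈ triangles G,
          (if 2 ≤ (t ∩ t').card then P.k else 0) :=
          sum_trianglesAt_le G S fun t => mul_nonneg (by norm_num)
            (Finset.sum_nonneg fun t' _ => hp t t')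
      _ = 9 * (P.k * ∑ t ∈ triangles G, ∑ t' ∈ triangles G,
          (if 2 ≤ (t ∩ t').card then (1 : ℝ) else 0)) := by
          simp only [Finset.mul_sum, mul_ite, mul_one, mul_zero]
          refine Finset.sum_congr rfl fun t _ => Finset.sum_congr rfl fun t' _ => ?_
          split_ifs <;> ring
      _ ≤ _ := by
          gcongr
          exact sum_sum_two_le_card_inter_le G
  · refine le_of_eq (Finset.sum_congr rfl fun v hv => ?_)
    have h1 : ∀ t ∈ trianglesAt G v, ∑ v' ∈ S, ∑ t' ∈ trianglesAt G v',
        (if v = v' then P.weight (lv v) else 0)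
          = (trianglesAt G v).card * P.weight (lv v) := by
      intro t _
      rw [Finset.sum_eq_single_of_mem v hv]
      · simp
      · intro v' _ hne
        simp [hne.symm]
    rw [Finset.sum_congr rfl h1, Finset.sum_const, nsmul_eq_mul]
    ring
  · refine le_trans (le_of_eq ?_)
      (mul_le_mul_of_nonneg_left (sum_sum_common_vertex_le G S) hr.le)
    simp only [Finset.mul_sum, mul_ite, mul_one, mul_zero]

/-- If vertices are sampled with probability one, then the light sum has no variance. -/
theorem integral_lightSum_sub_sq_of_k_eq_one (hk : P.k = 1) :
    ∫ y, (lightSum P G S y - (lightTriangles G S).card) ^ 2 ≤ 0 := by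
  rw [integral_lightSum_sub_sq]
  refine Finset.sum_nonpos fun t ht => Finset.sum_nonpos fun t' ht' => ?_
  rw [light_coeff_mul G (Finset.mem_filter.1 ht).1, light_coeff_mul G (Finset.mem_filter.1 ht').1,
    hk]
  simp

/-- If vertices are sampled with probability one, then the heavy sum has no variance. -/
theorem integral_heavySum_sub_sq_of_k_eq_one (hP : P.weight P.top = √P.k)
    (hlv : ∀ v ∈ S, lv v ≤ P.top) (hk : P.k = 1) (hω : 1 ≤ P.ω) :
    ∫ y, (heavySum P lv G S y - ∑ v ∈ S, ∑ t ∈ trianglesAt G v, share S t) ^ 2 ≤ 0 := by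
  rw [integral_heavySum_sub_sq G S hP hlv]
  refine Finset.sum_nonpos fun v hv => Finset.sum_nonpos fun t _ =>
    Finset.sum_nonpos fun v' hv' => Finset.sum_nonpos fun t' _ => ?_
  refine mul_nonpos_of_nonneg_of_nonpos (mul_nonneg (share_nonneg S t) (share_nonneg S t')) ?_
  have hw : ∀ x, 1 ≤ P.weight (lv x) := fun x => hω.trans <| by
    simpa [Params.weight] using Params.weight_mono (P := P) (Nat.zero_le (lv x))
  have h1 : 1 ^ 2 / P.weight (lv v) * (1 ^ 2 / P.weight (lv v')) ≤ 1 := by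
    rw [one_pow]
    exact mul_le_one₀ ((div_le_one (by linarith [hw v])).2 (hw v))
      (div_nonneg zero_le_one (by linarith [hw v']))
      ((div_le_one (by linarith [hw v'])).2 (hw v'))
  rw [heavyCov, hk, sub_nonpos]
  exact mul_le_one₀ h1 measureReal_nonneg measureReal_le_one

end ConditionalMoments

/-! ### The mean and the second moment of the estimate of a run -/

section Run

/-- Integrals over a triple product are compared by fixing the first two components. -/
theorem integral_triple_mono {α β γ : Type*} [MeasureSpace α] [MeasureSpace β] [MeasureSpace γ]
    [SFinite (volume : Measure α)] [SFinite (volume : Measure β)] [SFinite (volume : Measure γ)]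
    {f g : α × β × γ → ℝ} (hf : Integrable f) (hg : Integrable g)
    (h : ∀ a b, ∫ c, f (a, b, c) ≤ ∫ c, g (a, b, c)) : ∫ x, f x ≤ ∫ x, g x := by
  have e : MeasurePreserving (MeasurableEquiv.prodAssoc : (α × β) × γ ≃ᵐ α × β × γ)
      volume volume := measurePreserving_prodAssoc volume volume volume
  have hf' : Integrable (fun x : (α × β) × γ => f (MeasurableEquiv.prodAssoc x))
      (volume.prod volume) := (e.integrable_comp_emb (MeasurableEquiv.measurableEmbedding _)).2 hf
  have hg' : Integrable (fun x : (α × β) × γ => g (MeasurableEquiv.prodAssoc x))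
      (volume.prod volume) := (e.integrable_comp_emb (MeasurableEquiv.measurableEmbedding _)).2 hg
  rw [← e.integral_comp' f, ← e.integral_comp' g, Measure.volume_eq_prod (α × β) γ,
    integral_prod _ hf', integral_prod _ hg']
  exact integral_mono hf'.integral_prod_left hg'.integral_prod_left fun x => h x.1 x.2

theorem integral_triple_congr {α β γ : Type*} [MeasureSpace α] [MeasureSpace β] [MeasureSpace γ]
    [SFinite (volume : Measure α)] [SFinite (volume : Measure β)] [SFinite (volume : Measure γ)]
    {f g : α × β × γ → ℝ} (hf : Integrable f) (hg : Integrable g)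
    (h : ∀ a b, ∫ c, f (a, b, c) = ∫ c, g (a, b, c)) : ∫ x, f x = ∫ x, g x :=
  le_antisymm (integral_triple_mono hf hg fun a b => (h a b).le)
    (integral_triple_mono hg hf fun a b => (h a b).ge)

variable {V : Type u} [DecidableEq V] [Fintype V] (P : Params) (Tg : ℝ) (G : SimpleGraph V)

/-- The vertices that are not light. -/
noncomputable def heavySet (s : RunSeed V) : Finset V :=
  Finset.univ.filter fun v => level P s Tg G v ≠ ⊤

/-- The level of a vertex, with the value `0` at light vertices. -/
noncomputable def scaleOf (s : RunSeed V) (v : V) : ℕ := (level P s Tg G v).untopD 0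

variable {P Tg G}

theorem mem_heavySet {s : RunSeed V} {v : V} :
    v ∈ heavySet P Tg G s ↔ level P s Tg G v ≠ ⊤ := by simp [heavySet]

theorem level_eq_scaleOf {s : RunSeed V} {v : V} (hv : v ∈ heavySet P Tg G s) :
    level P s Tg G v = (scaleOf P Tg G s v : ℕ) := by
  obtain ⟨h, hh⟩ := WithTop.ne_top_iff_exists.1 (mem_heavySet.1 hv)
  rw [scaleOf, ← hh]
  rfl

theorem scaleOf_le {s : RunSeed V} {v : V} (hv : v ∈ heavySet P Tg G s) :
    scaleOf P Tg G s v ≤ P.top := level_le_top (level_eq_scaleOf hv)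

variable (P Tg G)

theorem lightEstimate_eq_lightSum (s : RunSeed V) :
    lightEstimate P s Tg G = lightSum P G (heavySet P Tg G s) s.2.2 := by
  classical
  have h1 : (triangles G).filter (fun t => ∀ v ∈ t, level P s Tg G v = ⊤ ∧ C P s v)
      = (lightTriangles G (heavySet P Tg G s)).filter fun t => s.2.2 ∈ lightEvent P t := by
    ext t
    simp only [lightTriangles, Finset.mem_filter, mem_heavySet, not_not, lightEvent,
      Set.mem_ofPred_eq, and_assoc]
    exact and_congr_right fun _ => ⟨fun h => ⟨fun v hv => (h v hv).1, fun v hv => (h v hv).2⟩,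
      fun h v hv => ⟨h.1 v hv, h.2 v hv⟩⟩
  have h2 : lightEstimate P s Tg G = P.k ^ (3 / 2 : ℝ) *
      (((triangles G).filter
        (fun t => ∀ v ∈ t, level P s Tg G v = ⊤ ∧ C P s v)).card : ℝ) := by
    unfold lightEstimate
    congr!
  rw [h2, h1, lightSum, P.k_rpow, Finset.card_filter, Nat.cast_sum, Finset.mul_sum]
  refine Finset.sum_congr rfl fun t _ => ?_
  by_cases h : s.2.2 ∈ lightEvent P t <;> simp [h]

theorem vertexEstimate_eq (s : RunSeed V) (v : V) (h : ℕ) :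
    vertexEstimate P s Tg G v h = ∑ t ∈ trianglesAt G v,
      Set.indicator {y | (y.1, y.2.2) ∈ starEvent P h v t}
        (fun _ => P.k ^ 2 / P.weight h * share (heavySet P Tg G s) t) s.2.2 := by
  classical
  have h1 : vertexEstimate P s Tg G v h = ∑ t ∈ (trianglesAt G v).filter
      (fun t => ∀ u ∈ t, u ≠ v → C P s u ∧ RC P s h s(v, u)),
      P.k ^ 2 / P.weight h * share (heavySet P Tg G s) t := by
    unfold vertexEstimate share
    refine Finset.sum_congr (by congr!) fun t _ => ?_
    refine congrArg (fun n : Finset V => P.k ^ 2 / P.weight h * (1 / (n.card : ℝ))) ?_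
    ext x
    simp [mem_heavySet]
  rw [h1, Finset.sum_filter]
  refine Finset.sum_congr rfl fun t _ => ?_
  rw [Set.indicator_apply]
  exact if_congr Iff.rfl rfl rfl

theorem heavyEstimate_eq_heavySum (s : RunSeed V) :
    heavyEstimate P s Tg G
      = heavySum P (scaleOf P Tg G s) G (heavySet P Tg G s) s.2.2 := by
  classical
  unfold heavyEstimate heavySum
  rw [← Finset.sum_subset (Finset.subset_univ (heavySet P Tg G s))]
  · refine Finset.sum_congr rfl fun v hv => ?_
    have hl := level_eq_scaleOf hv
    have hmem : ∀ h, h ∈ (Finset.range (P.top + 1)).filter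
        (fun h : ℕ => level P s Tg G v = (h : WithTop ℕ) ∧ Scale P s v h) ↔
          h = scaleOf P Tg G s v ∧ Scale P s v (scaleOf P Tg G s v) := by
      intro h
      rw [Finset.mem_filter, Finset.mem_range, hl, Nat.cast_inj]
      constructor
      · rintro ⟨-, rfl, h2⟩
        exact ⟨rfl, h2⟩
      · rintro ⟨rfl, h2⟩
        exact ⟨Nat.lt_succ_of_le (scaleOf_le hv), rfl, h2⟩
    by_cases hs : Scale P s v (scaleOf P Tg G s v)
    · have hset : (Finset.range (P.top + 1)).filter
          (fun h : ℕ => level P s Tg G v = (h : WithTop ℕ) ∧ Scale P s v h)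
            = {scaleOf P Tg G s v} := by
        ext h; rw [hmem]; simp [hs]
      refine (Finset.sum_congr (by convert hset) fun _ _ => rfl).trans ?_
      rw [Finset.sum_singleton, vertexEstimate_eq]
      refine Finset.sum_congr rfl fun t _ => ?_
      rw [Set.indicator_apply, Set.indicator_apply]
      refine if_congr ?_ rfl rfl
      exact ⟨fun h => ⟨hs, h⟩, fun h => h.2⟩
    · have hset : (Finset.range (P.top + 1)).filter
          (fun h : ℕ => level P s Tg G v = (h : WithTop ℕ) ∧ Scale P s v h) = ∅ := by
        ext h; rw [hmem]; simp [hs]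
      refine (Finset.sum_congr (by convert hset) fun _ _ => rfl).trans ?_
      rw [Finset.sum_empty]
      refine (Finset.sum_eq_zero fun t _ => Set.indicator_of_notMem (fun h => hs h.1) _).symm
  · intro v _ hv
    rw [mem_heavySet, not_not] at hv
    refine Finset.sum_eq_zero fun h hh => ?_
    have := (Finset.mem_filter.1 hh).2.1
    rw [hv] at this
    exact absurd this.symm (WithTop.natCast_ne_top h)

/-- The estimate of a run is unbiased. -/
theorem integral_runEstimate (hP : P.weight P.top = √P.k) :
    ∫ s, runEstimate P s Tg G = numTriangles G := by
  have h : ∫ s, runEstimate P s Tg G = ∫ _ : RunSeed V, (numTriangles G : ℝ) := by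
    refine integral_triple_congr (integrable_of_signature (runEstimate_factorsThrough P Tg G))
      (integrable_const _) fun a b => ?_
    -- The levels are determined by `a` and `b`.
    set S := heavySet P Tg G (a, b, fun _ => 0, fun _ => 0, fun _ => 0) with hS
    set lv := scaleOf P Tg G (a, b, fun _ => 0, fun _ => 0, fun _ => 0) with hlv
    have h1 : ∀ c, runEstimate P (a, b, c) Tg G = lightSum P G S c + heavySum P lv G S c :=
      fun c => by
        rw [runEstimate, lightEstimate_eq_lightSum, heavyEstimate_eq_heavySum]
        rfl
    simp only [h1]
    rw [integral_add (integrable_lightSum G S) (integrable_heavySum G S), integral_lightSum,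
      integral_heavySum G S hP fun v hv => scaleOf_le hv, card_lightTriangles_add_sum_share]
    simp
  rw [h]
  simp

/-- The variance of the estimate given the levels is at most `2 F`, if the two parts of the
estimate have conditional variances of sum at most `F`. -/
theorem integral_runEstimate_sub_sq_le (F : RunSeed V → ℝ)
    (hF : F.FactorsThrough (signature P))
    (hF' : ∀ a b c c', F (a, b, c) = F (a, b, c'))
    (h : ∀ s : RunSeed V,
      (∫ y, (lightSum P G (heavySet P Tg G s) y
          - (lightTriangles G (heavySet P Tg G s)).card) ^ 2)
        + ∫ y, (heavySum P (scaleOf P Tg G s) G (heavySet P Tg G s) y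
          - ∑ v ∈ heavySet P Tg G s, ∑ t ∈ trianglesAt G v, share (heavySet P Tg G s) t) ^ 2
      ≤ F s) :
    ∫ s, (runEstimate P s Tg G - numTriangles G) ^ 2 ≤ ∫ s, 2 * F s := by
  have hfac : (fun s => (runEstimate P s Tg G - numTriangles G) ^ 2).FactorsThrough
      (signature P) := fun s s' hs => by
    have := runEstimate_factorsThrough P Tg G hs
    simp only at this
    simp only [this]
  refine integral_triple_mono (integrable_of_signature hfac)
    ((integrable_of_signature hF).const_mul 2) fun a b => ?_
  have hab := h (a, b, fun _ => 0, fun _ => 0, fun _ => 0)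
  set S := heavySet P Tg G (a, b, fun _ => 0, fun _ => 0, fun _ => 0) with hS
  set lv := scaleOf P Tg G (a, b, fun _ => 0, fun _ => 0, fun _ => 0) with hlv
  set m₁ : ℝ := ((lightTriangles G S).card : ℝ)
  set m₂ : ℝ := ∑ v ∈ S, ∑ t ∈ trianglesAt G v, share S t
  have i1 : Integrable fun y => (lightSum P G S y - m₁) ^ 2 := by
    have : MemLp (lightSum P G S) 2 := memLp_finsetSum _ fun t _ =>
      (memLp_const _).indicator (measurableSet_lightEvent t)
    exact (this.sub (memLp_const m₁)).integrable_sq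
  have i2 : Integrable fun y => (heavySum P lv G S y - m₂) ^ 2 := by
    have : MemLp (heavySum P lv G S) 2 := memLp_finsetSum _ fun v _ => memLp_finsetSum _
      fun t _ => (memLp_const _).indicator (measurableSet_heavyEvent lv v t)
    exact (this.sub (memLp_const m₂)).integrable_sq
  have h1 : ∀ c, (runEstimate P (a, b, c) Tg G - numTriangles G) ^ 2
      ≤ 2 * ((lightSum P G S c - m₁) ^ 2 + (heavySum P lv G S c - m₂) ^ 2) := by
    intro c
    have e : runEstimate P (a, b, c) Tg G = lightSum P G S c + heavySum P lv G S c := by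
      rw [runEstimate, lightEstimate_eq_lightSum, heavyEstimate_eq_heavySum]
      rfl
    rw [e, ← card_lightTriangles_add_sum_share G S]
    nlinarith [sq_nonneg ((lightSum P G S c - m₁) - (heavySum P lv G S c - m₂))]
  have hFc : ∫ c, 2 * F (a, b, c)
      = 2 * F (a, b, fun _ => 0, fun _ => 0, fun _ => 0) := by
    rw [integral_congr_ae (Filter.Eventually.of_forall fun c =>
      congrArg (2 * ·) (hF' a b c (fun _ => 0, fun _ => 0, fun _ => 0)))]
    simp
  rw [hFc]
  calc _ ≤ ∫ c, 2 * ((lightSum P G S c - m₁) ^ 2 + (heavySum P lv G S c - m₂) ^ 2) :=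
        integral_mono_of_nonneg (Filter.Eventually.of_forall fun c => sq_nonneg _)
          ((i1.add i2).const_mul 2) (Filter.Eventually.of_forall h1)
    _ = 2 * ((∫ c, (lightSum P G S c - m₁) ^ 2) + ∫ c, (heavySum P lv G S c - m₂) ^ 2) := by
        rw [integral_const_mul, integral_add i1 i2]
    _ ≤ _ := by linarith

end Run

/-! ### The classifying tests -/

section Classification

variable {V : Type u} [DecidableEq V] [Fintype V] {P : Params} (G : SimpleGraph V) {h : ℕ}

variable (P) in
/-- The number of triangles at `v` whose star at `v` is sampled. -/
noncomputable def starCount (h : ℕ) (v : V)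
    (z : (V → unitInterval) × (Sym2 V → unitInterval)) : ℝ :=
  ∑ t ∈ trianglesAt G v, (starEvent P h v t).indicator (fun _ => 1) z

theorem measurable_starCount (v : V) : Measurable (starCount P G h v) :=
  Finset.measurable_sum _ fun t _ => measurable_const.indicator (measurableSet_starEvent v t)

theorem volume_real_starEvent_of_mem (hP : P.weight P.top = √P.k) (hh : h ≤ P.top) {v : V}
    {t : Finset V} (ht : t ∈ trianglesAt G v) :
    volume.real (starEvent P h v t) = (P.weight h / P.k) ^ 2 := by
  obtain ⟨ht, hvt⟩ := mem_trianglesAt.1 ht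
  rw [volume_real_starEvent hP hh, Finset.card_erase_of_mem hvt, card_of_mem_triangles ht]

theorem integral_starCount (hP : P.weight P.top = √P.k) (hh : h ≤ P.top) (v : V) :
    ∫ z, starCount P G h v z = (trianglesAt G v).card * (P.weight h / P.k) ^ 2 := by
  unfold starCount
  rw [integral_sum_indicator _ _ _ _ fun t _ => measurableSet_starEvent v t,
    Finset.sum_congr rfl fun t ht => by rw [volume_real_starEvent_of_mem G hP hh ht]]
  simp

theorem integral_starCount_sub_sq_le (hP : P.weight P.top = √P.k) (hh : h ≤ P.top) (v : V) :
    ∫ z, (starCount P G h v z - (trianglesAt G v).card * (P.weight h / P.k) ^ 2) ^ 2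
      ≤ (trianglesAt G v).card * (P.weight h / P.k) ^ 2
        + 2 * maxEdgeTriangles G * (trianglesAt G v).card * (P.weight h / P.k) ^ 3 := by
  have key := integral_sq_sum_indicator_sub volume (trianglesAt G v) (fun _ => 1)
    (starEvent P h v) fun t _ => measurableSet_starEvent v t
  have hp : 0 < P.weight h / P.k :=
    div_pos (Params.weight_pos h) (zero_lt_one.trans_le P.one_le_k)
  set p := P.weight h / P.k with hpdef
  have h1 : ∀ t ∈ trianglesAt G v, (1 : ℝ) * volume.real (starEvent P h v t) = p ^ 2 :=
    fun t ht => by rw [one_mul, volume_real_starEvent_of_mem G hP hh ht]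
  rw [Finset.sum_congr rfl h1, Finset.sum_const, nsmul_eq_mul] at key
  unfold starCount
  rw [key]
  have hcov : ∀ t ∈ trianglesAt G v, ∀ t' ∈ trianglesAt G v,
      (1 : ℝ) * 1 * volume.real (starEvent P h v t ∩ starEvent P h v t')
        - 1 * volume.real (starEvent P h v t) * (1 * volume.real (starEvent P h v t'))
      ≤ (if t = t' then p ^ 2 else 0) + p ^ 3 * (if (t ∩ t').card = 2 then 1 else 0) := by
    intro t ht t' ht'
    rw [h1 t ht, h1 t' ht', starEvent_inter, volume_real_starEvent hP hh, ← hpdef]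
    obtain ⟨ht, hvt⟩ := mem_trianglesAt.1 ht
    obtain ⟨ht', hvt'⟩ := mem_trianglesAt.1 ht'
    rw [Finset.card_erase_of_mem (Finset.mem_union_left _ hvt)]
    have ht := card_of_mem_triangles ht
    have ht' := card_of_mem_triangles ht'
    have hcard := Finset.card_union_add_card_inter t t'
    have hle : (t ∩ t').card ≤ 3 := ht ▸ Finset.card_le_card Finset.inter_subset_left
    have hpos : 0 < (t ∩ t').card := Finset.card_pos.2 ⟨v, Finset.mem_inter.2 ⟨hvt, hvt'⟩⟩
    have p1 : (0 : ℝ) ≤ if t = t' then p ^ 2 else 0 := by split_ifs <;> positivity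
    have p2 : (0 : ℝ) ≤ p ^ 3 * if (t ∩ t').card = 2 then 1 else 0 := by
      split_ifs <;> positivity
    have p3 : 0 < p ^ 2 * p ^ 2 := by positivity
    obtain hj | hj | hj : (t ∩ t').card = 1 ∨ (t ∩ t').card = 2 ∨ (t ∩ t').card = 3 := by omega
    · rw [show (t ∪ t').card - 1 = 4 by omega]
      nlinarith
    · rw [show (t ∪ t').card - 1 = 3 by omega, if_pos hj]
      linarith
    · have h2 : t ∩ t' = t := Finset.eq_of_subset_of_card_le Finset.inter_subset_left (by omega)
      have h3 : t ∩ t' = t' := Finset.eq_of_subset_of_card_le Finset.inter_subset_right (by omega)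
      rw [show (t ∪ t').card - 1 = 2 by omega, if_pos (h2.symm.trans h3)]
      linarith
  refine (Finset.sum_le_sum fun t ht => Finset.sum_le_sum fun t' ht' => hcov t ht t' ht').trans ?_
  simp only [Finset.sum_add_distrib, ← Finset.mul_sum]
  refine add_le_add (le_of_eq ?_) ?_
  · rw [Finset.sum_congr rfl fun t ht =>
      (Finset.sum_ite_eq (trianglesAt G v) t fun _ => p ^ 2)]
    rw [Finset.sum_congr rfl fun t ht => if_pos ht, Finset.sum_const, nsmul_eq_mul]
  · rw [mul_comm]
    exact mul_le_mul_of_nonneg_right (sum_sum_card_inter_eq_two_le G v) (by positivity)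

/-- Markov's inequality: a test at a scale below `Tg / τ(v)` rarely succeeds. -/
theorem volume_real_le_starCount (hP : P.weight P.top = √P.k) (hh : h ≤ P.top) {Tg : ℝ}
    (hTg : 0 < Tg) (v : V) :
    volume.real {z | P.weight h * Tg / P.k ^ 2 ≤ starCount P G h v z}
      ≤ (trianglesAt G v).card * P.weight h / Tg := by
  have hW := Params.weight_pos (P := P) h
  have hk : 0 < P.k := zero_lt_one.trans_le P.one_le_k
  have hm := mul_meas_ge_le_integral_of_nonneg (μ := volume) (f := starCount P G h v)
    (Filter.Eventually.of_forall fun z => Finset.sum_nonneg fun t _ =>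
      Set.indicator_nonneg (fun _ _ => zero_le_one) z)
    (integrable_finsetSum _ fun t _ =>
      integrable_indicator_one _ (measurableSet_starEvent v t) _) (P.weight h * Tg / P.k ^ 2)
  rw [integral_starCount G hP hh] at hm
  have hthr : 0 < P.weight h * Tg / P.k ^ 2 := by positivity
  rw [← le_div_iff₀' hthr] at hm
  refine hm.trans (le_of_eq ?_)
  field_simp

/-- Chebyshev's inequality: a test at a scale above `Tg / τ(v)` rarely fails. -/
theorem volume_real_starCount_lt (hP : P.weight P.top = √P.k) (hh : h ≤ P.top) {Tg : ℝ}
    (hTg : 0 < Tg) (hk2 : P.k ^ 2 ≤ P.ω * Tg) (hE : P.k * maxEdgeTriangles G ≤ Tg) (v : V)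
    (hv : 0 < (trianglesAt G v).card) :
    volume.real {z | starCount P G h v z < P.weight h * Tg / P.k ^ 2}
      ≤ 12 * Tg / (trianglesAt G v).card / P.weight h := by
  have hτ : (0 : ℝ) < (trianglesAt G v).card := by exact_mod_cast hv
  have hW := Params.weight_pos (P := P) h
  have hWω : P.ω ≤ P.weight h := by
    simpa [Params.weight] using Params.weight_mono (P := P) (Nat.zero_le h)
  have hk : 0 < P.k := zero_lt_one.trans_le P.one_le_k
  have hvar := integral_starCount_sub_sq_le G hP hh v
  set τ : ℝ := ((trianglesAt G v).card : ℝ) with hτdef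
  set W := P.weight h
  set m := τ * (W / P.k) ^ 2 with hm
  have hm0 : 0 < m := by positivity
  by_cases hbig : m < 2 * (W * Tg / P.k ^ 2)
  · -- The bound exceeds one.
    refine measureReal_le_one.trans ?_
    have : m = τ * W ^ 2 / P.k ^ 2 := by rw [hm]; ring
    rw [this, ← mul_div_assoc, div_lt_div_iff_of_pos_right (by positivity)] at hbig
    have h2 : τ * W < 2 * Tg := by
      have : W * (τ * W) < W * (2 * Tg) := by linarith
      exact lt_of_mul_lt_mul_left this hW.le
    rw [div_div, le_div_iff₀ (by positivity)]
    linarith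
  push Not at hbig
  have hi : Integrable fun z => (starCount P G h v z - m) ^ 2 := by
    have : MemLp (starCount P G h v) 2 := memLp_finsetSum _ fun t _ =>
      (memLp_const _).indicator (measurableSet_starEvent v t)
    exact (this.sub (memLp_const m)).integrable_sq
  have hc := mul_meas_ge_le_integral_of_nonneg (μ := volume)
    (f := fun z => (starCount P G h v z - m) ^ 2)
    (Filter.Eventually.of_forall fun z => sq_nonneg _) hi ((m / 2) ^ 2)
  have hmono : volume.real {z | starCount P G h v z < W * Tg / P.k ^ 2}
      ≤ volume.real {z | (m / 2) ^ 2 ≤ (starCount P G h v z - m) ^ 2} := by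
    refine measureReal_mono fun z hz => ?_
    have hz' : starCount P G h v z < W * Tg / P.k ^ 2 := hz
    change (m / 2) ^ 2 ≤ (starCount P G h v z - m) ^ 2
    nlinarith
  refine hmono.trans ?_
  rw [← le_div_iff₀' (by positivity)] at hc
  refine hc.trans ((div_le_div_of_nonneg_right hvar (by positivity)).trans ?_)
  have e : (m + 2 * maxEdgeTriangles G * τ * (W / P.k) ^ 3) / (m / 2) ^ 2
      = (4 * (P.k ^ 2 / W) + 8 * (P.k * maxEdgeTriangles G)) / (τ * W) := by
    rw [hm]; field_simp; ring
  have h4 : P.k ^ 2 / W ≤ Tg := by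
    rw [div_le_iff₀ hW]
    nlinarith
  rw [e, div_div]
  exact div_le_div_of_nonneg_right (by linarith) (by positivity)

/-- The part of a seed that is used by copy `i` of the classifying tests. -/
def testSeed (s : RunSeed V) (i : Fin 2) : (V → unitInterval) × (Sym2 V → unitInterval) :=
  (fun v => s.1 (i, v), fun e => s.2.1 (i, e))

omit [DecidableEq V] in
/-- The seeds of the two copies of the tests are independent. -/
theorem measurePreserving_testSeed :
    MeasurePreserving (testSeed : RunSeed V → Fin 2 → _) volume volume := by
  have h1 : MeasurePreserving (fun s : RunSeed V => (s.1, s.2.1)) volume volume :=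
    (MeasurePreserving.id volume).prod measurePreserving_fst
  have h2 : MeasurePreserving (Prod.map
      (fun (f : Fin 2 × V → unitInterval) (a : Fin 2) (b : V) => f (a, b))
      (fun (f : Fin 2 × Sym2 V → unitInterval) (a : Fin 2) (b : Sym2 V) => f (a, b)))
      volume volume := measurePreserving_curry.prod measurePreserving_curry
  have h3 := (volume_measurePreserving_arrowProdEquivProdArrow (V → unitInterval)
    (Sym2 V → unitInterval) (Fin 2)).symm
  exact h3.comp (h2.comp h1)

theorem X_eq_starCount (s : RunSeed V) (i : Fin 2) (v : V) :
    (X P s G i h v : ℝ) = starCount P G h v (testSeed s i) := by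
  classical
  unfold X starCount
  rw [Finset.card_filter, Nat.cast_sum]
  refine Finset.sum_congr rfl fun t _ => ?_
  rw [Set.indicator_apply, Nat.cast_ite, Nat.cast_one, Nat.cast_zero]
  exact if_congr Iff.rfl rfl rfl

theorem passes_iff {Tg : ℝ} {s : RunSeed V} {i : Fin 2} {v : V} :
    Passes P s Tg G i h v ↔ P.weight h * Tg / P.k ^ 2 ≤ starCount P G h v (testSeed s i) := by
  rw [Passes, X_eq_starCount, Params.weight, mul_right_comm]

theorem volume_real_passes_le (hP : P.weight P.top = √P.k) (hh : h ≤ P.top) {Tg : ℝ}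
    (hTg : 0 < Tg) (i : Fin 2) (v : V) :
    volume.real {s : RunSeed V | Passes P s Tg G i h v}
      ≤ (trianglesAt G v).card * P.weight h / Tg := by
  refine le_trans (le_of_eq ?_) (volume_real_le_starCount G hP hh hTg v)
  have e := (measurePreserving_eval (fun _ : Fin 2 =>
    (volume : Measure ((V → unitInterval) × (Sym2 V → unitInterval)))) i).comp
      measurePreserving_testSeed
  rw [← e.measureReal_preimage (measurableSet_le measurable_const
    (measurable_starCount G v)).nullMeasurableSet]
  congr 1
  ext s
  exact passes_iff G

/-- The two copies of a test are independent, so the probability that both fail is the square of the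
Chebyshev bound. This square makes the sum over the scales converge. -/
theorem volume_real_fails_le (hP : P.weight P.top = √P.k) (hh : h ≤ P.top) {Tg : ℝ}
    (hTg : 0 < Tg) (hk2 : P.k ^ 2 ≤ P.ω * Tg) (hE : P.k * maxEdgeTriangles G ≤ Tg) (v : V)
    (hv : 0 < (trianglesAt G v).card) :
    volume.real {s : RunSeed V | ∀ i, ¬ Passes P s Tg G i h v}
      ≤ (12 * Tg / (trianglesAt G v).card / P.weight h) ^ 2 := by
  set A : Set ((V → unitInterval) × (Sym2 V → unitInterval)) :=
    {z | starCount P G h v z < P.weight h * Tg / P.k ^ 2} with hA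
  have hAm : MeasurableSet A := measurableSet_lt (measurable_starCount G v) measurable_const
  have e1 : {s : RunSeed V | ∀ i, ¬ Passes P s Tg G i h v}
      = testSeed ⁻¹' {f | ∀ i ∈ (Finset.univ : Finset (Fin 2)), f i ∈ A} := by
    ext s
    simp only [Set.mem_ofPred_eq, Set.mem_preimage, Finset.mem_univ, true_implies, hA,
      passes_iff, not_le]
  rw [e1, measurePreserving_testSeed.measureReal_preimage
    (measurableSet_forall_mem _ fun _ => hAm).nullMeasurableSet, volume_real_forall_mem,
    Finset.prod_const, Finset.card_univ, Fintype.card_fin]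
  exact pow_le_pow_left₀ measureReal_nonneg
    (volume_real_starCount_lt G hP hh hTg hk2 hE v hv) 2

theorem sum_range_weight (P : Params) (n : ℕ) :
    ∑ h ∈ Finset.range n, P.weight h = P.weight n - P.ω := by
  induction n with
  | zero => simp [Params.weight]
  | succ n ih => rw [Finset.sum_range_succ, ih, Params.weight, Params.weight, pow_succ]; ring

/-- A vertex is heavy only if some test succeeds, and the Markov bounds of the tests form a
geometric series that is dominated by the last scale. -/
theorem volume_real_heavy_le (hP : P.weight P.top = √P.k) {Tg : ℝ} (hTg : 0 < Tg) (v : V) :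
    volume.real {s : RunSeed V | level P s Tg G v ≠ ⊤}
      ≤ 4 * (trianglesAt G v).card * √P.k / Tg := by
  have hsub : {s : RunSeed V | level P s Tg G v ≠ ⊤} ⊆
      ⋃ h ∈ Finset.range (P.top + 1), ⋃ i ∈ (Finset.univ : Finset (Fin 2)),
        {s | Passes P s Tg G i h v} := by
    intro s hs
    have hs' : level P s Tg G v ≠ ⊤ := hs
    rw [Ne, level_eq_top_iff] at hs'
    push Not at hs'
    obtain ⟨h, hh, i, hi⟩ := hs'
    simp only [Set.mem_iUnion, Finset.mem_range]
    exact ⟨h, by omega, i, Finset.mem_univ i, hi⟩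
  calc _ ≤ ∑ h ∈ Finset.range (P.top + 1), ∑ i : Fin 2,
        volume.real {s : RunSeed V | Passes P s Tg G i h v} :=
        (measureReal_mono hsub (measure_ne_top _ _)).trans
          ((measureReal_biUnion_finset_le _ _).trans
            (Finset.sum_le_sum fun h _ => measureReal_biUnion_finset_le _ _))
    _ ≤ ∑ h ∈ Finset.range (P.top + 1), ∑ i : Fin 2,
        ((trianglesAt G v).card * P.weight h / Tg) :=
        Finset.sum_le_sum fun h hh => Finset.sum_le_sum fun i _ => volume_real_passes_le G hP
          (Nat.lt_succ_iff.1 (Finset.mem_range.1 hh)) hTg i v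
    _ = 2 * (trianglesAt G v).card / Tg * ∑ h ∈ Finset.range (P.top + 1), P.weight h := by
        rw [Finset.mul_sum]
        refine Finset.sum_congr rfl fun h _ => ?_
        rw [Finset.sum_const, Finset.card_univ, Fintype.card_fin]
        ring
    _ ≤ 2 * (trianglesAt G v).card / Tg * (2 * √P.k) := by
        refine mul_le_mul_of_nonneg_left ?_ (by positivity)
        rw [sum_range_weight, ← hP, Params.weight, Params.weight, pow_succ]
        linarith [P.ω_pos]
    _ = _ := by ring

/-- A dyadic sum of terms `min x (Q² / x)` is dominated by its terms with `x` close to `Q`. The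
function `6 Q x / (x + Q)` is an upper bound for the partial sums. -/
theorem sum_le_of_le_weight {b : ℕ → ℝ} {Q : ℝ} (hQ : 0 < Q) (n : ℕ)
    (h1 : ∀ h < n, b h ≤ P.weight h) (h2 : ∀ h < n, b h ≤ Q ^ 2 / P.weight h) :
    ∑ h ∈ Finset.range n, b h ≤ 6 * Q := by
  have key : ∀ m ≤ n, ∑ h ∈ Finset.range m, b h ≤ 6 * Q * P.weight m / (P.weight m + Q) := by
    intro m
    induction m with
    | zero =>
      intro _
      have := Params.weight_pos (P := P) 0
      simp only [Finset.range_zero, Finset.sum_empty]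
      positivity
    | succ m ih =>
      intro hm
      have hx := Params.weight_pos (P := P) m
      have e1 := h1 m hm
      have e2 := h2 m hm
      have hs : P.weight (m + 1) = 2 * P.weight m := by
        rw [Params.weight, Params.weight, pow_succ]; ring
      rw [Finset.sum_range_succ, hs]
      set x := P.weight m
      have hb : b m ≤ 6 * Q ^ 2 * x / ((2 * x + Q) * (x + Q)) := by
        rcases le_total x Q with hxQ | hxQ
        · refine e1.trans ((le_div_iff₀ (by positivity)).2 ?_)
          have : (2 * x + Q) * (x + Q) ≤ 6 * Q ^ 2 := by nlinarith
          nlinarith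
        · refine e2.trans ((div_le_div_iff₀ hx (by positivity)).2 ?_)
          have : (2 * x + Q) * (x + Q) ≤ 6 * x ^ 2 := by nlinarith
          nlinarith [sq_nonneg Q]
      have e3 : 6 * Q * (2 * x) / (2 * x + Q)
          = 6 * Q * x / (x + Q) + 6 * Q ^ 2 * x / ((2 * x + Q) * (x + Q)) := by
        field_simp
        ring
      rw [e3]
      exact add_le_add (ih (by omega)) hb
  refine (key n le_rfl).trans ?_
  have := Params.weight_pos (P := P) n
  rw [div_le_iff₀ (by positivity)]
  nlinarith

end Classification

/-! ### The variance of a run -/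

section Variance

/-- The parameters suit the guess `Tg` and the bounds `DV`, `DE`: the weights end exactly at `√k`,
so that the estimate is unbiased, and either everything is sampled or `k` and `ω` are such that
every contribution to the variance is of order `max T Tg ^ 2`. -/
structure Params.Suitable (P : Params) (Tg : ℝ) (DV DE : ℕ) : Prop where
  weight_top : P.weight P.top = √P.k
  one_le_ω : 1 ≤ P.ω
  cases : P.k = 1 ∨ (P.k ^ 2 ≤ P.ω * Tg ∧ √P.k ^ 3 ≤ Tg ∧ P.k * DE ≤ Tg ∧
    P.ω * DV ≤ 4 * DV + 2 * Tg)

variable {V : Type u} [DecidableEq V] [Fintype V] {P : Params} {Tg : ℝ} (G : SimpleGraph V)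

variable (P Tg) in
/-- The scale `h` fails to recognize `v` as heavy. -/
def failSet (h : ℕ) (v : V) : Set (RunSeed V) := {s | ∀ i, ¬ Passes P s Tg G i h v}

variable (P Tg) in
/-- The vertex `v` is light. -/
def lightSet (v : V) : Set (RunSeed V) := {s | level P s Tg G v = ⊤}

theorem failSet_factorsThrough {h : ℕ} (hh : h ≤ P.top) (v : V) :
    (fun s => s ∈ failSet P Tg G h v).FactorsThrough (signature P) := by
  intro s s' hs
  simp only [failSet, Set.mem_ofPred_eq]
  exact propext (forall_congr' fun i => not_congr
    (iff_of_eq (passes_factorsThrough P Tg G hh v hs)))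

theorem lightSet_factorsThrough (v : V) :
    (fun s => s ∈ lightSet P Tg G v).FactorsThrough (signature P) := by
  intro s s' hs
  have := level_factorsThrough P Tg G v hs
  simp only at this
  simp only [lightSet, Set.mem_ofPred_eq, this]

omit [DecidableEq V] in
theorem measurableSet_of_factorsThrough {A : Set (RunSeed V)}
    (hA : (fun s => s ∈ A).FactorsThrough (signature P)) : MeasurableSet A :=
  measurableSet_setOfPred.2 (measurable_of_signature hA)

/-- A failed scale costs at most the contribution of the next weight to the variance. -/
theorem sum_weight_mul_sq_le (s : RunSeed V) :
    ∑ v ∈ heavySet P Tg G s, P.weight (scaleOf P Tg G s v) * ((trianglesAt G v).card : ℝ) ^ 2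
      ≤ ∑ v, P.ω * ((trianglesAt G v).card : ℝ) ^ 2
        + ∑ v, ∑ h ∈ Finset.range P.top, (failSet P Tg G h v).indicator
          (fun _ => P.weight h * ((trianglesAt G v).card : ℝ) ^ 2) s := by
  rw [← Finset.sum_add_distrib]
  have hn : ∀ h v, 0 ≤ (failSet P Tg G h v).indicator
      (fun _ => P.weight h * ((trianglesAt G v).card : ℝ) ^ 2) s := fun h v =>
    Set.indicator_nonneg (fun _ _ => mul_nonneg (Params.weight_pos h).le (sq_nonneg _)) s
  have hω := P.ω_pos
  refine le_trans (Finset.sum_le_sum fun v hv => ?_)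
    (Finset.sum_le_sum_of_subset_of_nonneg (Finset.subset_univ (heavySet P Tg G s))
      fun v _ _ => add_nonneg (by positivity) (Finset.sum_nonneg fun h _ => hn h v))
  obtain ⟨h1, -, h3⟩ := level_eq_coe_iff.1 (level_eq_scaleOf hv)
  have e : P.weight (scaleOf P Tg G s v)
      = P.ω + ∑ h ∈ Finset.range (scaleOf P Tg G s v), P.weight h := by
    rw [sum_range_weight]; ring
  rw [e, add_mul, Finset.sum_mul]
  refine add_le_add le_rfl ?_
  refine le_trans (Finset.sum_le_sum fun h hh => ?_) (Finset.sum_le_sum_of_subset_of_nonneg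
    (Finset.range_subset_range.2 h1) fun h _ _ => hn h v)
  have hs : s ∈ failSet P Tg G h v := fun i => h3 h (Finset.mem_range.1 hh) i
  rw [Set.indicator_of_mem hs]

/-- The error of a run when `k` may be large. The conditional variance depends on the levels through
the light vertices, the failed scales and the number of heavy vertices, whose expectations the
classifying tests control. -/
theorem integral_runEstimate_sub_sq_le_of_large {DV DE : ℕ} (hTg : 1 ≤ Tg)
    (hP : P.weight P.top = √P.k) (hω : 1 ≤ P.ω) (hk2 : P.k ^ 2 ≤ P.ω * Tg)
    (hk3 : √P.k ^ 3 ≤ Tg) (hkE : P.k * DE ≤ Tg) (hωV : P.ω * DV ≤ 4 * DV + 2 * Tg)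
    (hDV : maxVertexTriangles G ≤ DV) (hDE : maxEdgeTriangles G ≤ DE) :
    ∫ s, (runEstimate P s Tg G - numTriangles G) ^ 2
      ≤ 1000 * max (numTriangles G : ℝ) Tg ^ 2 := by
  have hTg0 : 0 < Tg := zero_lt_one.trans_le hTg
  have hr := P.sqrt_pos
  have hk0 : 0 < P.k := zero_lt_one.trans_le P.one_le_k
  have hE : P.k * maxEdgeTriangles G ≤ Tg :=
    (mul_le_mul_of_nonneg_left (by exact_mod_cast hDE) hk0.le).trans hkE
  set T : ℝ := (numTriangles G : ℝ) with hT
  set ΔE : ℝ := (maxEdgeTriangles G : ℝ) with hΔ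
  set τ : V → ℝ := fun v => ((trianglesAt G v).card : ℝ) with hτ
  have hT0 : 0 ≤ T := Nat.cast_nonneg _
  have hΔ0 : 0 ≤ ΔE := Nat.cast_nonneg _
  have hτ0 : ∀ v, 0 ≤ τ v := fun v => Nat.cast_nonneg _
  have hτT : ∀ v, τ v ≤ T := fun v => Nat.cast_le.2 (card_trianglesAt_le G v)
  have hτV : ∀ v, τ v ≤ DV := fun v => Nat.cast_le.2 ((card_trianglesAt_le_max G v).trans hDV)
  have hτsum : ∑ v, τ v = 3 * T := by
    rw [hτ, ← Nat.cast_sum, sum_card_trianglesAt]; push_cast; rfl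
  set c₀ : ℝ := √P.k ^ 3 * T + P.k * (3 * ΔE * T) + 3 * T * Tg + 9 * (P.k * (3 * ΔE * T))
    + ∑ v, P.ω * τ v ^ 2 with hc₀
  set F : RunSeed V → ℝ := fun s => c₀
    + ((∑ v, (lightSet P Tg G v).indicator (fun _ => √P.k * τ v ^ 2) s)
    + ((∑ v, ∑ h ∈ Finset.range P.top,
        (failSet P Tg G h v).indicator (fun _ => P.weight h * τ v ^ 2) s)
    + ∑ v, (lightSet P Tg G v)ᶜ.indicator (fun _ => √P.k * (6 * ΔE * T)) s)) with hF
  have mL : ∀ v, MeasurableSet (lightSet P Tg G v) := fun v =>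
    measurableSet_of_factorsThrough (lightSet_factorsThrough G v)
  have mF : ∀ v, ∀ h ∈ Finset.range P.top, MeasurableSet (failSet P Tg G h v) := fun v h hh =>
    measurableSet_of_factorsThrough (failSet_factorsThrough G (Finset.mem_range.1 hh).le v)
  have hmain := integral_runEstimate_sub_sq_le P Tg G F ?_ (fun a b c c' => rfl) ?_
  rotate_left
  · intro s s' hs
    have h1 : ∀ v, s ∈ lightSet P Tg G v ↔ s' ∈ lightSet P Tg G v := fun v =>
      iff_of_eq (lightSet_factorsThrough G v hs)
    have h2 : ∀ v, ∀ h ∈ Finset.range P.top,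
        (s ∈ failSet P Tg G h v ↔ s' ∈ failSet P Tg G h v) := fun v h hh =>
      iff_of_eq (failSet_factorsThrough G (Finset.mem_range.1 hh).le v hs)
    classical
    simp only [hF, Set.indicator_apply, Set.mem_compl_iff, h1]
    congr 3
    exact Finset.sum_congr rfl fun v _ => Finset.sum_congr rfl fun h hh => by simp only [h2 v h hh]
  · intro s
    have hS1 : ∑ v ∈ (heavySet P Tg G s)ᶜ, τ v ^ 2
        = ∑ v, (lightSet P Tg G v).indicator (fun _ => τ v ^ 2) s := by
      classical
      rw [heavySet, Finset.compl_filter, Finset.sum_filter]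
      refine Finset.sum_congr rfl fun v _ => ?_
      rw [Set.indicator_apply]
      exact if_congr not_not rfl rfl
    have hS2 : ((heavySet P Tg G s).card : ℝ)
        = ∑ v, (lightSet P Tg G v)ᶜ.indicator (fun _ => (1 : ℝ)) s := by
      classical
      rw [heavySet, Finset.card_filter, Nat.cast_sum]
      refine Finset.sum_congr rfl fun v _ => ?_
      rw [Set.indicator_apply, Nat.cast_ite, Nat.cast_one, Nat.cast_zero]
      exact if_congr Iff.rfl rfl rfl
    have e1 : ∑ v, (lightSet P Tg G v).indicator (fun _ => √P.k * τ v ^ 2) s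
        = √P.k * ∑ v ∈ (heavySet P Tg G s)ᶜ, τ v ^ 2 := by
      rw [hS1, Finset.mul_sum]
      refine Finset.sum_congr rfl fun v _ => ?_
      by_cases h : s ∈ lightSet P Tg G v <;> simp [h]
    have e2 : ∑ v, (lightSet P Tg G v)ᶜ.indicator (fun _ => √P.k * (6 * ΔE * T)) s
        = √P.k * ((heavySet P Tg G s).card * (6 * ΔE * T)) := by
      rw [hS2, Finset.sum_mul, Finset.mul_sum]
      refine Finset.sum_congr rfl fun v _ => ?_
      by_cases h : s ∈ lightSet P Tg G v <;> simp [h]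
    have b1 := integral_lightSum_sub_sq_le (P := P) G (heavySet P Tg G s)
    have b2 := integral_heavySum_sub_sq_le G (heavySet P Tg G s) (lv := scaleOf P Tg G s) hP
      (fun v hv => scaleOf_le hv) hk2 hω
    have b3 := sum_weight_mul_sq_le (P := P) (Tg := Tg) G s
    simp only [hF]
    rw [e1, e2]
    linarith
  have hint : ∫ s, F s = c₀ + ((∑ v, √P.k * τ v ^ 2 * volume.real (lightSet P Tg G v))
      + ((∑ v, ∑ h ∈ Finset.range P.top,
          P.weight h * τ v ^ 2 * volume.real (failSet P Tg G h v))
      + ∑ v, √P.k * (6 * ΔE * T) * volume.real (lightSet P Tg G v)ᶜ)) := by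
    have i1 : Integrable fun s : RunSeed V => ∑ v,
        (lightSet P Tg G v).indicator (fun _ => √P.k * τ v ^ 2) s :=
      integrable_finsetSum _ fun v _ => integrable_indicator_one _ (mL v) _
    have i2 : ∀ v, Integrable fun s : RunSeed V => ∑ h ∈ Finset.range P.top,
        (failSet P Tg G h v).indicator (fun _ => P.weight h * τ v ^ 2) s := fun v =>
      integrable_finsetSum _ fun h hh => integrable_indicator_one _ (mF v h hh) _
    have i2' : Integrable fun s : RunSeed V => ∑ v, ∑ h ∈ Finset.range P.top,
        (failSet P Tg G h v).indicator (fun _ => P.weight h * τ v ^ 2) s :=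
      integrable_finsetSum _ fun v _ => i2 v
    have i3 : Integrable fun s : RunSeed V => ∑ v,
        (lightSet P Tg G v)ᶜ.indicator (fun _ => √P.k * (6 * ΔE * T)) s :=
      integrable_finsetSum _ fun v _ => integrable_indicator_one _ (mL v).compl _
    have i23 : Integrable fun s : RunSeed V => (∑ v, ∑ h ∈ Finset.range P.top,
        (failSet P Tg G h v).indicator (fun _ => P.weight h * τ v ^ 2) s)
        + ∑ v, (lightSet P Tg G v)ᶜ.indicator (fun _ => √P.k * (6 * ΔE * T)) s := i2'.add i3
    have i123 : Integrable fun s : RunSeed V =>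
        (∑ v, (lightSet P Tg G v).indicator (fun _ => √P.k * τ v ^ 2) s)
        + ((∑ v, ∑ h ∈ Finset.range P.top,
          (failSet P Tg G h v).indicator (fun _ => P.weight h * τ v ^ 2) s)
        + ∑ v, (lightSet P Tg G v)ᶜ.indicator (fun _ => √P.k * (6 * ΔE * T)) s) := i1.add i23
    simp only [hF]
    rw [integral_add (integrable_const _) i123, integral_add i1 i23,
      integral_add i2' i3, integral_sum_indicator _ _ _ _ fun v _ => mL v,
      integral_sum_indicator _ _ _ _ fun v _ => (mL v).compl,
      integral_finsetSum _ fun v _ => i2 v]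
    congr 1
    · simp
    · congr 2
      exact Finset.sum_congr rfl fun v _ => integral_sum_indicator _ _ _ _ fun h hh => mF v h hh
  rw [integral_const_mul, hint] at hmain
  -- With `k1`, `k2`, `k3` for the part `c₀` that does not depend on the levels.
  have k1 : √P.k ^ 3 * T ≤ Tg * T := mul_le_mul_of_nonneg_right hk3 hT0
  have k2 : P.k * (3 * ΔE * T) ≤ 3 * (Tg * T) := by nlinarith
  have k3 : ∑ v, P.ω * τ v ^ 2 ≤ 12 * T ^ 2 + 6 * (Tg * T) := by
    have : ∀ v, P.ω * τ v ^ 2 ≤ (4 * T + 2 * Tg) * τ v := by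
      intro v
      have h1 : P.ω * τ v ≤ 4 * τ v + 2 * Tg := by
        rcases le_total P.ω 4 with h4 | h4
        · nlinarith [hτ0 v]
        · nlinarith [hτ0 v, hτV v]
      nlinarith [hτ0 v, hτT v]
    refine (Finset.sum_le_sum fun v _ => this v).trans (le_of_eq ?_)
    rw [← Finset.mul_sum, hτsum]
    ring
  have k4 : ∑ v, √P.k * τ v ^ 2 * volume.real (lightSet P Tg G v) ≤ 36 * (Tg * T) := by
    have : ∀ v, √P.k * τ v ^ 2 * volume.real (lightSet P Tg G v) ≤ 12 * Tg * τ v := by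
      intro v
      rcases Nat.eq_zero_or_pos (trianglesAt G v).card with h0 | hpos
      · simp [hτ, h0]
      have hτp : 0 < τ v := by simpa [hτ] using hpos
      have hf := volume_real_fails_le G hP le_rfl hTg0 hk2 hE v hpos
      have hsub : volume.real (lightSet P Tg G v)
          ≤ volume.real {s : RunSeed V | ∀ i, ¬ Passes P s Tg G i P.top v} :=
        measureReal_mono fun s hs => level_eq_top_iff.1 hs P.top le_rfl
      have h1 : volume.real (lightSet P Tg G v) ≤ 1 := measureReal_le_one
      rw [hP] at hf
      have hz : 0 < 12 * Tg / τ v / √P.k := by positivity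
      have hle : volume.real (lightSet P Tg G v) ≤ 12 * Tg / τ v / √P.k := by
        rcases le_total 1 (12 * Tg / τ v / √P.k) with hz1 | hz1
        · exact h1.trans hz1
        · exact (hsub.trans hf).trans (pow_le_of_le_one hz.le hz1 two_ne_zero)
      calc _ ≤ √P.k * τ v ^ 2 * (12 * Tg / τ v / √P.k) := by gcongr
        _ = 12 * Tg * τ v := by field_simp
    refine (Finset.sum_le_sum fun v _ => this v).trans (le_of_eq ?_)
    rw [← Finset.mul_sum, hτsum]
    ring
  have k5 : ∑ v, ∑ h ∈ Finset.range P.top,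
      P.weight h * τ v ^ 2 * volume.real (failSet P Tg G h v) ≤ 216 * (Tg * T) := by
    have : ∀ v, ∑ h ∈ Finset.range P.top,
        P.weight h * τ v ^ 2 * volume.real (failSet P Tg G h v) ≤ 72 * Tg * τ v := by
      intro v
      rcases Nat.eq_zero_or_pos (trianglesAt G v).card with h0 | hpos
      · simp [hτ, h0]
      have hτp : 0 < τ v := by simpa [hτ] using hpos
      have hQ : 0 < 12 * Tg / τ v := by positivity
      have hs := sum_le_of_le_weight (P := P)
        (b := fun h => P.weight h * volume.real (failSet P Tg G h v)) hQ P.top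
        (fun h _ => mul_le_of_le_one_right (Params.weight_pos h).le measureReal_le_one)
        (fun h hh => by
          have hw := Params.weight_pos (P := P) h
          have hf := volume_real_fails_le G hP hh.le hTg0 hk2 hE v hpos
          calc _ ≤ P.weight h * (12 * Tg / τ v / P.weight h) ^ 2 :=
                mul_le_mul_of_nonneg_left hf hw.le
            _ = _ := by field_simp)
      calc _ = τ v ^ 2 * ∑ h ∈ Finset.range P.top,
            P.weight h * volume.real (failSet P Tg G h v) := by
            rw [Finset.mul_sum]
            exact Finset.sum_congr rfl fun h _ => by ring
        _ ≤ τ v ^ 2 * (6 * (12 * Tg / τ v)) := mul_le_mul_of_nonneg_left hs (sq_nonneg _)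
        _ = 72 * Tg * τ v := by field_simp; norm_num
    refine (Finset.sum_le_sum fun v _ => this v).trans (le_of_eq ?_)
    rw [← Finset.mul_sum, hτsum]
    ring
  have k6 : ∑ v, √P.k * (6 * ΔE * T) * volume.real (lightSet P Tg G v)ᶜ ≤ 72 * T ^ 2 := by
    calc _ ≤ ∑ v, √P.k * (6 * ΔE * T) * (4 * τ v * √P.k / Tg) :=
          Finset.sum_le_sum fun v _ =>
            mul_le_mul_of_nonneg_left (volume_real_heavy_le G hP hTg0 v) (by positivity)
      _ = √P.k * (6 * ΔE * T) * (4 * √P.k / Tg) * ∑ v, τ v := by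
          rw [Finset.mul_sum]
          exact Finset.sum_congr rfl fun v _ => by ring
      _ = 72 * T ^ 2 * (P.k * ΔE / Tg) := by
          rw [hτsum]; conv_rhs => rw [P.k_eq]
          ring
      _ ≤ 72 * T ^ 2 * 1 := by
          refine mul_le_mul_of_nonneg_left ?_ (by positivity)
          rwa [div_le_one hTg0]
      _ = _ := mul_one _
  have hM1 : T ≤ max T Tg := le_max_left _ _
  have hM2 : Tg ≤ max T Tg := le_max_right _ _
  have hTT : T ^ 2 ≤ max T Tg ^ 2 := pow_le_pow_left₀ hT0 hM1 2
  have hTgT : Tg * T ≤ max T Tg ^ 2 := by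
    rw [sq]; exact mul_le_mul hM2 hM1 hT0 (hT0.trans hM1)
  have hM0 : 0 ≤ max T Tg ^ 2 := sq_nonneg _
  linarith

/-- The mean square error of a run is of order `max T Tg ^ 2`. -/
theorem integral_runEstimate_sub_sq_le_max {DV DE : ℕ} (hTg : 1 ≤ Tg)
    (hP : P.Suitable Tg DV DE) (hDV : maxVertexTriangles G ≤ DV)
    (hDE : maxEdgeTriangles G ≤ DE) :
    ∫ s, (runEstimate P s Tg G - numTriangles G) ^ 2
      ≤ 1000 * max (numTriangles G : ℝ) Tg ^ 2 := by
  rcases hP.cases with hk | ⟨h1, h2, h3, h4⟩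
  · have := integral_runEstimate_sub_sq_le P Tg G (fun _ => 0) (fun _ _ _ => rfl)
      (fun _ _ _ _ => rfl) fun s => by
        have b1 := integral_lightSum_sub_sq_of_k_eq_one (P := P) G (heavySet P Tg G s) hk
        have b2 := integral_heavySum_sub_sq_of_k_eq_one G (heavySet P Tg G s)
          (lv := scaleOf P Tg G s) hP.weight_top (fun v hv => scaleOf_le hv) hk hP.one_le_ω
        linarith
    simp only [mul_zero, integral_zero] at this
    exact this.trans (by positivity)
  · exact integral_runEstimate_sub_sq_le_of_large G hTg hP.weight_top hP.one_le_ω h1 h2 h3 h4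
      hDV hDE

end Variance

/-! ### The median of block means -/

section Median

/-- If fewer than half of the values are at distance `η` or more from `m`, then so is the median. -/
theorem abs_median_sub_le {n : ℕ} {f : Fin n → ℝ} {m η : ℝ}
    (h : 2 * (Finset.univ.filter fun i => η ≤ |f i - m|).card < n) : |median f - m| ≤ η := by
  set A : Set ℝ := {x : ℝ | n ≤ 2 * (Finset.univ.filter (fun i => f i ≤ x)).card} with hA
  have hcompl : (Finset.univ.filter fun i => η ≤ |f i - m|).card
      + (Finset.univ.filter fun i => ¬ η ≤ |f i - m|).card = n := by
    rw [Finset.card_filter_add_card_filter_not, Finset.card_univ, Fintype.card_fin]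
  have hup : m + η ∈ A := by
    have hsub : (Finset.univ.filter fun i => ¬ η ≤ |f i - m|) ⊆
        Finset.univ.filter fun i => f i ≤ m + η := by
      intro i hi
      simp only [Finset.mem_filter, Finset.mem_univ, true_and, not_le] at hi ⊢
      linarith [(abs_lt.1 hi).2]
    have := Finset.card_le_card hsub
    change n ≤ 2 * (Finset.univ.filter (fun i => f i ≤ m + η)).card
    omega
  have hlow : ∀ x ∈ A, m - η ≤ x := by
    intro x hx
    by_contra! hlt
    have hsub : (Finset.univ.filter fun i => f i ≤ x) ⊆
        Finset.univ.filter fun i => η ≤ |f i - m| := by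
      intro i hi
      simp only [Finset.mem_filter, Finset.mem_univ, true_and] at hi ⊢
      rw [le_abs]
      exact Or.inr (by linarith)
    have := Finset.card_le_card hsub
    have hx' : n ≤ 2 * (Finset.univ.filter (fun i => f i ≤ x)).card := hx
    omega
  have h1 : median f ≤ m + η := csInf_le ⟨m - η, hlow⟩ hup
  have h2 : m - η ≤ median f := le_csInf ⟨_, hup⟩ hlow
  exact abs_le.2 ⟨by linarith, by linarith⟩

/-- Chebyshev's inequality for a block of independent runs. -/
theorem volume_real_block_le {Ω : Type*} [MeasureSpace Ω]
    [IsProbabilityMeasure (volume : Measure Ω)]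
    {f : Ω → ℝ} (hf : MemLp f 2) {m C : ℝ} (hm : ∫ x, f x = m) (hC : ∫ x, (f x - m) ^ 2 ≤ C)
    {B : ℕ} (hB : 0 < B) {η : ℝ} (hη : 0 < η) :
    volume.real {τ : Fin B → Ω | η ≤ |(∑ b, f (τ b)) / B - m|} ≤ C / (B * η ^ 2) := by
  have hB' : (0 : ℝ) < B := by exact_mod_cast hB
  set g : (Fin B → Ω) → ℝ := ∑ b, fun τ => f (τ b) with hg
  have hgi : ∀ b : Fin B, MemLp (fun τ : Fin B → Ω => f (τ b)) 2 := fun b =>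
    hf.comp_measurePreserving (measurePreserving_eval _ b)
  have hgL : MemLp g 2 := memLp_finsetSum' _ fun b _ => hgi b
  have hmean : ∫ τ, g τ = B * m := by
    simp only [hg, Finset.sum_apply]
    rw [integral_finsetSum _ fun b _ => (hgi b).integrable one_le_two]
    have : ∀ b : Fin B, ∫ τ : Fin B → Ω, f (τ b) = m := by
      intro b
      rw [← hm]
      have e := measurePreserving_eval (fun _ : Fin B => (volume : Measure Ω)) b
      have := integral_map e.measurable.aemeasurable (f := f)
        (by rw [e.map_eq]; exact hf.aestronglyMeasurable)
      rw [e.map_eq] at this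
      exact this.symm
    rw [Finset.sum_congr rfl fun b _ => this b]
    simp
  have hvar : ProbabilityTheory.variance g volume ≤ B * C := by
    have := ProbabilityTheory.variance_sum_pi (μ := fun _ : Fin B => (volume : Measure Ω))
      (X := fun _ => f) fun _ => hf
    rw [hg, volume_pi, this, Finset.sum_const, Finset.card_univ, Fintype.card_fin, nsmul_eq_mul]
    refine mul_le_mul_of_nonneg_left ?_ hB'.le
    rw [ProbabilityTheory.variance_eq_integral hf.aestronglyMeasurable.aemeasurable, hm]
    exact hC
  have hch := ProbabilityTheory.meas_ge_le_variance_div_sq hgL (c := B * η) (by positivity)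
  have hset : {τ : Fin B → Ω | η ≤ |(∑ b, f (τ b)) / B - m|}
      = {τ | B * η ≤ |g τ - ∫ τ, g τ|} := by
    ext τ
    simp only [Set.mem_ofPred_eq, hmean]
    have : g τ - B * m = B * ((∑ b, f (τ b)) / B - m) := by
      rw [hg, Finset.sum_apply]; field_simp
    rw [this, abs_mul, abs_of_pos hB']
    exact (mul_le_mul_iff_right₀ hB').symm
  rw [hset]
  refine (ENNReal.toReal_le_of_le_ofReal ?_ hch).trans ?_
  · exact div_nonneg (ProbabilityTheory.variance_nonneg _ _) (sq_nonneg _)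
  · calc _ ≤ B * C / (B * η) ^ 2 := div_le_div_of_nonneg_right hvar (sq_nonneg _)
      _ = _ := by field_simp

/-- If each of `n` independent blocks is bad with probability at most `1 / 16`, then each of the at
most `2 ^ n` sets of at least `n / 2` blocks is bad with probability at most `(1 / 4) ^ n`. -/
theorem exists_volume_real_half_le {Ω : Type*} [MeasureSpace Ω]
    [IsProbabilityMeasure (volume : Measure Ω)] {A : Set Ω} (hA : MeasurableSet A)
    (hp : volume.real A ≤ 1 / 16) (n : ℕ) [DecidablePred (· ∈ A)] :
    ∃ U : Set (Fin n → Ω), MeasurableSet U ∧ volume.real U ≤ (1 / 2) ^ n ∧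
      ∀ σ, n ≤ 2 * (Finset.univ.filter fun a => σ a ∈ A).card → σ ∈ U := by
  set F : Finset (Finset (Fin n)) := Finset.univ.filter fun S => n ≤ 2 * S.card with hF
  refine ⟨⋃ S ∈ F, {σ | ∀ a ∈ S, σ a ∈ A},
    Finset.measurableSet_biUnion _ fun S _ => measurableSet_forall_mem S fun _ => hA, ?_, ?_⟩
  · refine (measureReal_biUnion_finset_le _ _).trans ?_
    have h1 : ∀ S ∈ F, volume.real {σ : Fin n → Ω | ∀ a ∈ S, σ a ∈ A} ≤ (1 / 4) ^ n := by
      intro S hS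
      rw [volume_real_forall_mem, Finset.prod_const]
      calc _ ≤ (1 / 16 : ℝ) ^ S.card := pow_le_pow_left₀ measureReal_nonneg hp _
        _ = (1 / 4) ^ (2 * S.card) := by rw [pow_mul]; norm_num
        _ ≤ (1 / 4) ^ n := pow_le_pow_of_le_one (by norm_num) (by norm_num)
          (Finset.mem_filter.1 hS).2
    refine (Finset.sum_le_card_nsmul _ _ _ h1).trans ?_
    have h2 : (F.card : ℝ) ≤ 2 ^ n := by
      have := Finset.card_filter_le (Finset.univ : Finset (Finset (Fin n)))
        fun S => n ≤ 2 * S.card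
      rw [Finset.card_univ, Fintype.card_finset, Fintype.card_fin] at this
      exact_mod_cast this
    rw [nsmul_eq_mul]
    calc _ ≤ (2 : ℝ) ^ n * (1 / 4) ^ n := mul_le_mul_of_nonneg_right h2 (by positivity)
      _ = (1 / 2) ^ n := by rw [← mul_pow]; norm_num
  · intro σ hσ
    simp only [Set.mem_iUnion]
    exact ⟨_, Finset.mem_filter.2 ⟨Finset.mem_univ _, hσ⟩, fun a ha => (Finset.mem_filter.1 ha).2⟩

end Median

section Correctness

variable {V : Type u} [Fintype V] [DecidableEq V] {P : Params} {ε δ Tg : ℝ} {DV DE : ℕ}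
  {G : SimpleGraph V} {stream : List (Sym2 V)}

/-- With probability at least `1 - δ` the final estimate has an error of at most
`ε / 8 * max T Tg`. -/
theorem exists_volume_le_final (hε : 0 < ε) (hTg : 1 ≤ Tg)
    (hP : P.Suitable Tg DV DE) (hB : 2 ^ 20 / ε ^ 2 ≤ P.blockSize)
    (hN : (1 / 2 : ℝ) ^ P.numBlocks ≤ δ) (hG : ∀ e, e ∈ stream ↔ e ∈ G.edgeSet)
    (hDV : maxVertexTriangles G ≤ DV) (hDE : maxEdgeTriangles G ≤ DE) :
    ∃ U : Set (Seed P V), volume U ≤ ENNReal.ofReal δ ∧ ∀ σ ∉ U,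
      |finalEstimate P Tg σ (onePass P σ stream) - numTriangles G|
        ≤ ε / 8 * max (numTriangles G : ℝ) Tg := by
  classical
  set M := max (numTriangles G : ℝ) Tg with hM
  have hM0 : 0 < M := lt_max_of_lt_right (by linarith)
  have hη : 0 < ε / 8 * M := by positivity
  have hB0 : (0 : ℝ) < P.blockSize := by exact_mod_cast P.blockSize_pos
  set A : Set (Fin P.blockSize → RunSeed V) :=
    {τ | ε / 8 * M ≤ |(∑ b, runEstimate P (τ b) Tg G) / P.blockSize - numTriangles G|} with hA
  have hfm : Measurable fun s : RunSeed V => runEstimate P s Tg G :=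
    measurable_of_signature (runEstimate_factorsThrough P Tg G)
  have hAm : MeasurableSet A := by
    refine measurableSet_le measurable_const ?_
    have : Measurable fun τ : Fin P.blockSize → RunSeed V =>
        (∑ b, runEstimate P (τ b) Tg G) / P.blockSize - numTriangles G :=
      ((Finset.measurable_sum _ fun b _ =>
        hfm.comp (measurable_pi_apply b)).div_const _).sub_const _
    exact continuous_abs.measurable.comp this
  -- The constant `2 ^ 20` exceeds `1000 * 8 ^ 2 * 16`.
  have hAp : volume.real A ≤ 1 / 16 := by
    refine (volume_real_block_le (memLp_of_signature (runEstimate_factorsThrough P Tg G) 2)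
      (integral_runEstimate P Tg G hP.weight_top)
      (integral_runEstimate_sub_sq_le_max G hTg hP hDV hDE) P.blockSize_pos hη).trans ?_
    rw [div_le_iff₀ (by positivity)] at hB
    rw [div_le_iff₀ (by positivity)]
    have : (P.blockSize : ℝ) * (ε / 8 * M) ^ 2 = P.blockSize * ε ^ 2 * M ^ 2 / 64 := by ring
    rw [this]
    nlinarith [mul_le_mul_of_nonneg_right hB (sq_nonneg M), sq_nonneg M]
  obtain ⟨U, hUm, hUp, hU⟩ := exists_volume_real_half_le hAm hAp P.numBlocks
  have hcurry : MeasurePreserving (fun (σ : Seed P V) a b => σ (a, b)) volume volume :=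
    measurePreserving_curry
  refine ⟨(fun (σ : Seed P V) a b => σ (a, b)) ⁻¹' U, ?_, fun σ hσ => ?_⟩
  · rw [hcurry.measure_preimage hUm.nullMeasurableSet, ← ofReal_measureReal]
    exact ENNReal.ofReal_le_ofReal (hUp.trans hN)
  · rw [finalEstimate_onePass P Tg σ hG]
    refine abs_median_sub_le ?_
    by_contra! hlt
    refine hσ (hU _ (hlt.trans (le_of_eq ?_)))
    congr!

theorem volume_not_isApprox_le (hε : 0 < ε) (hε1 : ε ≤ 1) (hTg : 1 ≤ Tg)
    (hP : P.Suitable Tg DV DE) (hB : 2 ^ 20 / ε ^ 2 ≤ P.blockSize)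
    (hN : (1 / 2 : ℝ) ^ P.numBlocks ≤ δ) (hG : ∀ e, e ∈ stream ↔ e ∈ G.edgeSet)
    (hDV : maxVertexTriangles G ≤ DV) (hDE : maxEdgeTriangles G ≤ DE)
    (hT : Tg ≤ numTriangles G) :
    volume {σ : Seed P V | ¬ IsApprox ε (numTriangles G) (output P Tg stream σ)}
      ≤ ENNReal.ofReal δ := by
  obtain ⟨U, hU, h⟩ := exists_volume_le_final hε hTg hP hB hN hG hDV hDE
  refine (measure_mono fun σ hσ => ?_).trans hU
  by_contra hσU
  refine hσ ?_
  have h1 := h σ hσU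
  rw [max_eq_left hT] at h1
  have hT0 : (0 : ℝ) ≤ numTriangles G := Nat.cast_nonneg _
  have h2 : ε * (numTriangles G : ℝ) ≤ numTriangles G := mul_le_of_le_one_left hT0 hε1
  have h3 : 0 ≤ ε * (numTriangles G : ℝ) := mul_nonneg hε.le hT0
  refine ⟨_, if_pos ?_, h1.trans (by linarith)⟩
  have := (abs_le.1 h1).1
  linarith

theorem volume_not_none_or_isApprox_le (hε : 0 < ε) (hε1 : ε ≤ 1) (hTg : 1 ≤ Tg)
    (hP : P.Suitable Tg DV DE) (hB : 2 ^ 20 / ε ^ 2 ≤ P.blockSize)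
    (hN : (1 / 2 : ℝ) ^ P.numBlocks ≤ δ) (hG : ∀ e, e ∈ stream ↔ e ∈ G.edgeSet)
    (hDV : maxVertexTriangles G ≤ DV) (hDE : maxEdgeTriangles G ≤ DE)
    (hT : numTriangles G < Tg) :
    volume {σ : Seed P V | ¬ (output P Tg stream σ = none ∨
      IsApprox ε (numTriangles G) (output P Tg stream σ))} ≤ ENNReal.ofReal δ := by
  obtain ⟨U, hU, h⟩ := exists_volume_le_final hε hTg hP hB hN hG hDV hDE
  refine (measure_mono fun σ hσ => ?_).trans hU
  by_contra hσU
  refine hσ ?_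
  have h1 := h σ hσU
  rw [max_eq_right hT.le] at h1
  have h3 : ε * Tg ≤ Tg := mul_le_of_le_one_left (by linarith) hε1
  by_cases hlt : 3 / 4 * Tg ≤ finalEstimate P Tg σ (onePass P σ stream)
  · refine Or.inr ⟨_, if_pos hlt, h1.trans ?_⟩
    -- An estimate that passes the threshold shows that `T` is at least `5 / 8 * Tg`.
    have h4 : 5 / 8 * Tg ≤ (numTriangles G : ℝ) := by
      have := (abs_le.1 h1).2
      linarith
    nlinarith
  · exact Or.inl (if_neg hlt)

end Correctness

/-! ### The expected number of kept edges -/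

section Space

variable {V : Type u} [Fintype V] {P : Params}

variable (P) in
/-- The event that the values of the hash functions at given points pass the tests of scale `h`. -/
def seedBox (h : ℕ) (S₁ : Finset (Fin 2 × V)) (S₂ : Finset (Fin 2 × Sym2 V)) (S₃ S₄ : Finset V)
    (S₅ : Finset (Sym2 V)) : Set (RunSeed V) :=
  {x | ∀ p ∈ S₁, x p ∈ {a | P.Picks a}} ×ˢ {x | ∀ p ∈ S₂, x p ∈ {a | P.Below h a}} ×ˢ
    {x | ∀ p ∈ S₃, x p ∈ {a | P.Picks a}} ×ˢ {x | ∀ p ∈ S₄, x p ∈ {a | P.Selects h a}} ×ˢ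
      {x | ∀ p ∈ S₅, x p ∈ {a | P.Below h a}}

variable [DecidableEq V]

theorem volume_real_seedBox (hP : P.weight P.top = √P.k) {h : ℕ} (hh : h ≤ P.top)
    (S₁ : Finset (Fin 2 × V)) (S₂ : Finset (Fin 2 × Sym2 V)) (S₃ S₄ : Finset V)
    (S₅ : Finset (Sym2 V)) :
    volume.real (seedBox P h S₁ S₂ S₃ S₄ S₅) = (1 / √P.k) ^ S₁.card *
      ((P.weight h / √P.k) ^ S₂.card * ((1 / √P.k) ^ S₃.card *
        ((1 / P.weight h) ^ S₄.card * (P.weight h / √P.k) ^ S₅.card))) := by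
  rw [seedBox, Measure.volume_eq_prod, measureReal_prod_prod, Measure.volume_eq_prod,
    measureReal_prod_prod, Measure.volume_eq_prod, measureReal_prod_prod, Measure.volume_eq_prod,
    measureReal_prod_prod]
  simp only [volume_real_forall_mem, Finset.prod_const, Params.volume_real_picks,
    Params.volume_real_below hP hh, Params.volume_real_selects hh]

/-- Each of the `5 + 3 * (top + 1)` ways to keep a pair has probability `1 / k`: the factors
`ω 2 ^ h` of a scale and of the edges sampled at that scale cancel. -/
theorem volume_real_keepsPair_le (hP : P.weight P.top = √P.k) {u v : V} (huv : u ≠ v) :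
    volume.real {s | KeepsPair P s u v} ≤ 8 * (P.top + 1) / P.k := by
  have hr := P.sqrt_pos
  have hsub : {s | KeepsPair P s u v} ⊆
      (⋃ i ∈ (Finset.univ : Finset (Fin 2)), seedBox P 0 {(i, u), (i, v)} ∅ ∅ ∅ ∅) ∪
      ((⋃ i ∈ (Finset.univ : Finset (Fin 2)), seedBox P 0 {(i, v)} ∅ {u} ∅ ∅) ∪
      (seedBox P 0 ∅ ∅ {u, v} ∅ ∅ ∪
      ((⋃ h ∈ Finset.range (P.top + 1), ⋃ i ∈ (Finset.univ : Finset (Fin 2)),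
        seedBox P h {(i, v)} {(i, s(u, v))} ∅ {u} ∅) ∪
      ⋃ h ∈ Finset.range (P.top + 1), seedBox P h ∅ ∅ {v} {u} {s(u, v)}))) := by
    rintro s (⟨i, h1, h2⟩ | ⟨i, h1, h2⟩ | ⟨h1, h2⟩ | ⟨i, h, h1, h2, h3⟩ | ⟨h, h1, h2, h3⟩)
    · refine Or.inl (Set.mem_biUnion (Finset.mem_univ i) ?_)
      simpa [seedBox] using ⟨h1, h2⟩
    · refine Or.inr (Or.inl (Set.mem_biUnion (Finset.mem_univ i) ?_))
      simpa [seedBox] using ⟨h2, h1⟩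
    · refine Or.inr (Or.inr (Or.inl ?_))
      simpa [seedBox] using ⟨h1, h2⟩
    · refine Or.inr (Or.inr (Or.inr (Or.inl (Set.mem_biUnion
        (Finset.mem_range.2 (Nat.lt_succ_of_le h1.1))
        (Set.mem_biUnion (Finset.mem_univ i) ?_)))))
      simpa [seedBox] using ⟨h3, h2, h1⟩
    · refine Or.inr (Or.inr (Or.inr (Or.inr (Set.mem_biUnion
        (Finset.mem_range.2 (Nat.lt_succ_of_le h1.1)) ?_))))
      simpa [seedBox] using ⟨h3, h1, h2⟩
  have hne : ∀ i : Fin 2, (i, u) ≠ (i, v) := fun i h => huv (congrArg Prod.snd h)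
  have b1 : ∀ i : Fin 2, volume.real (seedBox P 0 {(i, u), (i, v)} ∅ ∅ ∅ ∅) = 1 / P.k := by
    intro i
    rw [volume_real_seedBox hP (Nat.zero_le _), Finset.card_pair (hne i)]
    simp
    exact P.k_eq.symm
  have b2 : ∀ i : Fin 2, volume.real (seedBox P 0 {(i, v)} ∅ {u} ∅ ∅) = 1 / P.k := by
    intro i
    rw [volume_real_seedBox hP (Nat.zero_le _)]
    conv_rhs => rw [P.k_eq]
    simp only [Finset.card_singleton, Finset.card_empty]
    field_simp
  have b3 : volume.real (seedBox P 0 (∅ : Finset (Fin 2 × V)) ∅ {u, v} ∅ ∅) = 1 / P.k := by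
    rw [volume_real_seedBox hP (Nat.zero_le _), Finset.card_pair huv]
    simp
    exact P.k_eq.symm
  have b4 : ∀ h ∈ Finset.range (P.top + 1), ∀ i : Fin 2,
      volume.real (seedBox P h {(i, v)} {(i, s(u, v))} ∅ {u} ∅) = 1 / P.k := by
    intro h hh i
    have := Params.weight_pos (P := P) h
    rw [volume_real_seedBox hP (Nat.lt_succ_iff.1 (Finset.mem_range.1 hh))]
    conv_rhs => rw [P.k_eq]
    simp only [Finset.card_singleton, Finset.card_empty]
    field_simp
  have b5 : ∀ h ∈ Finset.range (P.top + 1),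
      volume.real (seedBox P h (∅ : Finset (Fin 2 × V)) ∅ {v} {u} {s(u, v)}) = 1 / P.k := by
    intro h hh
    have := Params.weight_pos (P := P) h
    rw [volume_real_seedBox hP (Nat.lt_succ_iff.1 (Finset.mem_range.1 hh))]
    conv_rhs => rw [P.k_eq]
    simp only [Finset.card_singleton, Finset.card_empty]
    field_simp
  have hk : 0 < 1 / P.k := one_div_pos.2 (zero_lt_one.trans_le P.one_le_k)
  refine (measureReal_mono hsub (measure_ne_top _ _)).trans ?_
  have u1 := measureReal_biUnion_finset_le (μ := volume) (Finset.univ : Finset (Fin 2))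
    fun i => seedBox P 0 {(i, u), (i, v)} ∅ ∅ ∅ ∅
  have u2 := measureReal_biUnion_finset_le (μ := volume) (Finset.univ : Finset (Fin 2))
    fun i => seedBox P 0 {(i, v)} ∅ {u} ∅ ∅
  have u4 := (measureReal_biUnion_finset_le (μ := volume) (Finset.range (P.top + 1))
    fun h => ⋃ i ∈ (Finset.univ : Finset (Fin 2)),
      seedBox P h {(i, v)} {(i, s(u, v))} ∅ {u} ∅).trans
    (Finset.sum_le_sum fun h _ => measureReal_biUnion_finset_le (μ := volume)
      (Finset.univ : Finset (Fin 2)) fun i => seedBox P h {(i, v)} {(i, s(u, v))} ∅ {u} ∅)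
  have u5 := measureReal_biUnion_finset_le (μ := volume) (Finset.range (P.top + 1))
    fun h => seedBox P h (∅ : Finset (Fin 2 × V)) ∅ {v} {u} {s(u, v)}
  rw [Finset.sum_congr rfl fun i _ => b1 i] at u1
  rw [Finset.sum_congr rfl fun i _ => b2 i] at u2
  rw [Finset.sum_congr rfl fun h hh => Finset.sum_congr rfl fun i _ => b4 h hh i] at u4
  rw [Finset.sum_congr rfl b5] at u5
  simp only [Finset.sum_const, Finset.card_univ, Fintype.card_fin, Finset.card_range,
    nsmul_eq_mul] at u1 u2 u4 u5
  push_cast at u1 u2 u4 u5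
  have e : 8 * ((P.top : ℝ) + 1) / P.k = 8 * (P.top + 1) * (1 / P.k) := by ring
  rw [e]
  refine (measureReal_union_le _ _).trans ((add_le_add u1 ((measureReal_union_le _ _).trans
    (add_le_add u2 ((measureReal_union_le _ _).trans (add_le_add b3.le
      ((measureReal_union_le _ _).trans (add_le_add u4 u5))))))).trans ?_)
  have ht : (0 : ℝ) ≤ P.top := Nat.cast_nonneg _
  nlinarith

/-- A run keeps a given edge with probability `O((top + 1) / k)`. -/
theorem volume_keepSet_le (hP : P.weight P.top = √P.k) {e : Sym2 V} (he : ¬ e.IsDiag) :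
    volume {s | e ∈ keepSet P s} ≤ ENNReal.ofReal (16 * (P.top + 1) / P.k) := by
  induction e using Sym2.ind with
  | _ a b =>
    have hab : a ≠ b := he
    have hsub : {s | s(a, b) ∈ keepSet P s}
        ⊆ {s | KeepsPair P s a b} ∪ {s | KeepsPair P s b a} := by
      rintro s ⟨u, v, huv, hk⟩
      rcases Sym2.eq_iff.1 huv with ⟨rfl, rfl⟩ | ⟨rfl, rfl⟩
      · exact Or.inl hk
      · exact Or.inr hk
    rw [← ofReal_measureReal]
    refine ENNReal.ofReal_le_ofReal ((measureReal_mono hsub (measure_ne_top _ _)).trans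
      ((measureReal_union_le _ _).trans ?_))
    refine (add_le_add (volume_real_keepsPair_le hP hab)
      (volume_real_keepsPair_le hP hab.symm)).trans (le_of_eq ?_)
    ring

theorem lintegral_card_onePass_le (hP : P.weight P.top = √P.k) {G : SimpleGraph V}
    {stream : List (Sym2 V)} (hG : ∀ e, e ∈ stream ↔ e ∈ G.edgeSet) :
    ∫⁻ σ : Seed P V, ((onePass P σ stream).card : ℝ≥0∞)
      ≤ ENNReal.ofReal (G.edgeSet.ncard * (P.numBlocks * P.blockSize
        * (16 * (P.top + 1) / P.k))) := by
  classical
  set K : Sym2 V → Set (RunSeed V) := fun e => toMeasurable volume {s | e ∈ keepSet P s} with hK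
  have hKm : ∀ e, MeasurableSet (K e) := fun e => measurableSet_toMeasurable _ _
  have hpt : ∀ σ : Seed P V, ((onePass P σ stream).card : ℝ≥0∞)
      ≤ ∑ e ∈ stream.toFinset, ∑ p, (K e).indicator (fun _ => 1) (σ p) := by
    intro σ
    have hsub : onePass P σ stream ⊆
        stream.toFinset.filter fun e => ∃ p, e ∈ keepSet P (σ p) := fun e he => by
      simpa using mem_onePass.1 he
    calc ((onePass P σ stream).card : ℝ≥0∞)
        ≤ ((stream.toFinset.filter fun e => ∃ p, e ∈ keepSet P (σ p)).card : ℝ≥0∞) := by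
          exact_mod_cast Finset.card_le_card hsub
      _ = ∑ e ∈ stream.toFinset, if ∃ p, e ∈ keepSet P (σ p) then 1 else 0 := by
          rw [Finset.card_filter]; push_cast; rfl
      _ ≤ _ := by
          refine Finset.sum_le_sum fun e _ => ?_
          split_ifs with h
          · obtain ⟨p, hp⟩ := h
            have hmem : σ p ∈ K e := subset_toMeasurable _ _ hp
            refine le_trans (le_of_eq ?_) (Finset.single_le_sum
              (f := fun p => (K e).indicator (fun _ => (1 : ℝ≥0∞)) (σ p))
              (fun _ _ => zero_le) (Finset.mem_univ p))
            simp [hmem]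
          · exact zero_le
  have hmeas : ∀ e p, Measurable fun σ : Seed P V =>
      (K e).indicator (fun _ => (1 : ℝ≥0∞)) (σ p) := fun e p =>
    (measurable_const.indicator (hKm e)).comp (measurable_pi_apply p)
  have hp0 : 0 ≤ 16 * ((P.top : ℝ) + 1) / P.k :=
    div_nonneg (by positivity) (zero_le_one.trans P.one_le_k)
  calc ∫⁻ σ : Seed P V, ((onePass P σ stream).card : ℝ≥0∞)
      ≤ ∫⁻ σ : Seed P V, ∑ e ∈ stream.toFinset, ∑ p,
        (K e).indicator (fun _ => 1) (σ p) := lintegral_mono hpt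
    _ = ∑ e ∈ stream.toFinset, ∑ p : Fin P.numBlocks × Fin P.blockSize,
        ∫⁻ σ : Seed P V, (K e).indicator (fun _ => 1) (σ p) := by
        rw [lintegral_finsetSum _ fun e _ => Finset.measurable_sum _ fun p _ => hmeas e p]
        exact Finset.sum_congr rfl fun e _ => lintegral_finsetSum _ fun p _ => hmeas e p
    _ ≤ ∑ e ∈ stream.toFinset, ∑ p : Fin P.numBlocks × Fin P.blockSize,
        ENNReal.ofReal (16 * (P.top + 1) / P.k) := by
        refine Finset.sum_le_sum fun e he => Finset.sum_le_sum fun p _ => ?_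
        have e1 := (measurePreserving_eval
          (fun _ : Fin P.numBlocks × Fin P.blockSize => (volume : Measure (RunSeed V))) p)
        have e2 : ∫⁻ σ : Seed P V, (K e).indicator (fun _ => (1 : ℝ≥0∞)) (σ p)
            = ∫⁻ s, (K e).indicator (fun _ => 1) s :=
          e1.lintegral_comp (measurable_const.indicator (hKm e))
        rw [e2, lintegral_indicator_const (hKm e), one_mul, hK, measure_toMeasurable]
        refine volume_keepSet_le hP ?_
        exact G.not_isDiag_of_mem_edgeSet ((hG e).1 (List.mem_toFinset.1 he))
    _ = _ := by
        have hc : stream.toFinset.card = G.edgeSet.ncard := by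
          rw [← Set.ncard_coe_finset]
          congr 1
          ext e
          simp [hG]
        rw [Finset.sum_const, Finset.sum_const, Finset.card_univ, Fintype.card_prod,
          Fintype.card_fin, Fintype.card_fin, hc, ENNReal.ofReal_mul (by positivity),
          ENNReal.ofReal_mul (by positivity), ENNReal.ofReal_natCast,
          ENNReal.ofReal_mul (by positivity), ENNReal.ofReal_natCast, ENNReal.ofReal_natCast]
        simp [mul_assoc]

end Space

/-! ### The choice of the parameters -/

section Choice

/-- Halving `√k` as long as it stays at least `ω₀` gives an `ω` for which the scales end exactly at
`√k`, and which is at least `ω₀` unless there is only one scale. -/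
theorem exists_topScale {k ω₀ : ℝ} (hk : 1 ≤ k) (hω₀ : 2 ≤ ω₀) :
    ∃ ω : ℝ, 1 ≤ ω ∧ ω ≤ √k ∧ ω * 2 ^ topScale k ω = √k ∧ ω ≤ 2 * ω₀ ∧
      ∑ h ∈ Finset.range (topScale k ω + 1), 1 / (ω * 2 ^ h) ≤ 1 ∧
      (topScale k ω = 0 ∨ (ω₀ ≤ ω ∧ ω₀ * 2 ^ topScale k ω ≤ √k)) := by
  have hr : 1 ≤ √k := Real.one_le_sqrt.2 hk
  have hr0 : 0 < √k := zero_lt_one.trans_le hr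
  have hω0 : 0 < ω₀ := by linarith
  set L := ⌊Real.logb 2 (√k / ω₀)⌋₊ with hL
  have hp : (0 : ℝ) < 2 ^ L := by positivity
  have htop : topScale k (√k / 2 ^ L) = L := by
    rw [topScale, div_div_cancel₀ hr0.ne', Real.logb_pow, Real.logb_self_eq_one one_lt_two,
      mul_one, Nat.ceil_natCast]
  have hcase : L = 0 ∨ (ω₀ ≤ √k / 2 ^ L ∧ ω₀ * 2 ^ L ≤ √k) := by
    rcases Nat.eq_zero_or_pos L with h | h
    · exact Or.inl h
    · have h1 : (L : ℝ) ≤ Real.logb 2 (√k / ω₀) := by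
        refine Nat.floor_le (le_of_lt ?_)
        by_contra! h0
        exact h.ne' (Nat.floor_of_nonpos h0)
      rw [Real.le_logb_iff_rpow_le one_lt_two (by positivity), Real.rpow_natCast,
        le_div_iff₀ hω0] at h1
      right
      rw [le_div_iff₀ hp]
      constructor <;> linarith
  refine ⟨√k / 2 ^ L, ?_, div_le_self hr0.le (one_le_pow₀ one_le_two), ?_, ?_, ?_, ?_⟩
  · rcases hcase with h | h
    · simpa [h] using hr
    · linarith [h.1]
  · rw [htop, div_mul_cancel₀ _ hp.ne']
  · have h1 := (Nat.lt_floor_add_one (Real.logb 2 (√k / ω₀))).le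
    rw [← hL, Real.logb_le_iff_le_rpow one_lt_two (by positivity), div_le_iff₀ hω0] at h1
    rw [div_le_iff₀ hp]
    have e : (2 : ℝ) ^ ((L : ℝ) + 1) = 2 ^ L * 2 := by
      rw [Real.rpow_add_one two_ne_zero, Real.rpow_natCast]
    rw [e] at h1
    linarith
  · rw [htop]
    rcases hcase with h | h
    · simp only [h, zero_add, Finset.range_one, Finset.sum_singleton, pow_zero, div_one, mul_one]
      exact (div_le_one hr0).2 hr
    · have hω : 2 ≤ √k / 2 ^ L := hω₀.trans h.1
      have hg : ∀ n : ℕ, ∑ h ∈ Finset.range n, (1 : ℝ) / 2 ^ h ≤ 2 := by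
        intro n
        simpa [one_div, inv_pow] using sum_geometric_two_le n
      calc ∑ h ∈ Finset.range (L + 1), 1 / (√k / 2 ^ L * 2 ^ h)
          = (1 / (√k / 2 ^ L)) * ∑ h ∈ Finset.range (L + 1), (1 : ℝ) / 2 ^ h := by
            rw [Finset.mul_sum]
            exact Finset.sum_congr rfl fun h _ => by rw [one_div_mul_one_div]
        _ ≤ (1 / 2) * 2 :=
            mul_le_mul (one_div_le_one_div_of_le two_pos hω) (hg _)
              (Finset.sum_nonneg fun _ _ => by positivity) (by norm_num)
        _ = 1 := by norm_num
  · rw [htop]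
    exact hcase

/-- The space bound for `c = Tg ^ (1 / 3)`, `k = max 1 (Tg / max c D)` and `n + 1` scales. It has no
constant term for `Tg` close to one because `1 / c ^ 2 = exp (-2 / 3 * log Tg)` is large there. -/
theorem succ_div_le {Tg c D k : ℝ} {n : ℕ} (hTg : 1 ≤ Tg) (hc : 1 ≤ c) (hc3 : c ^ 3 = Tg)
    (hD : 0 ≤ D) (hk : k = max 1 (Tg / max c D))
    (hn : n = 0 ∨ (max 2 (k ^ 2 / Tg) * 2 ^ n ≤ √k)) :
    (n + 1) / k ≤ 2 * (1 / c ^ 2 + D * Real.log Tg / Tg) := by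
  have hTg0 : 0 < Tg := by linarith
  have hc0 : 0 < c := by linarith
  have hℓ : 0 ≤ Real.log Tg := Real.log_nonneg hTg
  have hk1 : 1 ≤ k := hk ▸ le_max_left _ _
  have hk0 : 0 < k := by linarith
  rcases le_or_gt D c with hDc | hDc
  · -- `k ^ 2 / Tg = √k` in this case, so there is only one scale.
    have hkc : k = c ^ 2 := by
      rw [hk, max_eq_left hDc, ← hc3, pow_succ, mul_div_cancel_right₀ _ hc0.ne']
      exact max_eq_right (one_le_pow₀ hc)
    have hn0 : n = 0 := by
      rcases hn with h | h
      · exact h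
      · by_contra hne
        have h2 : (2 : ℝ) ≤ 2 ^ n := by
          simpa using pow_le_pow_right₀ (one_le_two (α := ℝ)) (Nat.one_le_iff_ne_zero.2 hne)
        have h3 : k ^ 2 / Tg = c := by
          rw [hkc, ← hc3]
          field_simp
        rw [h3, hkc, Real.sqrt_sq hc0.le] at h
        have h4 : c * 2 ≤ max 2 c * 2 ^ n :=
          mul_le_mul (le_max_right _ _) h2 two_pos.le (by positivity)
        linarith
    have : 0 ≤ D * Real.log Tg / Tg := by positivity
    have : 0 ≤ 1 / c ^ 2 := by positivity
    rw [hn0, hkc, Nat.cast_zero, zero_add]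
    linarith
  · have hD0 : 0 < D := by linarith
    rw [max_eq_right hDc.le] at hk
    have hkD : 1 / k ≤ D / Tg := by
      rw [div_le_div_iff₀ hk0 hTg0, one_mul, mul_comm, ← div_le_iff₀ hD0]
      exact hk ▸ le_max_right _ _
    have hkT : k ≤ Tg := hk ▸ max_le hTg (div_le_self hTg0.le (by linarith))
    have hnℓ : (n : ℝ) ≤ Real.log Tg := by
      rcases hn with h | h
      · simpa [h] using hℓ
      · have h1 : (2 : ℝ) ^ n ≤ √k := by
          refine le_trans ?_ h
          exact le_mul_of_one_le_left (by positivity) (one_le_two.trans (le_max_left _ _))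
        have h2 : ((2 : ℝ) ^ n) ^ 2 ≤ Tg := by
          rw [← Real.sq_sqrt hk0.le] at hkT
          exact (pow_le_pow_left₀ (by positivity) h1 2).trans hkT
        have h3 := Real.log_le_log (by positivity) h2
        rw [Real.log_pow, Real.log_pow] at h3
        push_cast at h3
        nlinarith [Real.log_two_gt_d9, (Nat.cast_nonneg n : (0 : ℝ) ≤ n)]
    have hcexp : 1 - 2 / 3 * Real.log Tg ≤ 1 / c ^ 2 := by
      have h1 : Real.log (c ^ 2) = 2 / 3 * Real.log Tg := by
        rw [← hc3, Real.log_pow, Real.log_pow]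
        push_cast
        ring
      have h3 := Real.add_one_le_exp (-Real.log (c ^ 2))
      rw [Real.exp_neg, Real.exp_log (by positivity), h1, ← one_div] at h3
      linarith
    have hkey : 1 / k ≤ 1 / c ^ 2 + D * Real.log Tg / Tg := by
      have e : D * Real.log Tg / Tg = D / Tg * Real.log Tg := by ring
      have hx : 0 < D / Tg := by positivity
      have hy : 0 < 1 / c ^ 2 := by positivity
      rw [e]
      rcases le_or_gt 1 (D / Tg) with h | h
      · have : 1 / k ≤ 1 := (div_le_one hk0).2 hk1
        nlinarith
      · refine hkD.trans ?_
        nlinarith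
    have e : ((n : ℝ) + 1) / k = n * (1 / k) + 1 / k := by ring
    have h1 : n * (1 / k) ≤ Real.log Tg * (D / Tg) := mul_le_mul hnℓ hkD (by positivity) hℓ
    have e' : Real.log Tg * (D / Tg) = D * Real.log Tg / Tg := by ring
    have : 0 ≤ 1 / c ^ 2 := by positivity
    rw [e]
    linarith

/-- The parameters are determined by `k = max 1 (Tg / B)` with `B` the maximum of `Tg ^ (1 / 3)`,
`DE` and `√DV`, which up to constants is the largest `k` that the variance permits, and by `ω`
close to `max 2 (k ^ 2 / Tg)`, the least weight that it permits. -/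
theorem exists_params {ε δ Tg : ℝ} (hε : 0 < ε) (hε1 : ε ≤ 1) (hδ : 0 < δ) (hδ1 : δ ≤ 1 / 2)
    (hTg : 1 ≤ Tg) (DV DE : ℕ) :
    ∃ P : Params, P.Suitable Tg DV DE ∧ 2 ^ 20 / ε ^ 2 ≤ P.blockSize ∧
      P.blockSize ≤ 2 ^ 21 / ε ^ 2 ∧ (1 / 2 : ℝ) ^ P.numBlocks ≤ δ ∧
      P.numBlocks ≤ 4 * Real.log (1 / δ) ∧
      (P.top + 1) / P.k ≤ 2 * (1 / Tg ^ (2 / 3 : ℝ) + √(DV : ℝ) * Real.log Tg / Tg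
        + DE * Real.log Tg / Tg) := by
  have hTg0 : 0 < Tg := by linarith
  set c : ℝ := Tg ^ (1 / 3 : ℝ) with hcdef
  have hc : 1 ≤ c := Real.one_le_rpow hTg (by norm_num)
  have hc0 : 0 < c := by linarith
  have hc3 : c ^ 3 = Tg := by
    rw [hcdef, ← Real.rpow_natCast, ← Real.rpow_mul hTg0.le]
    norm_num
  have hc2 : c ^ 2 = Tg ^ (2 / 3 : ℝ) := by
    rw [hcdef, ← Real.rpow_natCast, ← Real.rpow_mul hTg0.le]
    norm_num
  set D : ℝ := max (DE : ℝ) √(DV : ℝ) with hDdef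
  have hD : 0 ≤ D := le_max_of_le_left (Nat.cast_nonneg _)
  set B := max c D with hB
  have hB1 : 1 ≤ B := hc.trans (le_max_left _ _)
  have hB0 : 0 < B := by linarith
  set k := max 1 (Tg / B) with hk
  have hk1 : 1 ≤ k := le_max_left _ _
  have hk0 : 0 < k := by linarith
  obtain ⟨ω, hω1, hωk, hωtop, hω2, hsum, hcase⟩ :=
    exists_topScale hk1 (le_max_left 2 (k ^ 2 / Tg))
  have hlog : 1 ≤ Real.logb 2 (1 / δ) := by
    rw [Real.le_logb_iff_rpow_le one_lt_two (by positivity), Real.rpow_one, le_div_iff₀ hδ]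
    linarith
  have hb : 0 < 2 ^ 20 / ε ^ 2 := by positivity
  let P : Params :=
    { k := k
      ω := ω
      blockSize := ⌈2 ^ 20 / ε ^ 2⌉₊
      numBlocks := ⌈Real.logb 2 (1 / δ)⌉₊
      one_le_k := hk1
      ω_pos := by linarith
      ω_le := hωk
      blockSize_pos := Nat.ceil_pos.2 hb
      numBlocks_pos := Nat.ceil_pos.2 (by linarith)
      scale_prob_le := hsum }
  refine ⟨P, ⟨hωtop, hω1, ?_⟩, Nat.le_ceil _, ?_, ?_, ?_, ?_⟩
  · change k = 1 ∨ k ^ 2 ≤ ω * Tg ∧ √k ^ 3 ≤ Tg ∧ k * DE ≤ Tg ∧ ω * DV ≤ 4 * DV + 2 * Tg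
    rcases max_choice 1 (Tg / B) with h | h
    · exact Or.inl h
    right
    have hkB : k * B = Tg := by
      rw [hk, h, div_mul_cancel₀ _ hB0.ne']
    have hr : √k ^ 3 ≤ Tg := by
      have h1 : k ≤ c ^ 2 := by
        rw [hk, h, div_le_iff₀ hB0, ← hc3, pow_succ c 2]
        exact mul_le_mul_of_nonneg_left (le_max_left _ _) (by positivity)
      rw [← hc3]
      refine pow_le_pow_left₀ (Real.sqrt_nonneg _) ?_ 3
      rw [← Real.sqrt_sq hc0.le]
      exact Real.sqrt_le_sqrt h1
    refine ⟨?_, hr, ?_, ?_⟩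
    · rcases hcase with h0 | h0
      · rw [h0, pow_zero, mul_one] at hωtop
        have e : k ^ 2 = √k * √k ^ 3 := by
          nth_rewrite 1 [← Real.sq_sqrt hk0.le]
          ring
        rw [e, hωtop]
        exact mul_le_mul_of_nonneg_left hr (Real.sqrt_nonneg _)
      · rw [← div_le_iff₀ hTg0]
        exact (le_max_right _ _).trans h0.1
    · rw [← hkB]
      exact mul_le_mul_of_nonneg_left ((le_max_left _ _).trans (le_max_right _ _)) hk0.le
    · have h1 : k ^ 2 / Tg * DV ≤ Tg := by
        rw [div_mul_eq_mul_div, div_le_iff₀ hTg0]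
        calc k ^ 2 * DV = k ^ 2 * √(DV : ℝ) ^ 2 := by rw [Real.sq_sqrt (Nat.cast_nonneg _)]
          _ ≤ k ^ 2 * B ^ 2 := by
              gcongr
              exact (le_max_right _ _).trans (le_max_right _ _)
          _ = Tg * Tg := by rw [← hkB]; ring
      have h2 : max 2 (k ^ 2 / Tg) ≤ 2 + k ^ 2 / Tg :=
        max_le (by linarith [show 0 ≤ k ^ 2 / Tg by positivity]) (by linarith)
      calc ω * DV ≤ 2 * (2 + k ^ 2 / Tg) * DV := by gcongr; linarith
        _ = 4 * DV + 2 * (k ^ 2 / Tg * DV) := by ring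
        _ ≤ 4 * DV + 2 * Tg := by linarith
  · have h1 := (Nat.ceil_lt_add_one hb.le).le
    have h2 : 1 ≤ 2 ^ 20 / ε ^ 2 := by
      rw [le_div_iff₀ (by positivity)]
      nlinarith
    have e : (2 : ℝ) ^ 21 / ε ^ 2 = 2 ^ 20 / ε ^ 2 + 2 ^ 20 / ε ^ 2 := by ring
    rw [e]
    exact h1.trans (by linarith)
  · have h1 := Nat.le_ceil (Real.logb 2 (1 / δ))
    rw [Real.logb_le_iff_le_rpow one_lt_two (by positivity), Real.rpow_natCast] at h1
    change (1 / 2 : ℝ) ^ ⌈Real.logb 2 (1 / δ)⌉₊ ≤ δ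
    rw [one_div_pow]
    exact (one_div_le hδ (by positivity)).1 h1
  · have h1 := (Nat.ceil_lt_add_one (zero_le_one.trans hlog)).le
    have h2 : Real.logb 2 (1 / δ) * Real.log 2 = Real.log (1 / δ) :=
      div_mul_cancel₀ _ (Real.log_pos one_lt_two).ne'
    change (⌈Real.logb 2 (1 / δ)⌉₊ : ℝ) ≤ _
    nlinarith [Real.log_two_gt_d9]
  · have h1 := succ_div_le hTg hc hc3 hD hk (hcase.imp_right fun h => h.2)
    refine h1.trans ?_
    rw [← hc2]
    have h2 : D ≤ √(DV : ℝ) + DE :=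
      max_le (by linarith [Real.sqrt_nonneg (DV : ℝ)])
        (by linarith [(Nat.cast_nonneg DE : (0 : ℝ) ≤ DE)])
    have h3 : D * Real.log Tg / Tg ≤ (√(DV : ℝ) + DE) * Real.log Tg / Tg := by
      have := Real.log_nonneg hTg
      gcongr
    have e : (√(DV : ℝ) + DE) * Real.log Tg / Tg
        = √(DV : ℝ) * Real.log Tg / Tg + DE * Real.log Tg / Tg := by ring
    linarith

end Choice

end TriangleSampling

theorem mainTheorem1 :
    ∃ (params : (ε δ Tg : ℝ) → (DV DE : ℕ) → TriangleSampling.Params) (A : ℝ), 0 < A ∧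
      ∀ (ε δ Tg : ℝ) (DV DE : ℕ), 0 < ε → ε ≤ 1 → 0 < δ → δ ≤ 1 / 2 → 1 ≤ Tg →
      ∀ (V : Type u) [Fintype V] [DecidableEq V] (G : SimpleGraph V) (stream : List (Sym2 V)),
        stream.Nodup → (∀ e, e ∈ stream ↔ e ∈ G.edgeSet) →
        TriangleSampling.maxVertexTriangles G ≤ DV →
        TriangleSampling.maxEdgeTriangles G ≤ DE →
        -- expected number of kept edges
        ((∫⁻ σ : TriangleSampling.Seed (params ε δ Tg DV DE) V,
            ((TriangleSampling.onePass (params ε δ Tg DV DE) σ stream).card : ℝ≥0∞))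
          ≤ ENNReal.ofReal (A * (G.edgeSet.ncard * Real.log (1 / δ) / ε ^ 2 *
              (1 / Tg ^ (2 / 3 : ℝ) + √(DV : ℝ) * Real.log Tg / Tg
                + DE * Real.log Tg / Tg)))) ∧
        -- correctness for a valid guess
        (Tg ≤ TriangleSampling.numTriangles G →
          volume {σ : TriangleSampling.Seed (params ε δ Tg DV DE) V |
            ¬ TriangleSampling.IsApprox ε (TriangleSampling.numTriangles G)
              (TriangleSampling.output (params ε δ Tg DV DE) Tg stream σ)} ≤ ENNReal.ofReal δ) ∧
        -- correctness for a guess that is too large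
        (TriangleSampling.numTriangles G < Tg →
          volume {σ : TriangleSampling.Seed (params ε δ Tg DV DE) V |
            ¬ (TriangleSampling.output (params ε δ Tg DV DE) Tg stream σ = none ∨
              TriangleSampling.IsApprox ε (TriangleSampling.numTriangles G)
                (TriangleSampling.output (params ε δ Tg DV DE) Tg stream σ))}
            ≤ ENNReal.ofReal δ) := by
  have hex : ∀ (ε δ Tg : ℝ) (DV DE : ℕ), ∃ P : TriangleSampling.Params,
      0 < ε → ε ≤ 1 → 0 < δ → δ ≤ 1 / 2 → 1 ≤ Tg →
        P.Suitable Tg DV DE ∧ 2 ^ 20 / ε ^ 2 ≤ P.blockSize ∧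
        P.blockSize ≤ 2 ^ 21 / ε ^ 2 ∧ (1 / 2 : ℝ) ^ P.numBlocks ≤ δ ∧
        P.numBlocks ≤ 4 * Real.log (1 / δ) ∧
        (P.top + 1) / P.k ≤ 2 * (1 / Tg ^ (2 / 3 : ℝ) + √(DV : ℝ) * Real.log Tg / Tg
          + DE * Real.log Tg / Tg) := by
    intro ε δ Tg DV DE
    by_cases h : 0 < ε ∧ ε ≤ 1 ∧ 0 < δ ∧ δ ≤ 1 / 2 ∧ 1 ≤ Tg
    · obtain ⟨h1, h2, h3, h4, h5⟩ := h
      obtain ⟨P, hP⟩ := TriangleSampling.exists_params h1 h2 h3 h4 h5 DV DE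
      exact ⟨P, fun _ _ _ _ _ => hP⟩
    -- Any parameters will do outside the range of the theorem.
    · obtain ⟨P, -⟩ := TriangleSampling.exists_params (ε := 1) (δ := 1 / 2) (Tg := 1) one_pos le_rfl
        (by norm_num) le_rfl le_rfl DV DE
      exact ⟨P, fun h1 h2 h3 h4 h5 => absurd ⟨h1, h2, h3, h4, h5⟩ h⟩
  choose params hparams using hex
  -- `2 ^ 28 = 4 * 2 ^ 21 * (16 * 2)`: the factors come from the number of blocks, the block size,
  -- and the probability that a run keeps an edge.
  refine ⟨params, 2 ^ 28, by positivity, ?_⟩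
  intro ε δ Tg DV DE hε hε1 hδ hδ1 hTg V _ _ G stream _ hG hDV hDE
  obtain ⟨hP, hB, hB', hN, hN', hS⟩ := hparams ε δ Tg DV DE hε hε1 hδ hδ1 hTg
  refine ⟨?_, TriangleSampling.volume_not_isApprox_le hε hε1 hTg hP hB hN hG hDV hDE,
    TriangleSampling.volume_not_none_or_isApprox_le hε hε1 hTg hP hB hN hG hDV hDE⟩
  refine (TriangleSampling.lintegral_card_onePass_le hP.weight_top hG).trans
    (ENNReal.ofReal_le_ofReal ?_)
  have hlog : 0 ≤ Real.log (1 / δ) := Real.log_nonneg (by rw [le_div_iff₀ hδ]; linarith)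
  set P := params ε δ Tg DV DE
  set S := 1 / Tg ^ (2 / 3 : ℝ) + √(DV : ℝ) * Real.log Tg / Tg + DE * Real.log Tg / Tg
  have hk : 0 < P.k := zero_lt_one.trans_le P.one_le_k
  have hruns : (P.numBlocks : ℝ) * P.blockSize ≤ 4 * Real.log (1 / δ) * (2 ^ 21 / ε ^ 2) :=
    mul_le_mul hN' hB' (Nat.cast_nonneg _) (by positivity)
  have hrate : 16 * ((P.top : ℝ) + 1) / P.k ≤ 16 * (2 * S) := by
    rw [mul_div_assoc]
    exact mul_le_mul_of_nonneg_left hS (by norm_num)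
  calc (G.edgeSet.ncard : ℝ) * (P.numBlocks * P.blockSize * (16 * (P.top + 1) / P.k))
      ≤ G.edgeSet.ncard * (4 * Real.log (1 / δ) * (2 ^ 21 / ε ^ 2) * (16 * (2 * S))) :=
        mul_le_mul_of_nonneg_left
          (mul_le_mul hruns hrate (by positivity) (by positivity)) (Nat.cast_nonneg _)
    _ = 2 ^ 28 * (G.edgeSet.ncard * Real.log (1 / δ) / ε ^ 2 * S) := by ring
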